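/- Let $W\subseteq V$ be transitive models of $\mathsf{ZFC}$ (sets or proper classes). Assume that $V\models\mathsf{CP}$, and let $\kappa$ be an ordinal such that $(2^{\omega})^V<\kappa$, $\kappa$ is the least ordinal with $([\kappa]^{\omega})^V\not\subseteq W$, and $(\kappa^+)^W=(\kappa^+)^V$ (here $\kappa^+$ is the least cardinal, in the respective model, greater than $\kappa$; write $\kappa^+$ for the common value). Then: (1) $\kappa^+$ is $W$-Jónsson in $V$: for every $\psi:[\kappa^+]^{<\omega}\to\kappa^+$ with $\psi\in W$ there is in $V$ a proper subset $Y$ of $\kappa^+$ with $|Y|=\kappa^+$ which is $\psi$-closed, i.e. $\psi(s)\in Y$ for all $s\in[Y]^{<\omega}$. (2) If moreover $W$ and $V$ have the same bounded subsets of $\kappa$, then $\kappa$ is a Jónsson cardinal in $W$: in $W$, $\kappa$ is a cardinal and for every $\psi:[\kappa]^{<\omega}\to\kappa$ there is a $\psi$-closed proper subset $Y$ of $\kappa$ with $|Y|=\kappa$. Here $\mathsf{CP}$ is the following statement. For a regular cardinal $\theta>\omega$, a covering matrix for $\theta$ is a family $(K(n,\beta):n<\omega,\ \beta<\theta)$ of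 subsets of $\theta$ such that (i) $\beta\subseteq\bigcup_{n}K(n,\beta)$ for all $\beta<\theta$; (ii) $|K(n,\beta)|<\theta$ for all $n,\beta$; (iii) $K(n,\beta)\subseteq K(m,\beta)$ for all $\beta<\theta$ and $n<m<\omega$; (iv) for all $\gamma<\beta<\theta$ and $n<\omega$ there is $m<\omega$ with $K(n,\gamma)\subseteq K(m,\beta)$; (v) for every $X\subseteq\theta$ with $|X|\le\omega$ there is $\gamma_X<\theta$ such that for all $\beta<\theta$ and $n<\omega$ there is $m<\omega$ with $K(n,\beta)\cap X\subseteq K(m,\gamma_X)$. $\mathsf{CP}$ asserts that for every regular $\theta>2^{\omega}$ and every covering matrix $(K(n,\beta))$ for $\theta$ there is an unbounded $A\subseteq\theta$ such that every $X\in[A]^{\omega}$ is contained in some $K(n,\beta)$. -/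

import Mathlib

universe u

namespace InnerModel

/-! ### Transitive models of ZFC -/

/-- The only symbol of the language of set theory: a binary relation symbol. -/
inductive SetRel : ℕ → Type
  | mem : SetRel 2

/-- The first-order language of set theory. -/
def setLang : FirstOrder.Language := ⟨fun _ => Empty, SetRel⟩

/-- A collection `M` of sets (a set or a proper class) as the structure `(M, ∈)`. -/
instance setStructure (M : Set ZFSet.{u}) : setLang.Structure M where
  funMap := fun f => f.elim
  RelMap := fun {n} (r : SetRel n) =>
    match n, r with
    | _, SetRel.mem => fun v => (v 0).1 ∈ (v 1).1

/-- `M` (a set or a proper class) is transitive and `(M, ∈)` satisfies the axioms of ZFC. In the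
two schemata, the first-order formulas with parameters in `M` appear through the subsets of `M` and
of `M × M` that they define over `(M, ∈)`. -/
structure IsTransitiveModelZFC (M : Set ZFSet.{u}) : Prop where
  transitive : ∀ x ∈ M, ∀ y ∈ x, y ∈ M
  extensionality : ∀ x y : M, (∀ z : M, z.1 ∈ x.1 ↔ z.1 ∈ y.1) → x = y
  foundation : ∀ x : M, (∃ y : M, y.1 ∈ x.1) →
    ∃ y : M, y.1 ∈ x.1 ∧ ∀ z : M, z.1 ∈ y.1 → z.1 ∉ x.1
  pairing : ∀ x y : M, ∃ z : M, ∀ w : M, w.1 ∈ z.1 ↔ w = x ∨ w = y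
  union : ∀ x : M, ∃ z : M, ∀ w : M, w.1 ∈ z.1 ↔ ∃ y : M, y.1 ∈ x.1 ∧ w.1 ∈ y.1
  powerset : ∀ x : M, ∃ z : M, ∀ w : M, w.1 ∈ z.1 ↔ ∀ v : M, v.1 ∈ w.1 → v.1 ∈ x.1
  infinity : ∃ z : M, (∃ e : M, e.1 ∈ z.1 ∧ ∀ w : M, w.1 ∉ e.1) ∧
    ∀ x : M, x.1 ∈ z.1 → ∃ y : M, y.1 ∈ z.1 ∧ ∀ w : M, w.1 ∈ y.1 ↔ w.1 ∈ x.1 ∨ w = x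
  separation : ∀ D : Set M, (Set.univ : Set M).Definable₁ setLang D →
    ∀ a : M, ∃ b : M, ∀ x : M, x.1 ∈ b.1 ↔ x.1 ∈ a.1 ∧ x ∈ D
  replacement : ∀ R : Set (M × M), (Set.univ : Set M).Definable₂ setLang R →
    ∀ a : M, (∀ x : M, x.1 ∈ a.1 → ∃! y : M, (x, y) ∈ R) →
      ∃ b : M, ∀ y : M, y.1 ∈ b.1 ↔ ∃ x : M, x.1 ∈ a.1 ∧ (x, y) ∈ R
  choice : ∀ x : M, (∀ y : M, y.1 ∈ x.1 → ∃ z : M, z.1 ∈ y.1) →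
    (∀ y z w : M, y.1 ∈ x.1 → z.1 ∈ x.1 → w.1 ∈ y.1 → w.1 ∈ z.1 → y = z) →
    ∃ c : M, ∀ y : M, y.1 ∈ x.1 → ∃! w : M, w.1 ∈ y.1 ∧ w.1 ∈ c.1

/-! ### Functions and cardinalities, computed in a transitive model

The notions "ordinal", "ordered pair", "function from `x` to `y`", "finite" and `ω` are absolute
for transitive models, so they are used as they are; the notions that quantify over sets are
relativized to `M`. -/

/-- The value at `x` of the (set-theoretic) function `f`. -/
noncomputable def app (f x : ZFSet.{u}) : ZFSet.{u} :=
  ZFSet.sUnion (ZFSet.sep (fun y => ZFSet.pair x y ∈ f) (ZFSet.sUnion (ZFSet.sUnion f)))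

/-- `M ⊨ |x| ≤ |y|`: some injection from `x` to `y` belongs to `M`. -/
def CardLEIn (M : Set ZFSet.{u}) (x y : ZFSet.{u}) : Prop :=
  ∃ f ∈ M, ZFSet.IsFunc x y f ∧
    ∀ a b c : ZFSet.{u}, ZFSet.pair a c ∈ f → ZFSet.pair b c ∈ f → a = b

/-- `M ⊨ |x| = |y|`: some bijection from `x` onto `y` belongs to `M`. -/
def SameCardIn (M : Set ZFSet.{u}) (x y : ZFSet.{u}) : Prop :=
  ∃ f ∈ M, ZFSet.IsFunc x y f ∧
    (∀ a b c : ZFSet.{u}, ZFSet.pair a c ∈ f → ZFSet.pair b c ∈ f → a = b) ∧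
    ∀ c ∈ y, ∃ a ∈ x, ZFSet.pair a c ∈ f

/-- `M ⊨ |x| < |y|`. -/
def CardLTIn (M : Set ZFSet.{u}) (x y : ZFSet.{u}) : Prop :=
  CardLEIn M x y ∧ ¬ CardLEIn M y x

/-- `M ⊨ κ is a cardinal`. -/
def IsCardinalIn (M : Set ZFSet.{u}) (κ : ZFSet.{u}) : Prop :=
  κ ∈ M ∧ κ.IsOrdinal ∧ ∀ α ∈ κ, ¬ CardLEIn M κ α

/-- `M ⊨ μ = κ⁺`: `μ` is the least cardinal of `M` above the ordinal `κ`. -/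
def IsSuccCardIn (M : Set ZFSet.{u}) (κ μ : ZFSet.{u}) : Prop :=
  IsCardinalIn M μ ∧ κ ∈ μ ∧ ∀ ν ∈ μ, κ ∈ ν → ¬ IsCardinalIn M ν

/-- `M ⊨ κ is an infinite regular cardinal`: no function in `M` from a smaller ordinal to `κ` is
unbounded in `κ`. -/
def IsRegularIn (M : Set ZFSet.{u}) (κ : ZFSet.{u}) : Prop :=
  IsCardinalIn M κ ∧ ZFSet.omega ⊆ κ ∧
    ∀ α ∈ κ, ∀ f ∈ M, ZFSet.IsFunc α κ f → ∃ β ∈ κ, ∀ γ ∈ α, app f γ ∈ β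

/-- `M ⊨ c = 2^ω`. -/
def IsContinuumIn (M : Set ZFSet.{u}) (c : ZFSet.{u}) : Prop :=
  IsCardinalIn M c ∧ ∃ p ∈ M, (∀ x ∈ M, x ∈ p ↔ x ⊆ ZFSet.omega) ∧ SameCardIn M p c

/-- `M ⊨ 2^ω < κ`, for an ordinal `κ`. -/
def ContinuumLTIn (M : Set ZFSet.{u}) (κ : ZFSet.{u}) : Prop :=
  ∃ c ∈ κ, IsContinuumIn M c

/-! ### Covering matrices and the covering property -/

/-- `M ⊨ K is a lam-covering matrix for κ`. The matrix is the function
`K : lam × κ → P(κ)`, with entry `K(α, β) = app K (pair α β)`. -/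
structure IsCoveringMatrixIn (M : Set ZFSet.{u}) (lam κ K : ZFSet.{u}) : Prop where
  mem : K ∈ M
  isFunc : ZFSet.IsFunc (ZFSet.prod lam κ) (ZFSet.powerset κ) K
  cover : ∀ β ∈ κ, ∀ ξ ∈ β, ∃ α ∈ lam, ξ ∈ app K (ZFSet.pair α β)
  small : ∀ α ∈ lam, ∀ β ∈ κ, CardLTIn M (app K (ZFSet.pair α β)) κ
  mono : ∀ β ∈ κ, ∀ η ∈ lam, ∀ α ∈ η, app K (ZFSet.pair α β) ⊆ app K (ZFSet.pair η β)
  coherent : ∀ β ∈ κ, ∀ γ ∈ β, ∀ α ∈ lam, ∃ η ∈ lam,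
    app K (ZFSet.pair α γ) ⊆ app K (ZFSet.pair η β)
  localized : ∀ X ∈ M, X ⊆ κ → CardLEIn M X lam → ∃ γ ∈ κ, ∀ β ∈ κ, ∀ η ∈ lam, ∃ α ∈ lam,
    app K (ZFSet.pair η β) ∩ X ⊆ app K (ZFSet.pair α γ)

/-- `M ⊨ CP(κ, lam)`: for every `lam`-covering matrix for `κ` there is an unbounded `A ⊆ κ` such
that every subset of `A` of size `lam` is contained in an entry of the matrix. -/
def CoveringPropertyIn (M : Set ZFSet.{u}) (κ lam : ZFSet.{u}) : Prop :=
  ∀ K, IsCoveringMatrixIn M lam κ K →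
    ∃ A ∈ M, A ⊆ κ ∧ (∀ α ∈ κ, ∃ β ∈ A, α ⊆ β) ∧
      ∀ X ∈ M, X ⊆ A → SameCardIn M X lam →
        ∃ α ∈ lam, ∃ β ∈ κ, X ⊆ app K (ZFSet.pair α β)

/-- `M ⊨ CP`: `CP(κ, ω)` holds for all regular `κ > 2^ω`. -/
def CPIn (M : Set ZFSet.{u}) : Prop :=
  ∀ κ ∈ M, IsRegularIn M κ → ContinuumLTIn M κ → CoveringPropertyIn M κ ZFSet.omega

/-! ### Jónsson cardinals -/

/-- `[x]^{<ω}`, the set of finite subsets of `x`. -/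
noncomputable def finSubsets (x : ZFSet.{u}) : ZFSet.{u} :=
  ZFSet.sep (fun s => (s : Set ZFSet.{u}).Finite) (ZFSet.powerset x)

/-- `M ⊨ κ is E-Jónsson`: `κ` is a cardinal, and every function `ψ : [κ]^{<ω} → κ` in `E` has a
`ψ`-closed proper subset `Y` of `κ` in `M` with `|Y| = κ`. -/
def IsJonssonIn (M E : Set ZFSet.{u}) (κ : ZFSet.{u}) : Prop :=
  IsCardinalIn M κ ∧ ∀ ψ ∈ E, ZFSet.IsFunc (finSubsets κ) κ ψ →
    ∃ Y ∈ M, Y ⊆ κ ∧ Y ≠ κ ∧ SameCardIn M Y κ ∧ ∀ s ∈ finSubsets Y, app ψ s ∈ Y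

end InnerModel

open InnerModel

/-!
Call a set `S` *sequence-closed* if every `ω`-sequence of elements of `S` in `V` belongs to `W`.
By the choice of `κ`, ordinals below `κ` are sequence-closed and `κ` is not; so `κ` is a cardinal of
`W`, and it has a cofinal `ω`-sequence `h` in `V` (`seqClosed_of_mem`, `not_seqClosed`,
`isCardinalIn_of_new`, `exists_cofinal_seq`).

The closure in `V` of a sequence-closed set under a binary operation of `W` is sequence-closed
(`SeqClosed.opClosure`): a sequence in the closure lies in the closure of a sequence of generators,
that sequence belongs to `W`, and there its closure is countable. Applied to the algebra of finite
sets, this closes a set under a function on finite sets (`exists_seqClosed_closure`).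

Since `κ⁺` is the same in `W` and `V`, the model `W` has injections `Φ_β : β → κ` for `β < κ⁺`.
Let `K(n, β)` be the set of ordinals below `β` in the closure of `{β} ∪ (h 0 + 1) ∪ ⋯ ∪ (h n + 1)`
under the operation that computes `ξ` from `γ` and `Φ_γ(ξ)`. This is a covering matrix with
sequence-closed entries (`exists_coveringMatrix`), so by the covering property some unbounded
`A ⊆ κ⁺` is sequence-closed (`CoveringPropertyIn.exists_seqClosed`). For `ψ` in `W`, the closure `Y`
of `A` under `ψ` is sequence-closed and has size `κ⁺`; it is not `κ⁺`, as `κ` is not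
sequence-closed (`isJonssonIn_of_seqClosed`).

If moreover `W` and `V` have the same bounded subsets of `κ`, then `κ` is a cardinal of `V`
(`isCardinalIn_of_bounded`). An initial segment of `A` of type `κ` is moved by some `Φ_β` to a
sequence-closed `B ⊆ κ` of size `κ` (`exists_seqClosed_subset`). A cofinal `ω`-sequence `x` in `B`
belongs to `W`. The `ψ`-closure `Z` of `B` omits some `δ < κ` and has order type `κ`, but it need
not belong to `W`. Its bounded parts do, and they form an infinite branch through the tree of those
bounded subsets of `κ` in `W` that omit `δ`, are closed under `ψ` as far as their bound permits, and
have order type at least `x n` at level `n + 1` (`exists_pruned_tree`). Well-foundedness is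
absolute, so this tree has an infinite branch in `W` too; its union is as required
(`exists_closed_of_pruned_tree`).

All this is carried out inside transitive models, in which separation and replacement are available
for definable classes only. Definability is derived by instance inference from the shape of an
expression: see `IsDef`, `IsTerm` and `mem_model_of_isTerm`.
-/

namespace InnerModel

open FirstOrder

variable {M : Set ZFSet.{u}}

/-! ### Definability over a model -/

/-- `P` is definable over `(M, ∈)` with parameters from `M`. The argument of `P` assigns values to
infinitely many variables, of which a formula uses finitely many. A quantifier is a shift of the
variables: in the instances below, `v 0` is the bound variable and `fun i => v (i + 1)` assigns
values to the others. -/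
class IsDef (M : Set ZFSet.{u}) (P : (ℕ → M) → Prop) : Prop where
  definable : (Set.univ : Set M).Definable setLang {v | P v}

/-- `t` is a definable class function of the variables with values in `M`: its graph is definable
over `(M, ∈)` with parameters from `M`. -/
class IsTerm (M : Set ZFSet.{u}) (t : (ℕ → M) → ZFSet.{u}) : Prop where
  mem : ∀ v, t v ∈ M
  isDef : IsDef M fun v => (v 0).1 = t fun i => v (i + 1)

/-- `c` belongs to `M`, so it may occur as a parameter in a definition over `M`. Being a class, this
makes parameters visible to instance inference. -/
class Param (M : Set ZFSet.{u}) (c : ZFSet.{u}) : Prop where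
  mem : c ∈ M

theorem IsDef.congr {P Q : (ℕ → M) → Prop} (h : IsDef M P) (hPQ : ∀ v, P v ↔ Q v) : IsDef M Q := by
  have : P = Q := funext fun v => propext (hPQ v)
  exact this ▸ h

theorem IsDef.subst {P : (ℕ → M) → Prop} (h : IsDef M P) (σ : ℕ → ℕ) :
    IsDef M fun v => P fun i => v (σ i) :=
  ⟨h.definable.preimage_comp σ⟩

instance IsDef.and {P Q : (ℕ → M) → Prop} [hP : IsDef M P] [hQ : IsDef M Q] :
    IsDef M fun v => P v ∧ Q v :=
  ⟨hP.definable.inter hQ.definable⟩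

instance IsDef.or {P Q : (ℕ → M) → Prop} [hP : IsDef M P] [hQ : IsDef M Q] :
    IsDef M fun v => P v ∨ Q v :=
  ⟨hP.definable.union hQ.definable⟩

instance IsDef.not {P : (ℕ → M) → Prop} [hP : IsDef M P] : IsDef M fun v => ¬ P v :=
  ⟨hP.definable.compl⟩

instance IsDef.false : IsDef M fun _ => False := ⟨by simp⟩

instance IsDef.imp {P Q : (ℕ → M) → Prop} [IsDef M P] [IsDef M Q] :
    IsDef M fun v => P v → Q v :=
  IsDef.congr (P := fun v => ¬ P v ∨ Q v) inferInstance fun _ => imp_iff_not_or.symm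

instance IsDef.iff {P Q : (ℕ → M) → Prop} [IsDef M P] [IsDef M Q] :
    IsDef M fun v => (P v ↔ Q v) :=
  IsDef.congr (P := fun v => (P v → Q v) ∧ (Q v → P v)) inferInstance
    fun _ => iff_iff_implies_and_implies.symm

theorem IsDef.ex {P : (ℕ → M) → Prop} (h : IsDef M P) :
    IsDef M fun v => ∃ x : M, P fun i => Nat.casesOn i x v := by
  let σ : ℕ → ℕ ⊕ Unit := fun i => Nat.casesOn i (Sum.inr ()) Sum.inl
  have h1 := h.definable.preimage_comp σ
  refine ⟨?_⟩
  convert h1.exists_of_finite using 1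
  ext v
  simp only [Set.mem_ofPred_eq, Set.mem_preimage]
  constructor
  · rintro ⟨x, hx⟩
    refine ⟨fun _ => x, ?_⟩
    convert hx using 2 with i
    cases i <;> rfl
  · rintro ⟨x, hx⟩
    refine ⟨x (), ?_⟩
    convert hx using 2 with i
    cases i <;> rfl

theorem IsDef.exists_model {Q : (ℕ → M) → ZFSet.{u} → Prop}
    (h : IsDef M fun v => Q (fun i => v (i + 1)) (v 0).1) : IsDef M fun v => ∃ x, x ∈ M ∧ Q v x :=
  h.ex.congr fun v => by simp

theorem isDef_var_mem (i j : ℕ) : IsDef M fun v => (v i).1 ∈ (v j).1 := by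
  refine ⟨⟨Language.Relations.formula₂ (Sum.inl SetRel.mem) (Language.Term.var i)
    (Language.Term.var j), ?_⟩⟩
  ext v
  simp
  rfl

theorem isDef_var_eq (i j : ℕ) : IsDef M fun v => (v i).1 = (v j).1 := by
  refine ⟨⟨Language.Term.equal (Language.Term.var i) (Language.Term.var j), ?_⟩⟩
  ext v
  simp [Language.Formula.realize_equal, Subtype.ext_iff]

theorem isDef_var_eq_const (i : ℕ) {c : ZFSet.{u}} (hc : c ∈ M) : IsDef M fun v => (v i).1 = c := by
  refine ⟨⟨Language.Term.equal (Language.Term.var i)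
    (setLang.con (⟨⟨c, hc⟩, trivial⟩ : (Set.univ : Set M))).term, ?_⟩⟩
  ext v
  simp [Language.Formula.realize_equal, Subtype.ext_iff]

instance IsTerm.var (i : ℕ) : IsTerm M fun v => (v i).1 :=
  ⟨fun v => (v i).2, isDef_var_eq 0 (i + 1)⟩

instance IsTerm.const (c : ZFSet.{u}) [hc : Param M c] : IsTerm M fun _ => c :=
  ⟨fun _ => hc.mem, isDef_var_eq_const 0 hc.mem⟩

/-- Renaming of variables. Instance inference does not find renamings, so the shifted terms needed
under binders are supplied by hand. -/
theorem IsTerm.subst {t : (ℕ → M) → ZFSet.{u}} (h : IsTerm M t) (σ : ℕ → ℕ) :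
    IsTerm M fun v => t fun i => v (σ i) :=
  ⟨fun _ => h.mem _, h.isDef.subst fun i => Nat.casesOn i 0 fun j => σ j + 1⟩

instance IsDef.eq {s t : (ℕ → M) → ZFSet.{u}} [hs : IsTerm M s] [ht : IsTerm M t] :
    IsDef M fun v => s v = t v := by
  have h1 : IsDef M fun v => ∃ x, x ∈ M ∧ (x = s v ∧ x = t v) := by
    apply IsDef.exists_model (Q := fun v x => x = s v ∧ x = t v)
    exact IsDef.and (hP := hs.isDef) (hQ := ht.isDef)
  refine h1.congr fun v => ?_
  constructor
  · rintro ⟨x, -, h, h'⟩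
    rw [← h, ← h']
  · intro h
    exact ⟨s v, hs.mem v, rfl, h⟩

instance IsDef.mem {s t : (ℕ → M) → ZFSet.{u}} [hs : IsTerm M s] [ht : IsTerm M t] :
    IsDef M fun v => s v ∈ t v := by
  have h0 : IsDef M fun v => ∃ y, y ∈ M ∧ (y = t (fun i => v (i + 1)) ∧ (v 0).1 ∈ y) := by
    apply IsDef.exists_model (Q := fun v x => x = t (fun i => v (i + 1)) ∧ (v 0).1 ∈ x)
    exact IsDef.and (hP := ht.isDef.subst fun i => Nat.casesOn i 0 fun j => j + 2)
      (hQ := isDef_var_mem 1 0)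
  have h1 : IsDef M fun v => ∃ x, x ∈ M ∧ (x = s v ∧ ∃ y, y ∈ M ∧ (y = t v ∧ x ∈ y)) := by
    apply IsDef.exists_model (Q := fun v x => x = s v ∧ ∃ y, y ∈ M ∧ (y = t v ∧ x ∈ y))
    exact IsDef.and (hP := hs.isDef) (hQ := h0)
  refine h1.congr fun v => ?_
  constructor
  · rintro ⟨x, -, rfl, y, -, rfl, h⟩
    exact h
  · intro h
    exact ⟨_, hs.mem v, rfl, _, ht.mem v, rfl, h⟩

instance IsDef.exists_mem_model {Q : (ℕ → M) → ZFSet.{u} → Prop}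
    [h : IsDef M fun v => Q (fun i => v (i + 1)) (v 0).1] : IsDef M fun v => ∃ x, x ∈ M ∧ Q v x :=
  IsDef.exists_model h

instance IsDef.forall_mem_model {Q : (ℕ → M) → ZFSet.{u} → Prop}
    [h : IsDef M fun v => Q (fun i => v (i + 1)) (v 0).1] : IsDef M fun v => ∀ x, x ∈ M → Q v x :=
  IsDef.congr (P := fun v => ¬ ∃ x, x ∈ M ∧ ¬ Q v x) inferInstance fun v => by push Not; rfl

/-- Fixing some variables turns them into parameters. -/
theorem IsDef.freeze {P : (ℕ → M) → Prop} (h : IsDef M P) (σ : ℕ → ℕ ⊕ M) :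
    IsDef M fun w => P fun i => Sum.elim w id (σ i) := by
  obtain ⟨φ, hφ⟩ := h.definable
  refine ⟨⟨φ.subst fun i => Sum.elim Language.Term.var
    (fun c => (setLang.con (⟨c, trivial⟩ : (Set.univ : Set M))).term) (σ i), ?_⟩⟩
  ext w
  have h1 : P (fun i => Sum.elim w id (σ i)) ↔ φ.Realize (fun i => Sum.elim w id (σ i)) := by
    rw [← Set.mem_ofPred_eq (p := fun v => φ.Realize v), ← hφ]
    rfl
  rw [Set.mem_ofPred_eq, Set.mem_ofPred_eq, h1, Language.Formula.Realize, Language.Formula.Realize,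
    Language.BoundedFormula.realize_subst]
  apply iff_of_eq
  congr 1
  funext i
  rcases σ i with k | c <;> simp

/-- Substitution of terms into a definable binary predicate. -/
theorem IsDef.comp₂ {R : ZFSet.{u} → ZFSet.{u} → Prop} (hR : IsDef M fun v => R (v 0).1 (v 1).1)
    {s t : (ℕ → M) → ZFSet.{u}} [hs : IsTerm M s] [ht : IsTerm M t] :
    IsDef M fun v => R (s v) (t v) := by
  have := ht.subst Nat.succ
  let σ : ℕ → ℕ := fun i => Nat.casesOn i 1 fun _ => 0
  have : IsDef M fun v => R (v 1).1 (v 0).1 := hR.subst σ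
  refine IsDef.congr (P := fun v => ∃ x, x ∈ M ∧ (x = s v ∧ ∃ y, y ∈ M ∧ (y = t v ∧ R x y)))
    ?_ fun v => ?_
  · have := hs.subst Nat.succ
    have := ht.subst (· + 2)
    infer_instance
  · constructor
    · rintro ⟨_, -, rfl, _, -, rfl, h⟩
      exact h
    · exact fun h => ⟨_, hs.mem v, rfl, _, ht.mem v, rfl, h⟩

theorem IsTerm.comp₁ {F : ZFSet.{u} → ZFSet.{u}} (hF : IsTerm M fun v => F (v 0).1)
    {s : (ℕ → M) → ZFSet.{u}} [hs : IsTerm M s] : IsTerm M fun v => F (s v) := by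
  have := hs.subst Nat.succ
  let σ : ℕ → ℕ := fun i => Nat.casesOn i 1 fun _ => 0
  refine ⟨fun v => hF.mem fun _ => ⟨s v, hs.mem v⟩, ?_⟩
  exact IsDef.comp₂ (R := fun y x => x = F y) (hF.isDef.subst σ)

/-! ### Closure properties of transitive models -/

variable [hM : Fact (IsTransitiveModelZFC M)]

theorem mem_of_mem_model {x y : ZFSet.{u}} (hy : y ∈ M) (hx : x ∈ y) : x ∈ M :=
  hM.out.transitive y hy x hx

instance IsDef.exists_mem {t : (ℕ → M) → ZFSet.{u}} {Q : (ℕ → M) → ZFSet.{u} → Prop}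
    [ht : IsTerm M t] [h : IsDef M fun v => Q (fun i => v (i + 1)) (v 0).1] :
    IsDef M fun v => ∃ x, x ∈ t v ∧ Q v x :=
  have := ht.subst Nat.succ
  IsDef.congr (P := fun v => ∃ x, x ∈ M ∧ (x ∈ t v ∧ Q v x))
    (IsDef.exists_model (Q := fun v x => x ∈ t v ∧ Q v x)
      (IsDef.and (hP := IsDef.mem (t := fun v => t fun i => v (i + 1))) (hQ := h)))
    fun v => exists_congr fun _ => and_iff_right_of_imp fun hx =>
      mem_of_mem_model (ht.mem v) hx.1

instance IsDef.forall_mem {t : (ℕ → M) → ZFSet.{u}} {Q : (ℕ → M) → ZFSet.{u} → Prop}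
    [ht : IsTerm M t] [h : IsDef M fun v => Q (fun i => v (i + 1)) (v 0).1] :
    IsDef M fun v => ∀ x, x ∈ t v → Q v x :=
  IsDef.congr (P := fun v => ¬ ∃ x, x ∈ t v ∧ ¬ Q v x) inferInstance fun v => by push Not; rfl

instance IsDef.subset {s t : (ℕ → M) → ZFSet.{u}} [hs : IsTerm M s] [ht : IsTerm M t] :
    IsDef M fun v => s v ⊆ t v :=
  have := ht.subst Nat.succ
  IsDef.congr (P := fun v => ∀ x, x ∈ s v → x ∈ t v)
    (IsDef.forall_mem (h := IsDef.mem (t := fun v => t fun i => v (i + 1)))) fun _ => Iff.rfl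

/-- A definable class function with values in the model is a term as soon as membership in its
values is definable. -/
theorem IsTerm.of_mem {t : (ℕ → M) → ZFSet.{u}} (hmem : ∀ v, t v ∈ M)
    (h : IsDef M fun v => (v 0).1 ∈ t fun i => v (i + 1)) : IsTerm M t := by
  refine ⟨hmem, ?_⟩
  have h1 : IsDef M fun v => ∀ x, x ∈ M → (x ∈ (v 0).1 ↔ x ∈ t fun i => v (i + 1)) := by
    have h2 : IsDef M fun v => (v 0).1 ∈ t fun i => v (i + 2) :=
      h.subst fun i => Nat.casesOn i 0 fun j => j + 2
    exact IsDef.forall_mem_model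
  refine h1.congr fun v => ⟨fun h => ZFSet.ext fun x => ⟨fun hx => ?_, fun hx => ?_⟩, ?_⟩
  · exact (h x (mem_of_mem_model (v 0).2 hx)).1 hx
  · exact (h x (mem_of_mem_model (hmem _) hx)).2 hx
  · rintro h x -
    rw [h]

/-- Separation in the model. -/
theorem sep_mem_model {P : ZFSet.{u} → Prop} {a : ZFSet.{u}} (ha : a ∈ M)
    [h : IsDef M fun v => P (v 0).1] : ZFSet.sep P a ∈ M := by
  have hD : (Set.univ : Set M).Definable₁ setLang {x | P x.1} :=
    (h.definable.preimage_comp (fun _ => 0 : ℕ → Fin 1) :)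
  obtain ⟨b, hb⟩ := hM.out.separation _ hD ⟨a, ha⟩
  convert b.2
  ext x
  rw [ZFSet.mem_sep]
  constructor
  · rintro ⟨hx, hP⟩
    exact (hb ⟨x, mem_of_mem_model ha hx⟩).2 ⟨hx, hP⟩
  · intro hx
    exact (hb ⟨x, mem_of_mem_model b.2 hx⟩).1 hx

theorem pairSet_mem_model {x y : ZFSet.{u}} (hx : x ∈ M) (hy : y ∈ M) :
    ({x, y} : ZFSet) ∈ M := by
  obtain ⟨z, hz⟩ := hM.out.pairing ⟨x, hx⟩ ⟨y, hy⟩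
  convert z.2
  ext w
  rw [ZFSet.mem_pair]
  constructor
  · rintro (rfl | rfl)
    · exact (hz ⟨_, hx⟩).2 (Or.inl rfl)
    · exact (hz ⟨_, hy⟩).2 (Or.inr rfl)
  · intro hw
    simpa using (hz ⟨w, mem_of_mem_model z.2 hw⟩).1 hw

theorem singleton_mem_model {x : ZFSet.{u}} (hx : x ∈ M) : ({x} : ZFSet) ∈ M := by
  rw [← ZFSet.pair_eq_singleton]
  exact pairSet_mem_model hx hx

theorem sUnion_mem_model {x : ZFSet.{u}} (hx : x ∈ M) : ZFSet.sUnion x ∈ M := by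
  obtain ⟨z, hz⟩ := hM.out.union ⟨x, hx⟩
  convert z.2
  ext w
  rw [ZFSet.mem_sUnion]
  constructor
  · rintro ⟨y, hy, hw⟩
    have hyM := mem_of_mem_model hx hy
    exact (hz ⟨w, mem_of_mem_model hyM hw⟩).2 ⟨⟨y, hyM⟩, hy, hw⟩
  · intro hw
    obtain ⟨y, hy, hw⟩ := (hz ⟨w, mem_of_mem_model z.2 hw⟩).1 hw
    exact ⟨y, hy, hw⟩

theorem union_mem_model {x y : ZFSet.{u}} (hx : x ∈ M) (hy : y ∈ M) : x ∪ y ∈ M :=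
  sUnion_mem_model (pairSet_mem_model hx hy)

theorem insert_mem_model {x y : ZFSet.{u}} (hx : x ∈ M) (hy : y ∈ M) : insert x y ∈ M := by
  rw [ZFSet.insert_eq]
  exact union_mem_model (singleton_mem_model hx) hy

theorem pair_mem_model {x y : ZFSet.{u}} (hx : x ∈ M) (hy : y ∈ M) : ZFSet.pair x y ∈ M :=
  pairSet_mem_model (singleton_mem_model hx) (pairSet_mem_model hx hy)

/-- The powerset of `x` computed in the model. -/
theorem exists_powerset_model {x : ZFSet.{u}} (hx : x ∈ M) :
    ∃ p ∈ M, ∀ y, y ∈ p ↔ y ∈ M ∧ y ⊆ x := by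
  obtain ⟨z, hz⟩ := hM.out.powerset ⟨x, hx⟩
  refine ⟨z.1, z.2, fun y => ⟨fun hy => ?_, fun hy => ?_⟩⟩
  · have hyM := mem_of_mem_model z.2 hy
    exact ⟨hyM, fun w hw => (hz ⟨y, hyM⟩).1 hy ⟨w, mem_of_mem_model hyM hw⟩ hw⟩
  · exact (hz ⟨y, hy.1⟩).2 fun v hv => hy.2 hv

section terms
variable {s t : (ℕ → M) → ZFSet.{u}} [hs : IsTerm M s] [ht : IsTerm M t]

instance IsTerm.insert : IsTerm M fun v => insert (s v) (t v) :=
  have := hs.subst Nat.succ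
  have := ht.subst Nat.succ
  IsTerm.of_mem (fun v => insert_mem_model (hs.mem v) (ht.mem v))
    (IsDef.congr (P := fun v => (v 0).1 = s (fun i => v (i + 1)) ∨ (v 0).1 ∈ t fun i => v (i + 1))
      inferInstance fun v => by rw [ZFSet.mem_insert_iff])

instance IsTerm.singleton : IsTerm M fun v => ({s v} : ZFSet) :=
  have := hs.subst Nat.succ
  IsTerm.of_mem (fun v => singleton_mem_model (hs.mem v))
    (IsDef.congr (P := fun v => (v 0).1 = s (fun i => v (i + 1)))
      inferInstance fun v => by rw [ZFSet.mem_singleton])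

instance IsTerm.pair : IsTerm M fun v => ZFSet.pair (s v) (t v) := by
  unfold ZFSet.pair
  infer_instance

instance IsTerm.sUnion : IsTerm M fun v => ZFSet.sUnion (s v) := by
  have := hs.subst Nat.succ
  refine IsTerm.of_mem (fun v => sUnion_mem_model (hs.mem v))
    (IsDef.congr (P := fun v => ∃ y, y ∈ s (fun i => v (i + 1)) ∧ (v 0).1 ∈ y)
      ?_ fun v => by rw [ZFSet.mem_sUnion])
  infer_instance

instance IsTerm.union : IsTerm M fun v => s v ∪ t v :=
  have := hs.subst Nat.succ
  have := ht.subst Nat.succ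
  IsTerm.of_mem (fun v => union_mem_model (hs.mem v) (ht.mem v))
    (IsDef.congr (P := fun v => (v 0).1 ∈ s (fun i => v (i + 1)) ∨ (v 0).1 ∈ t fun i => v (i + 1))
      inferInstance fun v => by rw [ZFSet.mem_union])

instance IsTerm.sep {Q : (ℕ → M) → ZFSet.{u} → Prop}
    [h : IsDef M fun v => Q (fun i => v (i + 1)) (v 0).1] :
    IsTerm M fun v => ZFSet.sep (Q v) (s v) := by
  have := hs.subst Nat.succ
  have h2 : IsDef M fun v => Q (fun i => v (i + 1)) (v 0).1 := h
  refine IsTerm.of_mem (fun v => ?_)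
    (IsDef.congr (P := fun v => (v 0).1 ∈ s (fun i => v (i + 1)) ∧ Q (fun i => v (i + 1)) (v 0).1)
      inferInstance fun v => by rw [ZFSet.mem_sep])
  let σ : ℕ → ℕ ⊕ M := fun i => Nat.casesOn i (Sum.inl 0) fun j => Sum.inr (v j)
  have : IsDef M fun w => Q v (w 0).1 := h.freeze σ
  exact sep_mem_model (hs.mem v)

instance IsTerm.inter : IsTerm M fun v => s v ∩ t v := by
  have := ht.subst Nat.succ
  have : IsTerm M fun v => ZFSet.sep (fun x => x ∈ t v) (s v) :=
    IsTerm.sep (h := IsDef.mem (t := fun v => t fun i => v (i + 1)))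
  exact this

instance IsTerm.sdiff : IsTerm M fun v => s v \ t v := by
  have := ht.subst Nat.succ
  have : IsTerm M fun v => ZFSet.sep (fun x => x ∉ t v) (s v) :=
    IsTerm.sep (h := IsDef.not (hP := IsDef.mem (t := fun v => t fun i => v (i + 1))))
  exact this

open Classical in
instance IsTerm.ite {P : (ℕ → M) → Prop} [hP : IsDef M P] :
    IsTerm M fun v => if P v then s v else t v := by
  have := hs.subst Nat.succ
  have := ht.subst Nat.succ
  have := hP.subst Nat.succ
  refine IsTerm.of_mem (fun v => ?_)
    (IsDef.congr (P := fun v => (P (fun i => v (i + 1)) ∧ (v 0).1 ∈ s (fun i => v (i + 1))) ∨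
      (¬ P (fun i => v (i + 1)) ∧ (v 0).1 ∈ t (fun i => v (i + 1))))
      inferInstance fun v => ?_)
  · split_ifs
    exacts [hs.mem v, ht.mem v]
  · split_ifs <;> simp [*]

theorem empty_mem_model : (∅ : ZFSet) ∈ M := by
  obtain ⟨z, ⟨e, -, he⟩, -⟩ := hM.out.infinity
  convert e.2
  refine (ZFSet.eq_empty _).2 (fun w hw => he ⟨w, mem_of_mem_model e.2 hw⟩ hw) |>.symm

instance : Param M ∅ := ⟨empty_mem_model⟩

/-! ### Replacement -/

/-- The image of `a` under a class function `F`. -/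
noncomputable def img (F : ZFSet.{u} → ZFSet.{u}) (a : ZFSet.{u}) : ZFSet.{u} :=
  letI := Classical.allZFSetDefinable (fun s : Fin 1 → ZFSet.{u} => F (s 0))
  ZFSet.image F a

@[simp]
theorem mem_img {F : ZFSet.{u} → ZFSet.{u}} {a y : ZFSet.{u}} :
    y ∈ img F a ↔ ∃ x ∈ a, F x = y := by
  unfold img
  simp only [ZFSet.mem_image]

/-- Replacement in the model. -/
theorem replacement_model {R : ZFSet.{u} → ZFSet.{u} → Prop} {a : ZFSet.{u}} (ha : a ∈ M)
    [h : IsDef M fun v => R (v 0).1 (v 1).1]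
    (hR : ∀ x ∈ a, ∃ y ∈ M, R x y ∧ ∀ z ∈ M, R x z → z = y) :
    ∃ b ∈ M, ∀ y, y ∈ b ↔ y ∈ M ∧ ∃ x ∈ a, R x y := by
  have hD : (Set.univ : Set M).Definable₂ setLang {p : M × M | R p.1.1 p.2.1} :=
    (h.definable.preimage_comp (fun i => Nat.casesOn i 0 fun _ => 1 : ℕ → Fin 2) :)
  obtain ⟨b, hb⟩ := hM.out.replacement _ hD ⟨a, ha⟩ (by
    rintro ⟨x, hx⟩ hxa
    obtain ⟨y, hy, hxy, hu⟩ := hR x hxa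
    exact ⟨⟨y, hy⟩, hxy, fun z hz => Subtype.ext (hu z.1 z.2 hz)⟩)
  refine ⟨b.1, b.2, fun y => ⟨fun hy => ?_, ?_⟩⟩
  · have hyM := mem_of_mem_model b.2 hy
    obtain ⟨x, hx, hxy⟩ := (hb ⟨y, hyM⟩).1 hy
    exact ⟨hyM, x.1, hx, hxy⟩
  · rintro ⟨hyM, x, hx, hxy⟩
    exact (hb ⟨y, hyM⟩).2 ⟨⟨x, mem_of_mem_model ha hx⟩, hx, hxy⟩

instance IsTerm.img {F : (ℕ → M) → ZFSet.{u} → ZFSet.{u}}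
    [hF : IsTerm M fun v => F (fun i => v (i + 1)) (v 0).1] :
    IsTerm M fun v => img (F v) (s v) := by
  have := hs.subst Nat.succ
  have hF' : IsTerm M fun v => F (fun i => v (i + 2)) (v 0).1 :=
    hF.subst fun i => Nat.casesOn i 0 fun j => j + 2
  refine IsTerm.of_mem (fun v => ?_)
    (IsDef.congr
      (P := fun v => ∃ x, x ∈ s (fun i => v (i + 1)) ∧ F (fun i => v (i + 1)) x = (v 0).1)
      ?_ fun v => by rw [mem_img])
  · let σ : ℕ → ℕ ⊕ M := fun i => Nat.casesOn i (Sum.inl 1) fun j =>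
      Nat.casesOn j (Sum.inl 0) fun k => Sum.inr (v k)
    have hd : IsDef M fun w => (w 1).1 = F v (w 0).1 := hF.isDef.freeze σ
    have hFM : ∀ x ∈ s v, F v x ∈ M := fun x hx =>
      hF.mem fun i => Nat.casesOn i ⟨x, mem_of_mem_model (hs.mem v) hx⟩ v
    obtain ⟨b, hb, hb'⟩ := replacement_model (R := fun x y => y = F v x) (hs.mem v)
      fun x hx => ⟨F v x, hFM x hx, rfl, fun z _ hz => hz⟩
    convert hb
    ext y
    rw [mem_img, hb']
    constructor
    · rintro ⟨x, hx, rfl⟩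
      exact ⟨hFM x hx, x, hx, rfl⟩
    · rintro ⟨-, x, hx, rfl⟩
      exact ⟨x, hx, rfl⟩
  · infer_instance

end terms

/-- A term without variables denotes an element of the model. -/
theorem mem_model_of_isTerm (c : ZFSet.{u}) [h : IsTerm M fun _ => c] : c ∈ M :=
  h.mem fun _ => ⟨∅, empty_mem_model⟩

section functions
variable {s t f : (ℕ → M) → ZFSet.{u}} [hs : IsTerm M s] [ht : IsTerm M t] [hf : IsTerm M f]

theorem prod_eq_sUnion_img (x y : ZFSet.{u}) :
    ZFSet.prod x y = ZFSet.sUnion (img (fun a => img (fun b => ZFSet.pair a b) y) x) := by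
  ext z
  simp only [ZFSet.mem_prod, ZFSet.mem_sUnion, mem_img]
  constructor
  · rintro ⟨a, ha, b, hb, rfl⟩
    exact ⟨_, ⟨a, ha, rfl⟩, mem_img.2 ⟨b, hb, rfl⟩⟩
  · rintro ⟨_, ⟨a, ha, rfl⟩, hz⟩
    obtain ⟨b, hb, rfl⟩ := mem_img.1 hz
    exact ⟨a, ha, b, hb, rfl⟩

instance IsTerm.prod : IsTerm M fun v => ZFSet.prod (s v) (t v) := by
  simp only [prod_eq_sUnion_img]
  have := ht.subst Nat.succ
  have : IsTerm M fun v => InnerModel.img (fun b => ZFSet.pair (v 0).1 b) (t fun i => v (i + 1)) :=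
    inferInstance
  infer_instance

instance IsTerm.app : IsTerm M fun v => app (f v) (s v) := by
  unfold InnerModel.app
  have := hs.subst Nat.succ
  have := hf.subst Nat.succ
  infer_instance

/-- A description of functions in which all quantifiers are bounded. -/
theorem isFunc_iff {x y f : ZFSet.{u}} : ZFSet.IsFunc x y f ↔ f ⊆ ZFSet.prod x y ∧
    ∀ a, a ∈ x → ∃ b, b ∈ y ∧ (ZFSet.pair a b ∈ f ∧ ∀ c, c ∈ y → ZFSet.pair a c ∈ f → c = b) := by
  unfold ZFSet.IsFunc
  refine and_congr_right fun hf => forall₂_congr fun a ha => ?_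
  constructor
  · rintro ⟨b, hb, hu⟩
    exact ⟨b, (ZFSet.pair_mem_prod.1 (hf hb)).2, hb, fun c _ hc => hu c hc⟩
  · rintro ⟨b, _, hb, hu⟩
    exact ⟨b, hb, fun c hc => hu c (ZFSet.pair_mem_prod.1 (hf hc)).2 hc⟩

instance IsDef.isFunc : IsDef M fun v => ZFSet.IsFunc (s v) (t v) (f v) := by
  simp only [isFunc_iff]
  have := ht.subst Nat.succ
  have := hf.subst Nat.succ
  have := ht.subst (· + 2)
  have := hf.subst (· + 2)
  have := hf.subst (· + 3)
  infer_instance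

end functions

end InnerModel

namespace InnerModel

variable {M : Set ZFSet.{u}}

/-! ### Set-theoretic functions -/

section app
variable {x y f a b : ZFSet.{u}}

theorem app_eq_of_pair_mem (hf : ∀ c, ZFSet.pair a c ∈ f → c = b) (h : ZFSet.pair a b ∈ f) :
    app f a = b := by
  have h2 : ZFSet.sep (fun y => ZFSet.pair a y ∈ f) (ZFSet.sUnion (ZFSet.sUnion f)) = {b} := by
    ext c
    rw [ZFSet.mem_sep, ZFSet.mem_singleton]
    constructor
    · exact fun hc => hf c hc.2
    · rintro rfl
      refine ⟨?_, h⟩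
      rw [ZFSet.mem_sUnion]
      refine ⟨{a, c}, ?_, by simp⟩
      rw [ZFSet.mem_sUnion]
      exact ⟨_, h, by simp [ZFSet.pair]⟩
  rw [app, h2, ZFSet.sUnion_singleton]

theorem pair_app_mem (hf : ZFSet.IsFunc x y f) (ha : a ∈ x) : ZFSet.pair a (app f a) ∈ f := by
  obtain ⟨b, hb, hu⟩ := hf.2 a ha
  rwa [app_eq_of_pair_mem hu hb]

theorem app_eq (hf : ZFSet.IsFunc x y f) (h : ZFSet.pair a b ∈ f) : app f a = b := by
  obtain ⟨c, hc, hu⟩ := hf.2 a (ZFSet.pair_mem_prod.1 (hf.1 h)).1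
  exact app_eq_of_pair_mem (fun d hd => (hu d hd).trans (hu b h).symm) h

theorem app_mem (hf : ZFSet.IsFunc x y f) (ha : a ∈ x) : app f a ∈ y :=
  (ZFSet.pair_mem_prod.1 (hf.1 (pair_app_mem hf ha))).2

theorem pair_mem_iff (hf : ZFSet.IsFunc x y f) : ZFSet.pair a b ∈ f ↔ a ∈ x ∧ app f a = b := by
  constructor
  · exact fun h => ⟨(ZFSet.pair_mem_prod.1 (hf.1 h)).1, app_eq hf h⟩
  · rintro ⟨ha, rfl⟩
    exact pair_app_mem hf ha

theorem isFunc_ext {y' g : ZFSet.{u}} (hf : ZFSet.IsFunc x y f) (hg : ZFSet.IsFunc x y' g)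
    (h : ∀ a ∈ x, app f a = app g a) : f = g := by
  ext z
  constructor
  · intro hz
    obtain ⟨a, ha, b, -, rfl⟩ := ZFSet.mem_prod.1 (hf.1 hz)
    rw [pair_mem_iff hg, ← h a ha, ← pair_mem_iff hf |>.trans (and_congr_right fun _ => Iff.rfl)]
    exact hz
  · intro hz
    obtain ⟨a, ha, b, -, rfl⟩ := ZFSet.mem_prod.1 (hg.1 hz)
    rw [pair_mem_iff hf, h a ha, ← pair_mem_iff hg]
    exact hz

/-- A left inverse of an injection, given by a term. -/
theorem sUnion_sep_app_eq (hinj : ∀ a ∈ x, ∀ b ∈ x, app f a = app f b → a = b) (ha : a ∈ x) :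
    ZFSet.sUnion (ZFSet.sep (fun b => app f b = app f a) x) = a := by
  convert ZFSet.sUnion_singleton
  ext z
  rw [ZFSet.mem_sep, ZFSet.mem_singleton]
  constructor
  · exact fun h => hinj z h.1 a ha h.2
  · rintro rfl
    exact ⟨ha, rfl⟩

/-- The function with domain `a` given by the class function `F`. -/
noncomputable def lam (a : ZFSet.{u}) (F : ZFSet.{u} → ZFSet.{u}) : ZFSet.{u} :=
  img (fun x => ZFSet.pair x (F x)) a

theorem pair_mem_lam {F : ZFSet.{u} → ZFSet.{u}} : ZFSet.pair a b ∈ lam x F ↔ a ∈ x ∧ b = F a := by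
  simp only [lam, mem_img, ZFSet.pair_inj]
  constructor
  · rintro ⟨a, ha, rfl, rfl⟩
    exact ⟨ha, rfl⟩
  · rintro ⟨ha, rfl⟩
    exact ⟨a, ha, rfl, rfl⟩

theorem isFunc_lam {F : ZFSet.{u} → ZFSet.{u}} (hF : ∀ a ∈ x, F a ∈ y) :
    ZFSet.IsFunc x y (lam x F) := by
  refine ⟨fun z hz => ?_, fun a ha => ⟨F a, pair_mem_lam.2 ⟨ha, rfl⟩, fun b hb =>
    (pair_mem_lam.1 hb).2⟩⟩
  obtain ⟨a, ha, rfl⟩ := mem_img.1 hz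
  exact ZFSet.pair_mem_prod.2 ⟨ha, hF a ha⟩

theorem app_lam {F : ZFSet.{u} → ZFSet.{u}} (ha : a ∈ x) : app (lam x F) a = F a :=
  app_eq_of_pair_mem (fun _ hc => (pair_mem_lam.1 hc).2) (pair_mem_lam.2 ⟨ha, rfl⟩)

/-- The first component of an ordered pair. -/
noncomputable def fst (z : ZFSet.{u}) : ZFSet.{u} :=
  ZFSet.sUnion (ZFSet.sep (fun x => ∃ y, y ∈ ZFSet.sUnion z ∧ z = ZFSet.pair x y) (ZFSet.sUnion z))

/-- The second component of an ordered pair. -/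
noncomputable def snd (z : ZFSet.{u}) : ZFSet.{u} :=
  ZFSet.sUnion (ZFSet.sep (fun y => ∃ x, x ∈ ZFSet.sUnion z ∧ z = ZFSet.pair x y) (ZFSet.sUnion z))

theorem mem_sUnion_pair {c : ZFSet.{u}} : c ∈ ZFSet.sUnion (ZFSet.pair a b) ↔ c = a ∨ c = b := by
  simp [ZFSet.pair]

@[simp]
theorem fst_pair : fst (ZFSet.pair a b) = a := by
  have : ZFSet.sep (fun x => ∃ y, y ∈ ZFSet.sUnion (ZFSet.pair a b) ∧
      ZFSet.pair a b = ZFSet.pair x y) (ZFSet.sUnion (ZFSet.pair a b)) = {a} := by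
    ext c
    simp only [ZFSet.mem_sep, mem_sUnion_pair, ZFSet.pair_inj, ZFSet.mem_singleton]
    constructor
    · rintro ⟨-, _, -, rfl, -⟩
      rfl
    · rintro rfl
      exact ⟨Or.inl rfl, b, Or.inr rfl, rfl, rfl⟩
  rw [fst, this, ZFSet.sUnion_singleton]

@[simp]
theorem snd_pair : snd (ZFSet.pair a b) = b := by
  have : ZFSet.sep (fun y => ∃ x, x ∈ ZFSet.sUnion (ZFSet.pair a b) ∧
      ZFSet.pair a b = ZFSet.pair x y) (ZFSet.sUnion (ZFSet.pair a b)) = {b} := by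
    ext c
    simp only [ZFSet.mem_sep, mem_sUnion_pair, ZFSet.pair_inj, ZFSet.mem_singleton]
    constructor
    · rintro ⟨-, _, -, -, rfl⟩
      rfl
    · rintro rfl
      exact ⟨Or.inr rfl, a, Or.inl rfl, rfl, rfl⟩
  rw [snd, this, ZFSet.sUnion_singleton]

end app

section
variable [hM : Fact (IsTransitiveModelZFC M)] {s : (ℕ → M) → ZFSet.{u}} [hs : IsTerm M s]

instance IsTerm.fst : IsTerm M fun v => fst (s v) := by
  unfold InnerModel.fst
  have := hs.subst Nat.succ
  have := hs.subst (· + 2)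
  infer_instance

instance IsTerm.snd : IsTerm M fun v => snd (s v) := by
  unfold InnerModel.snd
  have := hs.subst Nat.succ
  have := hs.subst (· + 2)
  infer_instance

instance IsTerm.lam {F : (ℕ → M) → ZFSet.{u} → ZFSet.{u}}
    [hF : IsTerm M fun v => F (fun i => v (i + 1)) (v 0).1] :
    IsTerm M fun v => lam (s v) (F v) := by
  unfold InnerModel.lam
  infer_instance

end

variable [hM : Fact (IsTransitiveModelZFC M)]

theorem lam_mem_model {F : ZFSet.{u} → ZFSet.{u}} {a : ZFSet.{u}} (ha : a ∈ M)
    [hF : IsTerm M fun v => F (v 0).1] : lam a F ∈ M :=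
  have : Param M a := ⟨ha⟩
  mem_model_of_isTerm _

theorem prod_mem_model {a b : ZFSet.{u}} (ha : a ∈ M) (hb : b ∈ M) : ZFSet.prod a b ∈ M :=
  have : Param M a := ⟨ha⟩
  have : Param M b := ⟨hb⟩
  mem_model_of_isTerm _

theorem app_mem_model {f a : ZFSet.{u}} (hf : f ∈ M) (ha : a ∈ M) : app f a ∈ M :=
  have : Param M a := ⟨ha⟩
  have : Param M f := ⟨hf⟩
  mem_model_of_isTerm _

/-! ### The ordinal `ω` -/

omit hM in
/-- Induction on `ω` for arbitrary properties, definable or not. -/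
theorem omega_induction {P : ZFSet.{u} → Prop} (h0 : P ∅)
    (hs : ∀ n ∈ ZFSet.omega.{u}, P n → P (insert n n)) : ∀ n ∈ ZFSet.omega.{u}, P n := by
  intro n hn
  suffices h : ∀ k : ℕ, ∀ m : ZFSet.{u}, m = ZFSet.mk (PSet.ofNat k) → m ∈ ZFSet.omega.{u} ∧ P m by
    induction n using Quotient.inductionOn with
    | _ n =>
    obtain ⟨k, hk⟩ := hn
    exact (h k.down _ (ZFSet.sound hk)).2
  intro k
  induction k with
  | zero =>
    rintro _ rfl
    exact ⟨ZFSet.omega_zero, h0⟩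
  | succ k ih =>
    rintro _ rfl
    have := ih _ rfl
    exact ⟨ZFSet.omega_succ this.1, hs _ this.1 this.2⟩

/-- The axiom of infinity provides the true `ω`: it is the least inductive set in the sense of the
model. -/
theorem omega_mem_model : ZFSet.omega ∈ M := by
  obtain ⟨z, ⟨e, hez, he⟩, hz⟩ := hM.out.infinity
  have h0 : (∅ : ZFSet) ∈ z.1 := by
    convert hez
    exact (ZFSet.eq_empty _).2 (fun w hw => he ⟨w, mem_of_mem_model e.2 hw⟩ hw) |>.symm
  have hs : ∀ y ∈ z.1, insert y y ∈ z.1 := by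
    intro x hx
    have hxM := mem_of_mem_model z.2 hx
    obtain ⟨y, hy, hyx⟩ := hz ⟨x, hxM⟩ hx
    convert hy
    ext w
    rw [ZFSet.mem_insert_iff]
    constructor
    · intro h
      have hw : w ∈ M := by
        rcases h with rfl | h
        · exact hxM
        · exact mem_of_mem_model hxM h
      exact (hyx ⟨w, hw⟩).2 (h.symm.imp_right Subtype.ext)
    · intro h
      exact ((hyx ⟨w, mem_of_mem_model y.2 h⟩).1 h).symm.imp_left (congrArg Subtype.val)
  set I := ZFSet.sep (fun x => ∀ I, I ∈ M → (∅ ∈ I ∧ ∀ y, y ∈ I → insert y y ∈ I) → x ∈ I) z.1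
    with hI
  have hIM : I ∈ M := sep_mem_model z.2
  have hmin : ∀ J ∈ M, (∅ ∈ J ∧ ∀ y, y ∈ J → insert y y ∈ J) → I ⊆ J :=
    fun J hJ h x hx => (ZFSet.mem_sep.1 hx).2 J hJ h
  have hI0 : ∅ ∈ I := ZFSet.mem_sep.2 ⟨h0, fun J _ h => h.1⟩
  have hIs : ∀ y, y ∈ I → insert y y ∈ I := fun y hy =>
    ZFSet.mem_sep.2 ⟨hs y (ZFSet.mem_sep.1 hy).1, fun J hJ h => h.2 y (hmin J hJ h hy)⟩
  convert hIM
  ext x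
  constructor
  · exact fun hx => omega_induction hI0 (fun n _ h => hIs n h) x hx
  -- an `∈`-minimal element of `I \ ω` could be removed from `I`
  · induction x using ZFSet.inductionOn with
    | _ x ih =>
    intro hx
    by_contra hxo
    have : Param M x := ⟨mem_of_mem_model hIM hx⟩
    have : Param M I := ⟨hIM⟩
    have hJ : I \ {x} ∈ M := mem_model_of_isTerm _
    have := hmin _ hJ ⟨?_, fun y hy => ?_⟩ hx
    · simp at this
    · rw [ZFSet.mem_sdiff, ZFSet.mem_singleton]
      refine ⟨hI0, ?_⟩
      rintro rfl
      exact hxo ZFSet.omega_zero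
    · rw [ZFSet.mem_sdiff, ZFSet.mem_singleton] at hy ⊢
      refine ⟨hIs y hy.1, ?_⟩
      rintro rfl
      exact hxo (ZFSet.omega_succ (ih y (ZFSet.mem_insert y y) hy.1))

instance : Param M ZFSet.omega := ⟨omega_mem_model⟩

omit hM

theorem isOrdinal_of_mem_omega {n : ZFSet.{u}} (hn : n ∈ ZFSet.omega) : n.IsOrdinal :=
  omega_induction ZFSet.isOrdinal_empty (fun _ _ h => ZFSet.isOrdinal_succ h) n hn

theorem singleton_empty_mem_omega : ({∅} : ZFSet.{u}) ∈ ZFSet.omega := by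
  have := ZFSet.omega_succ ZFSet.omega_zero
  rwa [ZFSet.insert_eq, show ({∅} ∪ ∅ : ZFSet.{u}) = {∅} by ext; simp] at this

theorem singleton_empty_ne_empty : ({∅} : ZFSet.{u}) ≠ ∅ := fun h =>
  ZFSet.not_nonempty_empty (h ▸ ZFSet.singleton_nonempty ∅)

theorem omega_trans {n : ZFSet.{u}} (hn : n ∈ ZFSet.omega.{u}) : n ⊆ ZFSet.omega := by
  refine omega_induction (P := (· ⊆ ZFSet.omega)) (ZFSet.empty_subset _)
    (fun n hn h x hx => ?_) n hn
  rcases ZFSet.mem_insert_iff.1 hx with rfl | hx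
  · exact hn
  · exact h hx

theorem isOrdinal_omega : ZFSet.omega.{u}.IsOrdinal :=
  ZFSet.isOrdinal_iff_forall_mem_isOrdinal.2
    ⟨fun _ => omega_trans, fun _ => isOrdinal_of_mem_omega⟩

theorem finite_of_mem_omega {n : ZFSet.{u}} (hn : n ∈ ZFSet.omega) :
    (n : Set ZFSet.{u}).Finite := by
  refine omega_induction (P := fun n => (n : Set ZFSet.{u}).Finite) (by simp) (fun n _ h => ?_) n hn
  rw [ZFSet.coe_insert]
  exact h.insert n

theorem succ_subset_of_mem {α β : ZFSet.{u}} (hα : α.IsOrdinal) (hβ : β ∈ α) : insert β β ⊆ α := by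
  intro x hx
  rcases ZFSet.mem_insert_iff.1 hx with rfl | hx
  · exact hβ
  · exact hα.mem_trans hx hβ

theorem omega_subset_of_not_finite {α : ZFSet.{u}} (hα : α.IsOrdinal)
    (h : ¬ (α : Set ZFSet.{u}).Finite) : ZFSet.omega ⊆ α := by
  rcases ZFSet.IsOrdinal.mem_or_subset hα isOrdinal_omega with h' | h'
  · exact absurd (finite_of_mem_omega h') h
  · exact h'

theorem not_finite_omega : ¬ (ZFSet.omega.{u} : Set ZFSet.{u}).Finite := by
  intro hfin
  have : ∀ s : Set ZFSet.{u}, s.Finite → s ⊆ (ZFSet.omega : Set ZFSet.{u}) →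
      ∃ n ∈ ZFSet.omega.{u}, s ⊆ (n : Set ZFSet.{u}) := by
    intro s hs
    induction s, hs using Set.Finite.induction_on with
    | empty => exact fun _ => ⟨∅, ZFSet.omega_zero, by simp⟩
    | @insert c s _ _ ih =>
      intro hcs
      obtain ⟨n, hn, hsn⟩ := ih fun x hx => hcs (Or.inr hx)
      have hc : c ∈ ZFSet.omega := hcs (Or.inl rfl)
      rcases ZFSet.IsOrdinal.mem_or_subset (isOrdinal_of_mem_omega hc)
        (isOrdinal_of_mem_omega hn) with h | h
      · refine ⟨n, hn, ?_⟩
        rintro x (rfl | hx)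
        exacts [h, hsn hx]
      · refine ⟨insert c c, ZFSet.omega_succ hc, ?_⟩
        rintro x (rfl | hx)
        · exact ZFSet.mem_insert _ _
        · exact ZFSet.mem_insert_of_mem _ (h (hsn hx))
  obtain ⟨n, hn, h⟩ := this _ hfin subset_rfl
  exact ZFSet.mem_irrefl n (h hn)

theorem not_finite_of_omega_subset {α : ZFSet.{u}} (h : ZFSet.omega ⊆ α) :
    ¬ (α : Set ZFSet.{u}).Finite := fun hf => not_finite_omega (hf.subset fun _ hx => h hx)

/-! ### Cardinalities in a model -/

theorem CardLEIn.exists_app {x y : ZFSet.{u}} (h : CardLEIn M x y) :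
    ∃ f ∈ M, ZFSet.IsFunc x y f ∧ ∀ a ∈ x, ∀ b ∈ x, app f a = app f b → a = b := by
  obtain ⟨f, hf, hfun, hinj⟩ := h
  refine ⟨f, hf, hfun, fun a ha b hb hab => hinj a b (app f a) (pair_app_mem hfun ha) ?_⟩
  rw [hab]
  exact pair_app_mem hfun hb

theorem CardLEIn.of_app {x y f : ZFSet.{u}} (hf : f ∈ M) (hfun : ZFSet.IsFunc x y f)
    (hinj : ∀ a ∈ x, ∀ b ∈ x, app f a = app f b → a = b) : CardLEIn M x y := by
  refine ⟨f, hf, hfun, fun a b c ha hb => ?_⟩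
  rw [pair_mem_iff hfun] at ha hb
  exact hinj a ha.1 b hb.1 (ha.2.trans hb.2.symm)

theorem CardLEIn.not_finite {x y : ZFSet.{u}} (h : CardLEIn M x y)
    (hx : ¬ (x : Set ZFSet.{u}).Finite) : ¬ (y : Set ZFSet.{u}).Finite := by
  obtain ⟨f, -, hfun, hinj⟩ := h.exists_app
  exact fun hy => hx (Set.Finite.of_finite_image (hy.subset (by
    rintro _ ⟨a, ha, rfl⟩
    exact app_mem hfun ha)) fun a ha b hb => hinj a ha b hb)

theorem SameCardIn.exists_app {x y : ZFSet.{u}} (h : SameCardIn M x y) :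
    ∃ f ∈ M, ZFSet.IsFunc x y f ∧ (∀ a ∈ x, ∀ b ∈ x, app f a = app f b → a = b) ∧
      ∀ c ∈ y, ∃ a ∈ x, app f a = c := by
  obtain ⟨f, hf, hfun, hinj, hsurj⟩ := h
  refine ⟨f, hf, hfun, fun a ha b hb hab => hinj a b (app f a) (pair_app_mem hfun ha) ?_,
    fun c hc => ?_⟩
  · rw [hab]
    exact pair_app_mem hfun hb
  · obtain ⟨a, ha, h⟩ := hsurj c hc
    exact ⟨a, ha, app_eq hfun h⟩

theorem SameCardIn.of_app {x y f : ZFSet.{u}} (hf : f ∈ M) (hfun : ZFSet.IsFunc x y f)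
    (hinj : ∀ a ∈ x, ∀ b ∈ x, app f a = app f b → a = b)
    (hsurj : ∀ c ∈ y, ∃ a ∈ x, app f a = c) : SameCardIn M x y := by
  refine ⟨f, hf, hfun, fun a b c ha hb => ?_, fun c hc => ?_⟩
  · rw [pair_mem_iff hfun] at ha hb
    exact hinj a ha.1 b hb.1 (ha.2.trans hb.2.symm)
  · obtain ⟨a, ha, rfl⟩ := hsurj c hc
    exact ⟨a, ha, pair_app_mem hfun ha⟩

theorem SameCardIn.cardLEIn {x y : ZFSet.{u}} (h : SameCardIn M x y) : CardLEIn M x y :=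
  let ⟨f, hf, hfun, hinj, _⟩ := h
  ⟨f, hf, hfun, hinj⟩

include hM

theorem CardLEIn.of_term {x y : ZFSet.{u}} (F : ZFSet.{u} → ZFSet.{u}) (hx : x ∈ M)
    (hF : ∀ a ∈ x, F a ∈ y) (hinj : ∀ a ∈ x, ∀ b ∈ x, F a = F b → a = b)
    [IsTerm M fun v => F (v 0).1] : CardLEIn M x y := by
  refine .of_app (lam_mem_model (F := F) hx) (isFunc_lam hF) fun a ha b hb h => ?_
  rw [app_lam ha, app_lam hb] at h
  exact hinj a ha b hb h

theorem SameCardIn.of_term {x y : ZFSet.{u}} (F : ZFSet.{u} → ZFSet.{u}) (hx : x ∈ M)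
    (hF : ∀ a ∈ x, F a ∈ y) (hinj : ∀ a ∈ x, ∀ b ∈ x, F a = F b → a = b)
    (hsurj : ∀ c ∈ y, ∃ a ∈ x, F a = c)
    [IsTerm M fun v => F (v 0).1] : SameCardIn M x y := by
  refine .of_app (lam_mem_model (F := F) hx) (isFunc_lam hF) (fun a ha b hb h => ?_)
    fun c hc => ?_
  · rw [app_lam ha, app_lam hb] at h
    exact hinj a ha b hb h
  · obtain ⟨a, ha, rfl⟩ := hsurj c hc
    exact ⟨a, ha, app_lam ha⟩

theorem CardLEIn.of_subset {x y : ZFSet.{u}} (hx : x ∈ M) (h : x ⊆ y) : CardLEIn M x y :=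
  .of_term (fun a => a) hx (fun _ ha => h ha) fun _ _ _ _ h => h

/-- The domain of a function of the model belongs to the model. -/
theorem mem_model_of_isFunc {x y f : ZFSet.{u}} (hf : f ∈ M) (hfun : ZFSet.IsFunc x y f) :
    x ∈ M := by
  have : Param M f := ⟨hf⟩
  have : ZFSet.sep (fun a => ∃ b, b ∈ ZFSet.sUnion (ZFSet.sUnion f) ∧ ZFSet.pair a b ∈ f)
    (ZFSet.sUnion (ZFSet.sUnion f)) ∈ M := mem_model_of_isTerm _
  convert this
  ext a
  simp only [ZFSet.mem_sep]
  have key : ∀ b c, ZFSet.pair b c ∈ f →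
      b ∈ ZFSet.sUnion (ZFSet.sUnion f) ∧ c ∈ ZFSet.sUnion (ZFSet.sUnion f) := by
    intro b c h
    have : ({b, c} : ZFSet) ∈ ZFSet.sUnion f := ZFSet.mem_sUnion.2 ⟨_, h, by simp [ZFSet.pair]⟩
    exact ⟨ZFSet.mem_sUnion.2 ⟨_, this, by simp⟩, ZFSet.mem_sUnion.2 ⟨_, this, by simp⟩⟩
  constructor
  · intro ha
    have h := pair_app_mem hfun ha
    exact ⟨(key _ _ h).1, _, (key _ _ h).2, h⟩
  · rintro ⟨-, b, -, h⟩
    exact (ZFSet.pair_mem_prod.1 (hfun.1 h)).1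

theorem CardLEIn.mem_left {x y : ZFSet.{u}} (h : CardLEIn M x y) : x ∈ M :=
  let ⟨_, hf, hfun, _⟩ := h
  mem_model_of_isFunc hf hfun

theorem CardLEIn.trans {x y z : ZFSet.{u}} (h : CardLEIn M x y) (h' : CardLEIn M y z) :
    CardLEIn M x z := by
  have hx := h.mem_left
  obtain ⟨f, hf, hfun, hinj⟩ := h.exists_app
  obtain ⟨g, hg, hgun, hinj'⟩ := h'.exists_app
  have : Param M f := ⟨hf⟩
  have : Param M g := ⟨hg⟩
  exact .of_term (fun a => app g (app f a)) hx (fun a ha => app_mem hgun (app_mem hfun ha))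
    fun a ha b hb h => hinj a ha b hb (hinj' _ (app_mem hfun ha) _ (app_mem hfun hb) h)

theorem CardLEIn.prod {x y x' y' : ZFSet.{u}} (h : CardLEIn M x x') (h' : CardLEIn M y y') :
    CardLEIn M (ZFSet.prod x y) (ZFSet.prod x' y') := by
  have hx := prod_mem_model h.mem_left h'.mem_left
  obtain ⟨f, hf, hfun, hinj⟩ := h.exists_app
  obtain ⟨g, hg, hgun, hinj'⟩ := h'.exists_app
  have : Param M f := ⟨hf⟩
  have : Param M g := ⟨hg⟩
  refine .of_term (fun a => ZFSet.pair (app f (fst a)) (app g (snd a))) hx ?_ ?_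
  · intro a ha
    obtain ⟨b, hb, c, hc, rfl⟩ := ZFSet.mem_prod.1 ha
    rw [fst_pair, snd_pair]
    exact ZFSet.pair_mem_prod.2 ⟨app_mem hfun hb, app_mem hgun hc⟩
  · intro a ha a' ha' h
    obtain ⟨b, hb, c, hc, rfl⟩ := ZFSet.mem_prod.1 ha
    obtain ⟨b', hb', c', hc', rfl⟩ := ZFSet.mem_prod.1 ha'
    simp only [fst_pair, snd_pair, ZFSet.pair_inj] at h
    rw [hinj _ hb _ hb' h.1, hinj' _ hc _ hc' h.2]

/-! ### Choice functions -/

/-- The axiom of choice in the model, for a definable relation with values in a set. -/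
theorem exists_choice_model {a b : ZFSet.{u}} (ha : a ∈ M) (hb : b ∈ M)
    (R : ZFSet.{u} → ZFSet.{u} → Prop) [hR : IsDef M fun v => R (v 0).1 (v 1).1]
    (h : ∀ x ∈ a, ∃ y ∈ b, R x y) : ∃ f ∈ M, ZFSet.IsFunc a b f ∧ ∀ x ∈ a, R x (app f x) := by
  have : Param M a := ⟨ha⟩
  have : Param M b := ⟨hb⟩
  have : IsDef M fun v => R (v 1).1 (v 0).1 := hR.comp₂
  let F : ZFSet.{u} → ZFSet.{u} := fun x =>
    img (fun y => ZFSet.pair x y) (ZFSet.sep (fun y => R x y) b)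
  have hF : IsTerm M fun v => F (v 0).1 := by
    unfold F
    infer_instance
  have hX : img F a ∈ M := mem_model_of_isTerm _
  have memF : ∀ x z, z ∈ F x ↔ ∃ y ∈ b, R x y ∧ z = ZFSet.pair x y := by
    intro x z
    simp only [F, mem_img, ZFSet.mem_sep]
    exact ⟨fun ⟨y, ⟨h1, h2⟩, h3⟩ => ⟨y, h1, h2, h3.symm⟩,
      fun ⟨y, h1, h2, h3⟩ => ⟨y, ⟨h1, h2⟩, h3.symm⟩⟩
  obtain ⟨c, hc⟩ := hM.out.choice ⟨_, hX⟩ (by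
      rintro ⟨y, hy⟩ hyF
      obtain ⟨x, hx, rfl⟩ := mem_img.1 hyF
      obtain ⟨z, hz, hR⟩ := h x hx
      have hz' := (memF x _).2 ⟨z, hz, hR, rfl⟩
      exact ⟨⟨_, mem_of_mem_model hy hz'⟩, hz'⟩) (by
      rintro ⟨y, hy⟩ ⟨z, hz⟩ ⟨w, hw⟩ hyF hzF hwy hwz
      obtain ⟨x, hx, rfl⟩ := mem_img.1 hyF
      obtain ⟨x', hx', rfl⟩ := mem_img.1 hzF
      obtain ⟨_, _, _, rfl⟩ := (memF _ _).1 hwy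
      obtain ⟨_, _, _, h⟩ := (memF _ _).1 hwz
      rw [Subtype.mk.injEq, (ZFSet.pair_inj.1 h).1])
  have : Param M c.1 := ⟨c.2⟩
  have key : ∀ x ∈ a, ∃ y ∈ b, R x y ∧ ZFSet.pair x y ∈ c.1 ∧
      ∀ y' ∈ b, R x y' → ZFSet.pair x y' ∈ c.1 → y' = y := by
    intro x hx
    have hFx : F x ∈ M := mem_of_mem_model hX (mem_img.2 ⟨x, hx, rfl⟩)
    obtain ⟨w, ⟨hw, hwc⟩, hu⟩ := hc ⟨F x, hFx⟩ (mem_img.2 ⟨x, hx, rfl⟩)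
    obtain ⟨y, hy, hR, hwy⟩ := (memF _ _).1 hw
    refine ⟨y, hy, hR, hwy ▸ hwc, fun y' hy' hR' hc' => ?_⟩
    have hz' := (memF x _).2 ⟨y', hy', hR', rfl⟩
    have := hu ⟨_, mem_of_mem_model hFx hz'⟩ ⟨hz', hc'⟩
    rw [Subtype.ext_iff, hwy] at this
    exact (ZFSet.pair_inj.1 this).2
  refine ⟨ZFSet.sep (fun z => z ∈ c.1 ∧ R (fst z) (snd z)) (ZFSet.prod a b), ?_, ?_⟩
  · have : IsDef M fun v => R (fst (v 0).1) (snd (v 0).1) := hR.comp₂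
    exact mem_model_of_isTerm _
  · have hfun : ZFSet.IsFunc a b (ZFSet.sep (fun z => z ∈ c.1 ∧ R (fst z) (snd z))
        (ZFSet.prod a b)) := by
      refine ⟨ZFSet.sep_subset, fun x hx => ?_⟩
      obtain ⟨y, hy, hR, hyc, hu⟩ := key x hx
      refine ⟨y, ZFSet.mem_sep.2 ⟨ZFSet.pair_mem_prod.2 ⟨hx, hy⟩, hyc, by simpa⟩, fun z hz => ?_⟩
      obtain ⟨hz, hzc, hR⟩ := ZFSet.mem_sep.1 hz
      rw [fst_pair, snd_pair] at hR
      exact hu z (ZFSet.pair_mem_prod.1 hz).2 hR hzc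
    refine ⟨hfun, fun x hx => ?_⟩
    have := (ZFSet.mem_sep.1 (pair_app_mem hfun hx)).2.2
    rwa [fst_pair, snd_pair] at this

end InnerModel

namespace InnerModel

variable {M : Set ZFSet.{u}} [hM : Fact (IsTransitiveModelZFC M)]

/-! ### Mostowski collapse and order types in a model -/

/-- The predecessors of `x` in `T` under the relation `R`. -/
noncomputable def preds (T R x : ZFSet.{u}) : ZFSet.{u} :=
  ZFSet.sep (fun y => ZFSet.pair y x ∈ R) T

/-- `f` restricts to the Mostowski collapse of the relation `R` on the `R`-initial segment `S`
of `T`. -/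
def IsCollapse (T R S f : ZFSet.{u}) : Prop :=
  S ⊆ T ∧ (∀ x, x ∈ S → preds T R x ⊆ S) ∧
    ∀ x, x ∈ S → app f x = img (fun y => app f y) (preds T R x)

omit hM in
theorem mem_preds {T R x y : ZFSet.{u}} : y ∈ preds T R x ↔ y ∈ T ∧ ZFSet.pair y x ∈ R :=
  ZFSet.mem_sep

omit hM in
theorem img_congr {F G : ZFSet.{u} → ZFSet.{u}} {a : ZFSet.{u}} (h : ∀ x ∈ a, F x = G x) :
    img F a = img G a := by
  ext y
  simp only [mem_img]
  exact exists_congr fun x => and_congr_right fun hx => by rw [h x hx]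

section
variable {T R s f : (ℕ → M) → ZFSet.{u}} [hT : IsTerm M T] [hR : IsTerm M R]
  [hs : IsTerm M s] [hf : IsTerm M f]

instance IsTerm.preds : IsTerm M fun v => preds (T v) (R v) (s v) := by
  unfold InnerModel.preds
  have := hs.subst Nat.succ
  have := hR.subst Nat.succ
  infer_instance

instance IsDef.isCollapse : IsDef M fun v => IsCollapse (T v) (R v) (s v) (f v) := by
  unfold IsCollapse
  have := hT.subst Nat.succ
  have := hs.subst Nat.succ
  have := hR.subst Nat.succ
  have := hf.subst Nat.succ
  have := hf.subst (· + 2)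
  infer_instance

end

/-- Collapses are unique, by induction along a relation which is only assumed to be well-founded in
the sense of the model. -/
theorem IsCollapse.unique {T R S S' f f' : ZFSet.{u}}
    (hmin : ∀ U ∈ M, U ⊆ T → U.Nonempty → ∃ x ∈ U, ∀ y ∈ U, ZFSet.pair y x ∉ R)
    (hS : S ∈ M) (hS' : S' ∈ M) (hf : f ∈ M) (hf' : f' ∈ M)
    (h : IsCollapse T R S f) (h' : IsCollapse T R S' f') {x : ZFSet.{u}} (hx : x ∈ S)
    (hx' : x ∈ S') : app f x = app f' x := by
  by_contra hne
  have : Param M S := ⟨hS⟩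
  have : Param M S' := ⟨hS'⟩
  have : Param M f := ⟨hf⟩
  have : Param M f' := ⟨hf'⟩
  have hU : ZFSet.sep (fun x => x ∈ S' ∧ app f x ≠ app f' x) S ∈ M := mem_model_of_isTerm _
  obtain ⟨z, hz, hzmin⟩ := hmin _ hU (ZFSet.sep_subset.trans h.1)
    ⟨x, ZFSet.mem_sep.2 ⟨hx, hx', hne⟩⟩
  obtain ⟨hz, hz', hzne⟩ := ZFSet.mem_sep.1 hz
  apply hzne
  rw [h.2.2 z hz, h'.2.2 z hz']
  refine img_congr fun y hy => ?_
  by_contra hy'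
  exact hzmin y (ZFSet.mem_sep.2 ⟨h.2.1 z hz hy, h'.2.1 z hz' hy, hy'⟩) (mem_preds.1 hy).2

/-- A relation of the model which is well-founded in the sense of the model has a Mostowski
collapse in the model. -/
theorem exists_collapse_model {T R : ZFSet.{u}} (hT : T ∈ M) (hR : R ∈ M)
    (hmin : ∀ U ∈ M, U ⊆ T → U.Nonempty → ∃ x ∈ U, ∀ y ∈ U, ZFSet.pair y x ∉ R) :
    ∃ g ∈ M, ∀ x ∈ T, app g x = img (fun y => app g y) (preds T R x) := by
  have : Param M T := ⟨hT⟩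
  have : Param M R := ⟨hR⟩
  set G := ZFSet.sep (fun x => ∃ S, S ∈ M ∧ ∃ f, f ∈ M ∧ (IsCollapse T R S f ∧ x ∈ S)) T with hG
  have hGM : G ∈ M := mem_model_of_isTerm _
  obtain ⟨g, hg, hg'⟩ := replacement_model (a := G) hGM (R := fun x z => ∃ S, S ∈ M ∧ ∃ f, f ∈ M ∧
    (IsCollapse T R S f ∧ x ∈ S ∧ z = ZFSet.pair x (app f x))) (by
      intro x hx
      obtain ⟨-, S, hS, f, hf, h, hxS⟩ := ZFSet.mem_sep.1 hx
      refine ⟨_, pair_mem_model (mem_of_mem_model hGM hx)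
        (app_mem_model hf (mem_of_mem_model hGM hx)), ⟨S, hS, f, hf, h, hxS, rfl⟩, ?_⟩
      rintro _ - ⟨S', hS', f', hf', h', hxS', rfl⟩
      rw [IsCollapse.unique hmin hS hS' hf hf' h h' hxS hxS'])
  have happ : ∀ S ∈ M, ∀ f ∈ M, IsCollapse T R S f → ∀ x ∈ S, x ∈ G ∧ app g x = app f x := by
    intro S hS f hf h x hx
    have hxG : x ∈ G := ZFSet.mem_sep.2 ⟨h.1 hx, S, hS, f, hf, h, hx⟩
    have hxM := mem_of_mem_model hS hx
    refine ⟨hxG, app_eq_of_pair_mem (fun c hc => ?_) ((hg' _).2 ⟨pair_mem_model hxM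
      (app_mem_model hf hxM), x, hxG, S, hS, f, hf, h, hx, rfl⟩)⟩
    obtain ⟨-, y, -, S', hS', f', hf', h', hxS', heq⟩ := (hg' _).1 hc
    obtain ⟨rfl, rfl⟩ := ZFSet.pair_inj.1 heq
    exact IsCollapse.unique hmin hS' hS hf' hf h' h hxS' hx
  have hgc : IsCollapse T R G g := by
    refine ⟨ZFSet.sep_subset, fun x hx y hy => ?_, fun x hx => ?_⟩
    all_goals
      obtain ⟨-, S, hS, f, hf, h, hxS⟩ := ZFSet.mem_sep.1 hx
    · exact (happ S hS f hf h y (h.2.1 x hxS hy)).1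
    · rw [(happ S hS f hf h x hxS).2, h.2.2 x hxS]
      exact img_congr fun y hy => (happ S hS f hf h y (h.2.1 x hxS hy)).2.symm
  have : Param M g := ⟨hg⟩
  have : Param M G := ⟨hGM⟩
  suffices hTG : T ⊆ G from ⟨g, hg, fun x hx => hgc.2.2 x (hTG hx)⟩
  intro z hz
  by_contra hzG
  obtain ⟨x, hx, hxmin⟩ := hmin (T \ G) (mem_model_of_isTerm _)
    (fun y hy => (ZFSet.mem_sdiff.1 hy).1) ⟨z, ZFSet.mem_sdiff.2 ⟨hz, hzG⟩⟩
  obtain ⟨hxT, hxG⟩ := ZFSet.mem_sdiff.1 hx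
  have hpx : preds T R x ⊆ G := by
    intro y hy
    by_contra hyG
    exact hxmin y (ZFSet.mem_sdiff.2 ⟨(mem_preds.1 hy).1, hyG⟩) (mem_preds.1 hy).2
  -- the collapse extends to `x`
  set f := lam (insert x G) fun y => img (fun y => app g y) (preds T R y) with hf
  have : Param M x := ⟨mem_of_mem_model hT hxT⟩
  have hfM : f ∈ M := mem_model_of_isTerm _
  have hp : ∀ y ∈ insert x G, preds T R y ⊆ G := by
    intro y hy
    rcases ZFSet.mem_insert_iff.1 hy with rfl | hy
    exacts [hpx, hgc.2.1 y hy]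
  have hfc : IsCollapse T R (insert x G) f := by
    refine ⟨fun y hy => ?_, fun y hy => (hp y hy).trans fun _ => ZFSet.mem_insert_of_mem _,
      fun y hy => ?_⟩
    · rcases ZFSet.mem_insert_iff.1 hy with rfl | hy
      exacts [hxT, hgc.1 hy]
    · rw [hf, app_lam hy]
      refine img_congr fun w hw => ?_
      rw [app_lam (ZFSet.mem_insert_of_mem _ (hp y hy hw)), ← hgc.2.2 w (hp y hy hw)]
  exact hxG (happ _ (mem_model_of_isTerm _) f hfM hfc x (ZFSet.mem_insert _ _)).1

theorem SameCardIn.symm {x y : ZFSet.{u}} (h : SameCardIn M x y) : SameCardIn M y x := by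
  obtain ⟨f, hf, hfun, hinj, hsurj⟩ := h
  have : Param M f := ⟨hf⟩
  have hmem : ∀ a b, ZFSet.pair b a ∈ img (fun z => ZFSet.pair (snd z) (fst z)) f ↔
      ZFSet.pair a b ∈ f := by
    intro a b
    rw [mem_img]
    constructor
    · rintro ⟨z, hz, h⟩
      obtain ⟨c, -, d, -, rfl⟩ := ZFSet.mem_prod.1 (hfun.1 hz)
      rw [fst_pair, snd_pair, ZFSet.pair_inj] at h
      rwa [← h.1, ← h.2]
    · exact fun h => ⟨_, h, by simp⟩
  refine ⟨img (fun z => ZFSet.pair (snd z) (fst z)) f, mem_model_of_isTerm _, ⟨?_, ?_⟩, ?_, ?_⟩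
  · intro z hz
    obtain ⟨w, hw, rfl⟩ := mem_img.1 hz
    obtain ⟨c, hc, d, hd, rfl⟩ := ZFSet.mem_prod.1 (hfun.1 hw)
    rw [fst_pair, snd_pair]
    exact ZFSet.pair_mem_prod.2 ⟨hd, hc⟩
  · intro b hb
    obtain ⟨a, ha, hab⟩ := hsurj b hb
    exact ⟨a, (hmem _ _).2 hab, fun c hc => hinj _ _ _ ((hmem _ _).1 hc) hab⟩
  · intro a b c ha hb
    rw [hmem] at ha hb
    exact app_eq hfun ha ▸ app_eq hfun hb
  · intro c hc
    obtain ⟨b, hb, -⟩ := hfun.2 c hc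
    exact ⟨b, (ZFSet.pair_mem_prod.1 (hfun.1 hb)).2, (hmem _ _).2 hb⟩

/-- A well-order of the model is isomorphic, in the model, to an ordinal. -/
theorem exists_orderType_of_rel {T R : ZFSet.{u}} (hT : T ∈ M) (hR : R ∈ M)
    (hmin : ∀ U ∈ M, U ⊆ T → U.Nonempty → ∃ x ∈ U, ∀ y ∈ U, ZFSet.pair y x ∉ R)
    (htrans : ∀ x ∈ T, ∀ y ∈ T, ∀ z ∈ T, ZFSet.pair x y ∈ R → ZFSet.pair y z ∈ R →
      ZFSet.pair x z ∈ R)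
    (htri : ∀ x ∈ T, ∀ y ∈ T, ZFSet.pair x y ∈ R ∨ x = y ∨ ZFSet.pair y x ∈ R) :
    ∃ θ ∈ M, θ.IsOrdinal ∧ ∃ e ∈ M, ZFSet.IsFunc θ T e ∧ (∀ x ∈ T, ∃ a ∈ θ, app e a = x) ∧
      ∀ a ∈ θ, ∀ b ∈ θ, a ∈ b → ZFSet.pair (app e a) (app e b) ∈ R := by
  have : Param M T := ⟨hT⟩
  obtain ⟨g, hg, hgx⟩ := exists_collapse_model hT hR hmin
  have : Param M g := ⟨hg⟩
  have hlt : ∀ x ∈ T, ∀ y ∈ T, ZFSet.pair x y ∈ R → app g x ∈ app g y := by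
    intro x hx y hy h
    rw [hgx y hy, mem_img]
    exact ⟨x, mem_preds.2 ⟨hx, h⟩, rfl⟩
  have hinj : ∀ x ∈ T, ∀ y ∈ T, app g x = app g y → x = y := by
    intro x hx y hy h
    rcases htri x hx y hy with h' | h' | h'
    · exact absurd (hlt x hx y hy h') (by rw [h]; exact ZFSet.mem_irrefl _)
    · exact h'
    · exact absurd (hlt y hy x hx h') (by rw [h]; exact ZFSet.mem_irrefl _)
  have hθ : (img (fun y => app g y) T).IsOrdinal := by
    refine ZFSet.isOrdinal_iff_forall_mem_isTransitive.2
      ⟨fun z hz w hw => ?_, fun z hz w hw u hu => ?_⟩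
    all_goals
      obtain ⟨x, hx, rfl⟩ := mem_img.1 hz
      rw [hgx x hx] at hw
      obtain ⟨y, hy, rfl⟩ := mem_img.1 hw
      rw [mem_preds] at hy
    · exact mem_img.2 ⟨y, hy.1, rfl⟩
    · rw [hgx y hy.1] at hu
      obtain ⟨t, ht, rfl⟩ := mem_img.1 hu
      rw [mem_preds] at ht
      exact hlt t ht.1 x hx (htrans t ht.1 y hy.1 x hx ht.2 hy.2)
  have hsame : SameCardIn M T (img (fun y => app g y) T) :=
    .of_term (fun y => app g y) hT (fun y hy => mem_img.2 ⟨y, hy, rfl⟩) hinj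
      fun c hc => mem_img.1 hc
  have hmem : ∀ a b, ZFSet.pair b a ∈ img (fun z => ZFSet.pair (app g z) z) T ↔
      a ∈ T ∧ app g a = b := by
    intro a b
    simp only [mem_img, ZFSet.pair_inj]
    constructor
    · rintro ⟨z, hz, rfl, rfl⟩
      exact ⟨hz, rfl⟩
    · rintro ⟨ha, rfl⟩
      exact ⟨a, ha, rfl, rfl⟩
  have hfun : ZFSet.IsFunc (img (fun y => app g y) T) T
      (img (fun z => ZFSet.pair (app g z) z) T) := by
    refine ⟨fun z hz => ?_, fun b hb => ?_⟩
    · obtain ⟨w, hw, rfl⟩ := mem_img.1 hz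
      exact ZFSet.pair_mem_prod.2 ⟨mem_img.2 ⟨w, hw, rfl⟩, hw⟩
    · obtain ⟨a, ha, rfl⟩ := mem_img.1 hb
      exact ⟨a, (hmem _ _).2 ⟨ha, rfl⟩, fun c hc =>
        hinj _ ((hmem _ _).1 hc).1 _ ha ((hmem _ _).1 hc).2⟩
  have happ : ∀ x ∈ T, app (img (fun z => ZFSet.pair (app g z) z) T) (app g x) = x :=
    fun x hx => app_eq hfun ((hmem _ _).2 ⟨hx, rfl⟩)
  refine ⟨img (fun y => app g y) T, mem_model_of_isTerm _, hθ,
    img (fun z => ZFSet.pair (app g z) z) T, mem_model_of_isTerm _, hfun, fun x hx =>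
    ⟨app g x, mem_img.2 ⟨x, hx, rfl⟩, happ x hx⟩, fun a ha b hb hab => ?_⟩
  obtain ⟨x, hx, rfl⟩ := mem_img.1 ha
  obtain ⟨y, hy, rfl⟩ := mem_img.1 hb
  rw [happ x hx, happ y hy]
  rcases htri x hx y hy with h | h | h
  · exact h
  · subst h
    exact absurd hab (ZFSet.mem_irrefl _)
  · exact absurd hab (ZFSet.mem_asymm (hlt y hy x hx h))

/-- A set of ordinals of the model has, in the model, an increasing enumeration indexed by an
ordinal. -/
theorem exists_orderType {T : ZFSet.{u}} (hT : T ∈ M) (hord : ∀ x ∈ T, x.IsOrdinal) :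
    ∃ θ ∈ M, θ.IsOrdinal ∧ ∃ e ∈ M, ZFSet.IsFunc θ T e ∧ (∀ x ∈ T, ∃ a ∈ θ, app e a = x) ∧
      ∀ a ∈ θ, ∀ b ∈ θ, a ∈ b → app e a ∈ app e b := by
  have : Param M T := ⟨hT⟩
  set R := ZFSet.sep (fun z => fst z ∈ snd z) (ZFSet.prod T T) with hR
  have hRM : R ∈ M := mem_model_of_isTerm _
  have hmem : ∀ x ∈ T, ∀ y ∈ T, ZFSet.pair x y ∈ R ↔ x ∈ y := by
    intro x hx y hy
    rw [hR, ZFSet.mem_sep, ZFSet.pair_mem_prod, fst_pair, snd_pair]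
    exact and_iff_right ⟨hx, hy⟩
  obtain ⟨θ, hθ, hθo, e, he, hfun, hsurj, hlt⟩ := exists_orderType_of_rel hT hRM
    (fun U _ hUT hU => by
      obtain ⟨x, hx, hmin⟩ := ZFSet.mem_wf.has_min (U : Set ZFSet) hU
      refine ⟨x, hx, fun y hy h => hmin y hy ((hmem y (hUT hy) x (hUT hx)).1 h)⟩)
    (fun x hx y hy z hz => by
      rw [hmem x hx y hy, hmem y hy z hz, hmem x hx z hz]
      exact (hord z hz).mem_trans)
    (fun x hx y hy => by
      rw [hmem x hx y hy, hmem y hy x hx]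
      exact ZFSet.IsOrdinal.mem_trichotomous (hord x hx) (hord y hy))
  exact ⟨θ, hθ, hθo, e, he, hfun, hsurj, fun a ha b hb hab =>
    (hmem _ (app_mem hfun ha) _ (app_mem hfun hb)).1 (hlt a ha b hb hab)⟩

omit hM in
/-- A strictly increasing function on an ordinal is injective. -/
theorem injective_of_increasing {θ e : ZFSet.{u}} (hθ : θ.IsOrdinal)
    (hlt : ∀ a ∈ θ, ∀ b ∈ θ, a ∈ b → app e a ∈ app e b) :
    ∀ a ∈ θ, ∀ b ∈ θ, app e a = app e b → a = b := by
  intro a ha b hb h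
  rcases ZFSet.IsOrdinal.mem_trichotomous (hθ.mem ha) (hθ.mem hb) with h' | h' | h'
  · exact absurd (hlt a ha b hb h') (by rw [h]; exact ZFSet.mem_irrefl _)
  · exact h'
  · exact absurd (hlt b hb a ha h') (by rw [h]; exact ZFSet.mem_irrefl _)

omit hM in
/-- A strictly increasing function between ordinals is pointwise at least the identity. -/
theorem subset_app_of_increasing {θ δ e : ZFSet.{u}} (hθ : θ.IsOrdinal) (hδ : δ.IsOrdinal)
    (he : ZFSet.IsFunc θ δ e) (hlt : ∀ a ∈ θ, ∀ b ∈ θ, a ∈ b → app e a ∈ app e b) :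
    ∀ a ∈ θ, a ⊆ app e a := by
  intro a
  induction a using ZFSet.inductionOn with
  | _ a ih =>
  intro ha
  have hea := hδ.mem (app_mem he ha)
  intro b hb
  have hbθ := hθ.mem_trans hb ha
  exact ZFSet.IsOrdinal.mem_of_subset_of_mem (hθ.mem hbθ) hea (ih b hb hbθ) (hlt b hbθ a ha hb)

end InnerModel

namespace InnerModel

variable {M : Set ZFSet.{u}} [hM : Fact (IsTransitiveModelZFC M)]

/-! ### Products of infinite ordinals and regularity of successor cardinals -/

/-- The new element of `δ + 1` is given the code `(1, 0)`, and `x ∈ δ` the code `(0, x)`. -/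
theorem cardLEIn_succ {δ : ZFSet.{u}} (hω : ZFSet.omega ⊆ δ)
    (h : CardLEIn M (ZFSet.prod δ δ) δ) (hδ : δ ∈ M) : CardLEIn M (insert δ δ) δ := by
  classical
  have : Param M δ := ⟨hδ⟩
  have h0 : (∅ : ZFSet) ∈ δ := hω ZFSet.omega_zero
  have h1 : ({∅} : ZFSet) ∈ δ := hω singleton_empty_mem_omega
  refine CardLEIn.trans (.of_term
    (fun x => if x = δ then ZFSet.pair {∅} ∅ else ZFSet.pair ∅ x)
    (mem_model_of_isTerm _) (fun a ha => ?_) (fun a ha b hb hab => ?_)) h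
  · split_ifs with h
    · exact ZFSet.pair_mem_prod.2 ⟨h1, h0⟩
    · exact ZFSet.pair_mem_prod.2 ⟨h0, (ZFSet.mem_insert_iff.1 ha).resolve_left h⟩
  · split_ifs at hab with h h' h' <;> rw [ZFSet.pair_inj] at hab
    · rw [h, h']
    · exact absurd hab.1 singleton_empty_ne_empty
    · exact absurd hab.1.symm singleton_empty_ne_empty
    · exact hab.2

omit hM in
theorem finite_prod {a b : ZFSet.{u}} (ha : (a : Set ZFSet.{u}).Finite)
    (hb : (b : Set ZFSet.{u}).Finite) : (ZFSet.prod a b : Set ZFSet.{u}).Finite := by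
  refine (Set.Finite.image2 ZFSet.pair ha hb).subset ?_
  intro z hz
  obtain ⟨x, hx, y, hy, rfl⟩ := ZFSet.mem_prod.1 hz
  exact ⟨x, hx, y, hy, rfl⟩

omit hM in
theorem union_of_isOrdinal {x y : ZFSet.{u}} (hx : x.IsOrdinal) (hy : y.IsOrdinal) :
    x ∪ y = x ∨ x ∪ y = y := by
  rcases hx.subset_total hy with h | h
  · right
    ext z
    rw [ZFSet.mem_union]
    exact ⟨fun h' => h'.elim (fun h' => h h') id, Or.inr⟩
  · left
    ext z
    rw [ZFSet.mem_union]
    exact ⟨fun h' => h'.elim id (fun h' => h h'), Or.inl⟩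

/-- The Gödel ordering of pairs of ordinals: by maximum (which is the union), then
lexicographically. -/
def GoedelLT (x y : ZFSet.{u}) : Prop :=
  fst x ∪ snd x ∈ fst y ∪ snd y ∨
    (fst x ∪ snd x = fst y ∪ snd y ∧ (fst x ∈ fst y ∨ (fst x = fst y ∧ snd x ∈ snd y)))

omit hM in
theorem goedelLT_wf : WellFounded (GoedelLT.{u}) := by
  have h := InvImage.wf (fun x : ZFSet.{u} => (fst x ∪ snd x, fst x, snd x))
    (ZFSet.mem_wf.prod_lex (ZFSet.mem_wf.prod_lex ZFSet.mem_wf))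
  refine Subrelation.wf (fun {x y} hxy => ?_) h
  simp only [InvImage, Prod.lex_def]
  exact hxy

omit hM in
theorem goedelLT_trans {α x y z : ZFSet.{u}} (hα : α.IsOrdinal) (hz : z ∈ ZFSet.prod α α)
    (hxy : GoedelLT x y) (hyz : GoedelLT y z) : GoedelLT x z := by
  obtain ⟨a, ha, b, hb, rfl⟩ := ZFSet.mem_prod.1 hz
  have h : (a ∪ b).IsOrdinal := by
    rcases union_of_isOrdinal (hα.mem ha) (hα.mem hb) with h | h <;> rw [h]
    exacts [hα.mem ha, hα.mem hb]
  unfold GoedelLT at *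
  rw [fst_pair, snd_pair] at *
  rcases hxy with h1 | ⟨h1, h1'⟩ <;> rcases hyz with h2 | ⟨h2, h2'⟩
  · exact Or.inl (h.mem_trans h1 h2)
  · exact Or.inl (h2 ▸ h1)
  · exact Or.inl (h1 ▸ h2)
  · refine Or.inr ⟨h1.trans h2, ?_⟩
    rcases h1' with h1 | ⟨h1, h1'⟩ <;> rcases h2' with h2 | ⟨h2, h2'⟩
    · exact Or.inl ((hα.mem ha).mem_trans h1 h2)
    · exact Or.inl (h2 ▸ h1)
    · exact Or.inl (h1 ▸ h2)
    · exact Or.inr ⟨h1.trans h2, (hα.mem hb).mem_trans h1' h2'⟩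

omit hM in
theorem goedelLT_trichotomous {α x y : ZFSet.{u}} (hα : α.IsOrdinal) (hx : x ∈ ZFSet.prod α α)
    (hy : y ∈ ZFSet.prod α α) : GoedelLT x y ∨ x = y ∨ GoedelLT y x := by
  obtain ⟨a, ha, b, hb, rfl⟩ := ZFSet.mem_prod.1 hx
  obtain ⟨c, hc, d, hd, rfl⟩ := ZFSet.mem_prod.1 hy
  have h : ∀ a ∈ α, ∀ b ∈ α, (a ∪ b).IsOrdinal := by
    intro a ha b hb
    rcases union_of_isOrdinal (hα.mem ha) (hα.mem hb) with h | h <;> rw [h]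
    exacts [hα.mem ha, hα.mem hb]
  simp only [GoedelLT, fst_pair, snd_pair, ZFSet.pair_inj]
  have h1 := (h a ha b hb).mem_trichotomous (h c hc d hd)
  have h2 := (hα.mem ha).mem_trichotomous (hα.mem hc)
  have h3 := (hα.mem hb).mem_trichotomous (hα.mem hd)
  rcases h1 with h1 | h1 | h1
  · exact Or.inl (Or.inl h1)
  · rcases h2 with h2 | h2 | h2
    · exact Or.inl (Or.inr ⟨h1, Or.inl h2⟩)
    · rcases h3 with h3 | h3 | h3
      · exact Or.inl (Or.inr ⟨h1, Or.inr ⟨h2, h3⟩⟩)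
      · exact Or.inr (Or.inl ⟨h2, h3⟩)
      · exact Or.inr (Or.inr (Or.inr ⟨h1.symm, Or.inr ⟨h2.symm, h3⟩⟩))
    · exact Or.inr (Or.inr (Or.inr ⟨h1.symm, Or.inl h2⟩))
  · exact Or.inr (Or.inr (Or.inl h1))

/-- In a model of ZFC, `|α × α| ≤ |α|` for every infinite ordinal `α`. -/
theorem cardLEIn_prod_self {α : ZFSet.{u}} (hα : α.IsOrdinal) (hαM : α ∈ M)
    (hω : ZFSet.omega ⊆ α) : CardLEIn M (ZFSet.prod α α) α := by
  induction α using ZFSet.inductionOn with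
  | _ α ih =>
  have : Param M α := ⟨hαM⟩
  have hinf := not_finite_of_omega_subset hω
  by_cases hc : ∃ δ ∈ α, CardLEIn M α δ
  · obtain ⟨δ, hδ, h⟩ := hc
    have hδM := mem_of_mem_model hαM hδ
    have := ih δ hδ (hα.mem hδ) hδM (omega_subset_of_not_finite (hα.mem hδ) (h.not_finite hinf))
    exact ((h.prod h).trans this).trans (.of_subset hδM (hα.subset_of_mem hδ))
  set T := ZFSet.prod α α with hT
  have hTM : T ∈ M := mem_model_of_isTerm _
  have : Param M T := ⟨hTM⟩
  set R := ZFSet.sep (fun z => GoedelLT (fst z) (snd z)) (ZFSet.prod T T) with hR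
  have hRM : R ∈ M := by
    unfold GoedelLT at hR
    rw [hR]
    exact mem_model_of_isTerm _
  have hmem : ∀ x ∈ T, ∀ y ∈ T, ZFSet.pair x y ∈ R ↔ GoedelLT x y := by
    intro x hx y hy
    rw [hR, ZFSet.mem_sep, ZFSet.pair_mem_prod, fst_pair, snd_pair]
    exact and_iff_right ⟨hx, hy⟩
  obtain ⟨θ, hθ, hθo, e, he, hfun, hsurj, hlt⟩ := exists_orderType_of_rel hTM hRM
    (fun U _ hUT hU => by
      obtain ⟨x, hx, hmin⟩ := goedelLT_wf.has_min (U : Set ZFSet) hU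
      exact ⟨x, hx, fun y hy h => hmin y hy ((hmem y (hUT hy) x (hUT hx)).1 h)⟩)
    (fun x hx y hy z hz => by
      rw [hmem x hx y hy, hmem y hy z hz, hmem x hx z hz]
      exact goedelLT_trans hα hz)
    (fun x hx y hy => by
      rw [hmem x hx y hy, hmem y hy x hx]
      exact goedelLT_trichotomous hα hx hy)
  have : Param M e := ⟨he⟩
  have hlt' : ∀ a ∈ θ, ∀ b ∈ θ, a ∈ b → GoedelLT (app e a) (app e b) := fun a ha b hb hab =>
    (hmem _ (app_mem hfun ha) _ (app_mem hfun hb)).1 (hlt a ha b hb hab)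
  have hinj : ∀ a ∈ θ, ∀ b ∈ θ, app e a = app e b → a = b := by
    intro a ha b hb h
    rcases (hθo.mem ha).mem_trichotomous (hθo.mem hb) with h' | h' | h'
    · exact absurd (hlt' a ha b hb h') (by rw [h]; exact goedelLT_wf.irrefl.irrefl _)
    · exact h'
    · exact absurd (hlt' b hb a ha h') (by rw [h]; exact goedelLT_wf.irrefl.irrefl _)
  have hsame : SameCardIn M θ T := .of_app he hfun hinj hsurj
  rcases ZFSet.IsOrdinal.mem_or_subset hα hθo with h | h
  swap
  · exact hsame.symm.cardLEIn.trans (.of_subset hθ h)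
  -- if the order type exceeds `α`, then `α` injects into a product of smaller ordinals
  exfalso
  obtain ⟨ξ, hξ, η, hη, hx⟩ := ZFSet.mem_prod.1 (app_mem hfun h)
  set δ := ξ ∪ η with hδ
  have hδα : δ ∈ α := by
    rcases union_of_isOrdinal (hα.mem hξ) (hα.mem hη) with h | h <;> rw [hδ, h] <;> assumption
  have hδM := mem_of_mem_model hαM hδα
  have hδo := hα.mem hδα
  have hle : CardLEIn M α (ZFSet.prod (insert δ δ) (insert δ δ)) := by
    refine .of_term (fun β => app e β) hαM (fun β hβ => ?_) fun a ha b hb =>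
      hinj a (hθo.mem_trans ha h) b (hθo.mem_trans hb h)
    have hβθ := hθo.mem_trans hβ h
    have h1 := hlt' β hβθ α h hβ
    obtain ⟨a, ha, b, hb, hab⟩ := ZFSet.mem_prod.1 (app_mem hfun hβθ)
    rw [hab]
    rw [hx, hab] at h1
    simp only [GoedelLT, fst_pair, snd_pair, ← hδ] at h1
    have h2 : a ∪ b ⊆ δ := by
      rcases h1 with h1 | h1
      · exact hδo.subset_of_mem h1
      · rw [h1.1]
    have h3 : ∀ c ∈ α, c ⊆ a ∪ b → c ∈ insert δ δ := fun c hc hcab =>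
      ZFSet.mem_insert_iff.2 ((hα.mem hc).eq_or_mem_of_subset hδo (hcab.trans h2))
    exact ZFSet.pair_mem_prod.2 ⟨h3 a ha fun z hz => ZFSet.mem_union.2 (Or.inl hz),
      h3 b hb fun z hz => ZFSet.mem_union.2 (Or.inr hz)⟩
  by_cases hfin : (δ : Set ZFSet.{u}).Finite
  · have hfin' : ((insert δ δ : ZFSet) : Set ZFSet.{u}).Finite := by
      rw [ZFSet.coe_insert]
      exact hfin.insert δ
    exact hle.not_finite hinf (finite_prod hfin' hfin')
  · have hωδ := omega_subset_of_not_finite hδo hfin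
    have h1 := ih δ hδα hδo hδM hωδ
    have h2 := cardLEIn_succ hωδ h1 hδM
    exact hc ⟨δ, hδα, (hle.trans (h2.prod h2)).trans h1⟩

theorem IsCardinalIn.succ_mem {κ β : ZFSet.{u}} (hκ : IsCardinalIn M κ) (hω : ZFSet.omega ⊆ κ)
    (hβ : β ∈ κ) : insert β β ∈ κ := by
  have hβo := hκ.2.1.mem hβ
  have hβM := mem_of_mem_model hκ.1 hβ
  rcases (ZFSet.isOrdinal_succ hβo).eq_or_mem_of_subset hκ.2.1 (succ_subset_of_mem hκ.2.1 hβ)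
    with h | h
  · have hinf : ¬ (β : Set ZFSet.{u}).Finite := by
      intro hf
      apply not_finite_of_omega_subset hω
      rw [← h, ZFSet.coe_insert]
      exact hf.insert β
    have hωβ := omega_subset_of_not_finite hβo hinf
    exact absurd (h ▸ cardLEIn_succ hωβ (cardLEIn_prod_self hβo hβM hωβ) hβM) (hκ.2.2 β hβ)
  · exact h

theorem IsSuccCardIn.cardLEIn_of_mem {κ μ β : ZFSet.{u}} (h : IsSuccCardIn M κ μ) (hβ : β ∈ μ) :
    CardLEIn M β κ := by
  have hμo := h.1.2.1
  obtain ⟨ν, ⟨hνo, hν⟩, hmin⟩ := ZFSet.mem_wf.has_min {ν : ZFSet.{u} | ν.IsOrdinal ∧ CardLEIn M β ν}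
    ⟨β, hμo.mem hβ, .of_subset (mem_of_mem_model h.1.1 hβ) subset_rfl⟩
  have hβν : ν ⊆ β := (ZFSet.IsOrdinal.notMem_iff_subset (hμo.mem hβ) hνo).1 fun hβν =>
    hmin β ⟨hμo.mem hβ, .of_subset (mem_of_mem_model h.1.1 hβ) subset_rfl⟩ hβν
  have hνμ : ν ∈ μ := hνo.mem_of_subset_of_mem hμo hβν hβ
  have hνM := mem_of_mem_model h.1.1 hνμ
  have hcard : IsCardinalIn M ν :=
    ⟨hνM, hνo, fun α hα hle => hmin α ⟨hνo.mem hα, hν.trans hle⟩ hα⟩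
  have hνκ : ν ⊆ κ := (ZFSet.IsOrdinal.notMem_iff_subset (hμo.mem h.2.1) hνo).1
    fun hκν => h.2.2 ν hνμ hκν hcard
  exact hν.trans (.of_subset hνM hνκ)

/-- The axiom of choice provides a family of injections into `κ` of the ordinals below its
successor. -/
theorem IsSuccCardIn.exists_injections {κ μ : ZFSet.{u}} (h : IsSuccCardIn M κ μ) :
    ∃ Φ ∈ M, ∀ β ∈ μ, ZFSet.IsFunc β κ (app Φ β) ∧
      ∀ a ∈ β, ∀ b ∈ β, app (app Φ β) a = app (app Φ β) b → a = b := by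
  have hμM := h.1.1
  have hκM := mem_of_mem_model hμM h.2.1
  have : Param M κ := ⟨hκM⟩
  obtain ⟨p, hp, hpm⟩ := exists_powerset_model (prod_mem_model hμM hκM)
  obtain ⟨Φ, hΦ, -, hΦ'⟩ := exists_choice_model hμM hp (fun β f => ZFSet.IsFunc β κ f ∧
      ∀ a, a ∈ β → ∀ b, b ∈ β → app f a = app f b → a = b) (by
    intro β hβ
    obtain ⟨f, hf, hfun, hinj⟩ := (h.cardLEIn_of_mem hβ).exists_app
    refine ⟨f, (hpm f).2 ⟨hf, fun z hz => ?_⟩, hfun, hinj⟩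
    obtain ⟨a, ha, b, hb, rfl⟩ := ZFSet.mem_prod.1 (hfun.1 hz)
    exact ZFSet.pair_mem_prod.2 ⟨h.1.2.1.mem_trans ha hβ, hb⟩)
  exact ⟨Φ, hΦ, hΦ'⟩

/-- Successor cardinals are regular. -/
theorem IsSuccCardIn.isRegularIn {κ μ : ZFSet.{u}} (h : IsSuccCardIn M κ μ)
    (hω : ZFSet.omega ⊆ κ) : IsRegularIn M μ := by
  have hμM := h.1.1
  have hμo := h.1.2.1
  have hκM := mem_of_mem_model hμM h.2.1
  have hωμ : ZFSet.omega ⊆ μ := hω.trans (hμo.subset_of_mem h.2.1)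
  refine ⟨h.1, hωμ, fun α hα f hf hfun => ?_⟩
  by_contra! hunb
  obtain ⟨Φ, hΦ, hΦinj⟩ := h.exists_injections
  have : Param M Φ := ⟨hΦ⟩
  have : Param M f := ⟨hf⟩
  have : Param M α := ⟨mem_of_mem_model hμM hα⟩
  obtain ⟨c, hc, hcfun, hcmem⟩ := exists_choice_model hμM (mem_of_mem_model hμM hα)
    (fun ξ γ => ξ ∈ app f γ) (by
      intro ξ hξ
      obtain ⟨γ, hγ, hξγ⟩ := hunb _ (h.1.succ_mem hωμ hξ)
      have hfγ := hμo.mem (app_mem hfun hγ)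
      have h1 := (ZFSet.IsOrdinal.notMem_iff_subset hfγ (ZFSet.isOrdinal_succ (hμo.mem hξ))).1 hξγ
      exact ⟨γ, hγ, h1 (ZFSet.mem_insert _ _)⟩)
  have : Param M c := ⟨hc⟩
  have hle : CardLEIn M μ (ZFSet.prod κ κ) := by
    refine .of_term (fun ξ => ZFSet.pair (app (app Φ α) (app c ξ))
      (app (app Φ (app f (app c ξ))) ξ)) hμM (fun ξ hξ => ?_) (fun ξ hξ η hη heq => ?_)
    · exact ZFSet.pair_mem_prod.2 ⟨app_mem (hΦinj α hα).1 (app_mem hcfun hξ),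
        app_mem (hΦinj _ (app_mem hfun (app_mem hcfun hξ))).1 (hcmem ξ hξ)⟩
    · obtain ⟨h1, h2⟩ := ZFSet.pair_inj.1 heq
      have h3 := (hΦinj α hα).2 _ (app_mem hcfun hξ) _ (app_mem hcfun hη) h1
      have hη' := hcmem η hη
      rw [← h3] at h2 hη'
      exact (hΦinj _ (app_mem hfun (app_mem hcfun hξ))).2 _ (hcmem ξ hξ) _ hη' h2
  exact h.1.2.2 κ h.2.1
    (hle.trans (cardLEIn_prod_self (hμo.mem h.2.1) hκM hω))

end InnerModel

namespace InnerModel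

variable {M : Set ZFSet.{u}} [hM : Fact (IsTransitiveModelZFC M)]

/-! ### Generating subalgebras in a model -/

/-- `Q` contains the codes of the generators `g i` and is closed under coding the values of the
binary operation `op`, when `p` is a pairing function on `α`: the generator `g i` has the code
`p (0, i)`, and if `s` and `t` have the codes `c` and `d` then `op (s, t)` has the code
`p (1, p (c, d))`. -/
def CodeClosed (α D p op g Q : ZFSet.{u}) : Prop :=
  (∀ i, i ∈ α → ZFSet.pair (app p (ZFSet.pair ∅ i)) (app g i) ∈ Q) ∧
    ∀ c, c ∈ α → ∀ d, d ∈ α → ∀ s, s ∈ D → ∀ t, t ∈ D → ZFSet.pair c s ∈ Q → ZFSet.pair d t ∈ Q →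
      ZFSet.pair (app p (ZFSet.pair {∅} (app p (ZFSet.pair c d)))) (app op (ZFSet.pair s t)) ∈ Q

/-- In a model, a subset generated by an infinite ordinal's worth of elements under a binary
operation is contained in a closed set onto which that ordinal maps. -/
theorem exists_closed_image {α D op g : ZFSet.{u}} (hα : α.IsOrdinal) (hαM : α ∈ M)
    (hω : ZFSet.omega ⊆ α) (hD : D ∈ M) (hop : op ∈ M)
    (hopf : ZFSet.IsFunc (ZFSet.prod D D) D op) (hg : g ∈ M) (hgf : ZFSet.IsFunc α D g) :
    ∃ C ∈ M, C ⊆ D ∧ (∀ i ∈ α, app g i ∈ C) ∧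
      (∀ s ∈ C, ∀ t ∈ C, app op (ZFSet.pair s t) ∈ C) ∧
      ∃ e ∈ M, ∀ s ∈ C, ∃ i ∈ α, app e i = s := by
  obtain ⟨p, hp, hpf, hpinj⟩ := (cardLEIn_prod_self hα hαM hω).exists_app
  have : Param M α := ⟨hαM⟩
  have : Param M D := ⟨hD⟩
  have : Param M op := ⟨hop⟩
  have : Param M g := ⟨hg⟩
  have : Param M p := ⟨hp⟩
  have h0 : (∅ : ZFSet) ∈ α := hω ZFSet.omega_zero
  have h1 : ({∅} : ZFSet) ∈ α := hω singleton_empty_mem_omega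
  have h01 : (∅ : ZFSet.{u}) ≠ {∅} := singleton_empty_ne_empty.symm
  have hq : ∀ a ∈ α, ∀ b ∈ α, app p (ZFSet.pair a b) ∈ α := fun a ha b hb =>
    app_mem hpf (ZFSet.pair_mem_prod.2 ⟨ha, hb⟩)
  have hqinj : ∀ a ∈ α, ∀ b ∈ α, ∀ c ∈ α, ∀ d ∈ α,
      app p (ZFSet.pair a b) = app p (ZFSet.pair c d) → a = c ∧ b = d :=
    fun a ha b hb c hc d hd h => ZFSet.pair_inj.1 <|
      hpinj _ (ZFSet.pair_mem_prod.2 ⟨ha, hb⟩) _ (ZFSet.pair_mem_prod.2 ⟨hc, hd⟩) h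
  have hopm : ∀ s ∈ D, ∀ t ∈ D, app op (ZFSet.pair s t) ∈ D := fun s hs t ht =>
    app_mem hopf (ZFSet.pair_mem_prod.2 ⟨hs, ht⟩)
  have hdef : IsDef M fun v => CodeClosed α D p op g (v 0).1 := by
    unfold CodeClosed
    infer_instance
  have : IsDef M fun v => ∀ Q, Q ∈ M → CodeClosed α D p op g Q → (v 0).1 ∈ Q := by
    have := hdef
    infer_instance
  set R := ZFSet.sep (fun z => ∀ Q, Q ∈ M → CodeClosed α D p op g Q → z ∈ Q) (ZFSet.prod α D)
    with hR
  have hRM : R ∈ M := sep_mem_model (prod_mem_model hαM hD)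
  have : Param M R := ⟨hRM⟩
  have hRsub : R ⊆ ZFSet.prod α D := ZFSet.sep_subset
  have hRmin : ∀ Q ∈ M, CodeClosed α D p op g Q → R ⊆ Q := fun Q hQ h z hz =>
    (ZFSet.mem_sep.1 hz).2 Q hQ h
  have hRc : CodeClosed α D p op g R := by
    refine ⟨fun i hi => ZFSet.mem_sep.2 ⟨ZFSet.pair_mem_prod.2 ⟨hq _ h0 _ hi, app_mem hgf hi⟩,
      fun Q _ h => h.1 i hi⟩, fun c hc d hd s hs t ht hcs hdt => ZFSet.mem_sep.2
      ⟨ZFSet.pair_mem_prod.2 ⟨hq _ h1 _ (hq _ hc _ hd), hopm s hs t ht⟩, fun Q hQ h =>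
        h.2 c hc d hd s hs t ht (hRmin Q hQ h hcs) (hRmin Q hQ h hdt)⟩⟩
  -- every element of the least relation arises from one of the two closure conditions
  have hinv : R ⊆ ZFSet.sep (fun z =>
      (∃ i, i ∈ α ∧ z = ZFSet.pair (app p (ZFSet.pair ∅ i)) (app g i)) ∨
      ∃ c, c ∈ α ∧ ∃ d, d ∈ α ∧ ∃ s, s ∈ D ∧ ∃ t, t ∈ D ∧
        (ZFSet.pair c s ∈ R ∧ ZFSet.pair d t ∈ R ∧ z = ZFSet.pair
          (app p (ZFSet.pair {∅} (app p (ZFSet.pair c d)))) (app op (ZFSet.pair s t)))) R := by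
    refine hRmin _ (mem_model_of_isTerm _) ⟨fun i hi => ?_, fun c hc d hd s hs t ht hcs hdt => ?_⟩
    · exact ZFSet.mem_sep.2 ⟨hRc.1 i hi, Or.inl ⟨i, hi, rfl⟩⟩
    · have hcs := ZFSet.sep_subset hcs
      have hdt := ZFSet.sep_subset hdt
      exact ZFSet.mem_sep.2 ⟨hRc.2 c hc d hd s hs t ht hcs hdt,
        Or.inr ⟨c, hc, d, hd, s, hs, t, ht, hcs, hdt, rfl⟩⟩
  -- every code has at most one value
  have hfun : R ⊆ ZFSet.sep (fun z => ∀ s, s ∈ D → ZFSet.pair (fst z) s ∈ R → s = snd z) R := by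
    refine hRmin _ (mem_model_of_isTerm _) ⟨fun i hi => ?_, fun c hc d hd s hs t ht hcs hdt => ?_⟩
    · refine ZFSet.mem_sep.2 ⟨hRc.1 i hi, fun s hs h => ?_⟩
      rw [fst_pair] at h
      rw [snd_pair]
      rcases (ZFSet.mem_sep.1 (hinv h)).2 with ⟨j, hj, heq⟩ | ⟨c, hc, d, hd, _, _, _, _, _, _, heq⟩
      · obtain ⟨h2, h3⟩ := ZFSet.pair_inj.1 heq
        rw [h3, (hqinj _ h0 _ hi _ h0 _ hj h2).2]
      · exact absurd (hqinj _ h0 _ hi _ h1 _ (hq _ hc _ hd) (ZFSet.pair_inj.1 heq).1).1 h01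
    · obtain ⟨hcs, hcs'⟩ := ZFSet.mem_sep.1 hcs
      obtain ⟨hdt, hdt'⟩ := ZFSet.mem_sep.1 hdt
      simp only [fst_pair, snd_pair] at hcs' hdt'
      refine ZFSet.mem_sep.2 ⟨hRc.2 c hc d hd s hs t ht hcs hdt, fun w hw h => ?_⟩
      rw [fst_pair] at h
      rw [snd_pair]
      rcases (ZFSet.mem_sep.1 (hinv h)).2 with
        ⟨j, hj, heq⟩ | ⟨c', hc', d', hd', s', hs', t', ht', hcs2, hdt2, heq⟩
      · exact absurd (hqinj _ h1 _ (hq _ hc _ hd) _ h0 _ hj (ZFSet.pair_inj.1 heq).1).1.symm h01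
      · obtain ⟨h2, h3⟩ := ZFSet.pair_inj.1 heq
        have h4 := (hqinj _ h1 _ (hq _ hc _ hd) _ h1 _ (hq _ hc' _ hd') h2).2
        obtain ⟨rfl, rfl⟩ := hqinj _ hc _ hd _ hc' _ hd' h4
        rw [h3, hcs' s' hs' hcs2, hdt' t' ht' hdt2]
  have key : ∀ c s, ZFSet.pair c s ∈ R → app R c = s := by
    intro c s h
    refine app_eq_of_pair_mem (fun t ht => ?_) h
    have := (ZFSet.mem_sep.1 (hfun h)).2 t (ZFSet.pair_mem_prod.1 (hRsub ht)).2
    rw [fst_pair, snd_pair] at this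
    exact this ht
  refine ⟨ZFSet.sep (fun s => ∃ c, c ∈ α ∧ ZFSet.pair c s ∈ R) D, mem_model_of_isTerm _,
    ZFSet.sep_subset, fun i hi => ?_, fun s hs t ht => ?_, R, hRM, fun s hs => ?_⟩
  · exact ZFSet.mem_sep.2 ⟨app_mem hgf hi, _, hq _ h0 _ hi, hRc.1 i hi⟩
  · obtain ⟨hs, c, hc, hcs⟩ := ZFSet.mem_sep.1 hs
    obtain ⟨ht, d, hd, hdt⟩ := ZFSet.mem_sep.1 ht
    exact ZFSet.mem_sep.2 ⟨hopm s hs t ht, _, hq _ h1 _ (hq _ hc _ hd),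
      hRc.2 c hc d hd s hs t ht hcs hdt⟩
  · obtain ⟨hs, c, hc, hcs⟩ := ZFSet.mem_sep.1 hs
    exact ⟨c, hc, key c s hcs⟩

end InnerModel

namespace InnerModel

/-! ### Sets all of whose sequences belong to the inner model -/

section SurjSeq
variable {M : Set ZFSet.{u}} [hM : Fact (IsTransitiveModelZFC M)]

theorem CardLEIn.exists_surjection {x y : ZFSet.{u}} (hx : x.Nonempty) (hy : y ∈ M)
    (h : CardLEIn M x y) : ∃ e ∈ M, ZFSet.IsFunc y x e ∧ ∀ a ∈ x, ∃ b ∈ y, app e b = a := by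
  have hxM := h.mem_left
  obtain ⟨f, hf, hfun, hinj⟩ := h.exists_app
  have : Param M f := ⟨hf⟩
  have : Param M x := ⟨hxM⟩
  obtain ⟨e, he, hefun, hea⟩ := exists_choice_model hy hxM
    (fun b a => (∃ c, c ∈ x ∧ app f c = b) → app f a = b) (by
      intro b _
      by_cases hb : ∃ c ∈ x, app f c = b
      · obtain ⟨c, hc, hcb⟩ := hb
        exact ⟨c, hc, fun _ => hcb⟩
      · obtain ⟨c, hc⟩ := hx
        exact ⟨c, hc, fun h => absurd h hb⟩)
  exact ⟨e, he, hefun, fun a ha => ⟨app f a, app_mem hfun ha,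
    hinj _ (app_mem hefun (app_mem hfun ha)) _ ha (hea _ (app_mem hfun ha) ⟨a, ha, rfl⟩)⟩⟩

/-- A sequence of sequences can be merged into one sequence. -/
theorem exists_merge {G B : ZFSet.{u}} (hG : G ∈ M)
    (hGf : ∀ n ∈ ZFSet.omega, ZFSet.IsFunc ZFSet.omega B (app G n)) :
    ∃ g ∈ M, ZFSet.IsFunc ZFSet.omega B g ∧
      ∀ n ∈ ZFSet.omega, ∀ m ∈ ZFSet.omega, ∃ k ∈ ZFSet.omega, app g k = app (app G n) m := by
  have : Param M G := ⟨hG⟩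
  obtain ⟨e, he, hef, hsurj⟩ := (cardLEIn_prod_self (M := M) isOrdinal_omega omega_mem_model
    subset_rfl).exists_surjection
    ⟨_, ZFSet.pair_mem_prod.2 ⟨ZFSet.omega_zero, ZFSet.omega_zero⟩⟩ omega_mem_model
  have : Param M e := ⟨he⟩
  refine ⟨lam ZFSet.omega fun k => app (app G (fst (app e k))) (snd (app e k)),
    mem_model_of_isTerm _, isFunc_lam fun k hk => ?_, fun n hn m hm => ?_⟩
  · obtain ⟨a, ha, b, hb, h⟩ := ZFSet.mem_prod.1 (app_mem hef hk)
    rw [h, fst_pair, snd_pair]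
    exact app_mem (hGf a ha) hb
  · obtain ⟨k, hk, h⟩ := hsurj _ (ZFSet.pair_mem_prod.2 ⟨hn, hm⟩)
    exact ⟨k, hk, by rw [app_lam hk, h, fst_pair, snd_pair]⟩

end SurjSeq

/-- Every `ω`-sequence of elements of `S` that belongs to `V` belongs to `W`. -/
def SeqClosed (V W : Set ZFSet.{u}) (S : ZFSet.{u}) : Prop :=
  ∀ f ∈ V, ZFSet.IsFunc ZFSet.omega S f → f ∈ W

variable {V W : Set ZFSet.{u}}

theorem isFunc_mono {x y y' f : ZFSet.{u}} (h : ZFSet.IsFunc x y f) (hy : y ⊆ y') :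
    ZFSet.IsFunc x y' f := by
  refine ⟨fun z hz => ?_, h.2⟩
  obtain ⟨a, ha, b, hb, rfl⟩ := ZFSet.mem_prod.1 (h.1 hz)
  exact ZFSet.pair_mem_prod.2 ⟨ha, hy hb⟩

theorem SeqClosed.mono {S S' : ZFSet.{u}} (h : SeqClosed V W S') (hS : S ⊆ S') : SeqClosed V W S :=
  fun f hf hfun => h f hf (isFunc_mono hfun hS)

variable [hV : Fact (IsTransitiveModelZFC V)] [hW : Fact (IsTransitiveModelZFC W)]

/-- Sequences can be transported along a class function of `V` that has an inverse in `W`. -/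
theorem SeqClosed.of_term {S T : ZFSet.{u}} (hT : SeqClosed V W T) (F G : ZFSet.{u} → ZFSet.{u})
    [IsTerm V fun v => F (v 0).1] [hG : IsTerm W fun v => G (v 0).1] (hF : ∀ x ∈ S, F x ∈ T)
    (hGF : ∀ x ∈ S, G (F x) = x) : SeqClosed V W S := by
  intro f hf hfun
  have : Param V f := ⟨hf⟩
  have : IsTerm V fun v => F (app f (v 0).1) := IsTerm.comp₁ inferInstance
  have h1 : lam ZFSet.omega (fun n => F (app f n)) ∈ W :=
    hT _ (mem_model_of_isTerm _) (isFunc_lam fun n hn => hF _ (app_mem hfun hn))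
  have : Param W (lam ZFSet.omega (fun n => F (app f n))) := ⟨h1⟩
  have : IsTerm W fun v => G (app (lam ZFSet.omega (fun n => F (app f n))) (v 0).1) :=
    IsTerm.comp₁ hG
  have h2 : lam ZFSet.omega (fun n => G (app (lam ZFSet.omega (fun n => F (app f n))) n)) ∈ W :=
    mem_model_of_isTerm _
  have h3 : ∀ n ∈ ZFSet.omega, G (app (lam ZFSet.omega (fun n => F (app f n))) n) = app f n := by
    intro n hn
    rw [app_lam hn, hGF _ (app_mem hfun hn)]
  convert h2
  refine isFunc_ext hfun (isFunc_lam (y := S) fun n hn => ?_) fun n hn => ?_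
  · rw [h3 n hn]
    exact app_mem hfun hn
  · rw [app_lam hn, h3 n hn]

theorem SeqClosed.of_cardLEIn (hWV : W ⊆ V) {S T : ZFSet.{u}} (h : CardLEIn W S T)
    (hT : SeqClosed V W T) : SeqClosed V W S := by
  have hS := h.mem_left
  obtain ⟨i, hi, hfun, hinj⟩ := h.exists_app
  have : Param V i := ⟨hWV hi⟩
  have : Param W i := ⟨hi⟩
  have : Param W S := ⟨hS⟩
  refine hT.of_term (fun x => app i x)
    (fun y => ZFSet.sUnion (ZFSet.sep (fun x => app i x = y) S))
    (fun x hx => app_mem hfun hx) fun x hx => sUnion_sep_app_eq hinj hx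

theorem SeqClosed.of_surjection (hWV : W ⊆ V) {S T e : ZFSet.{u}} (hT : SeqClosed V W T)
    (hTV : T ∈ V) (he : e ∈ W) (h : ∀ s ∈ S, ∃ i ∈ T, app e i = s) : SeqClosed V W S := by
  intro f hf hfun
  have : Param V f := ⟨hf⟩
  have : Param V e := ⟨hWV he⟩
  have : Param W e := ⟨he⟩
  obtain ⟨c, hc, hcfun, hce⟩ := exists_choice_model omega_mem_model hTV
    (fun n i => app e i = app f n) fun n hn => h _ (app_mem hfun hn)
  have : Param W c := ⟨hT c hc hcfun⟩
  have h2 : lam ZFSet.omega (fun n => app e (app c n)) ∈ W := mem_model_of_isTerm _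
  convert h2
  refine isFunc_ext hfun (isFunc_lam (y := S) fun n hn => ?_) fun n hn => ?_
  · rw [hce n hn]
    exact app_mem hfun hn
  · rw [app_lam hn, hce n hn]

/-- A sequence in `S ∪ {b}` is recovered from a sequence in `S` and a sequence of truth values. -/
theorem SeqClosed.insert {S b : ZFSet.{u}} (hS : SeqClosed V W S)
    (hω : SeqClosed V W ZFSet.omega) (hne : S.Nonempty) (hSV : S ∈ V) (hbV : b ∈ V) (hb : b ∈ W) :
    SeqClosed V W (insert b S) := by
  classical
  intro f hf hfun
  have : Param V f := ⟨hf⟩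
  have : Param V b := ⟨hbV⟩
  have : Param W b := ⟨hb⟩
  obtain ⟨s, hs⟩ := hne
  have : Param V s := ⟨mem_of_mem_model hSV hs⟩
  have h1 : lam ZFSet.omega (fun n => if app f n = b then s else app f n) ∈ W := by
    refine hS _ (mem_model_of_isTerm _) (isFunc_lam fun n hn => ?_)
    split_ifs with h
    · exact hs
    · exact (ZFSet.mem_insert_iff.1 (app_mem hfun hn)).resolve_left h
  have h2 : lam ZFSet.omega (fun n => if app f n = b then ∅ else {∅}) ∈ W := by
    refine hω _ (mem_model_of_isTerm _) (isFunc_lam fun n hn => ?_)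
    split_ifs with h
    · exact ZFSet.omega_zero
    · exact singleton_empty_mem_omega
  have : Param W _ := ⟨h1⟩
  have : Param W _ := ⟨h2⟩
  have h3 : lam ZFSet.omega (fun m =>
    if app (lam ZFSet.omega (fun n => if app f n = b then ∅ else {∅})) m = ∅ then b else
      app (lam ZFSet.omega (fun n => if app f n = b then s else app f n)) m) ∈ W :=
    mem_model_of_isTerm _
  have h4 : ∀ n ∈ ZFSet.omega,
      (if app (lam ZFSet.omega (fun n => if app f n = b then ∅ else {∅})) n = ∅ then b else
      app (lam ZFSet.omega (fun n => if app f n = b then s else app f n)) n) = app f n := by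
    intro n hn
    rw [app_lam hn, app_lam hn]
    by_cases h : app f n = b
    · simp [h]
    · simp [h, singleton_empty_ne_empty]
  convert h3
  refine isFunc_ext hfun (isFunc_lam (y := Insert.insert b S) fun n hn => ?_) fun n hn => ?_
  · rw [h4 n hn]
    exact app_mem hfun hn
  · rw [app_lam hn, h4 n hn]

/-- The elements of `D` in the closure of `S` under the binary operation `op`, computed in `M`. -/
noncomputable def opClosure (M : Set ZFSet.{u}) (D op S : ZFSet.{u}) : ZFSet.{u} :=
  ZFSet.sep (fun z => ∀ C, C ∈ M → S ⊆ C →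
    (∀ s, s ∈ C → ∀ t, t ∈ C → app op (ZFSet.pair s t) ∈ C) → z ∈ C) D

instance IsTerm.opClosure {M : Set ZFSet.{u}} [hM : Fact (IsTransitiveModelZFC M)]
    {D op S : (ℕ → M) → ZFSet.{u}} [hD : IsTerm M D] [hop : IsTerm M op] [hS : IsTerm M S] :
    IsTerm M fun v => opClosure M (D v) (op v) (S v) := by
  unfold InnerModel.opClosure
  have := hS.subst Nat.succ
  have := hS.subst (· + 2)
  have := hop.subst (· + 4)
  infer_instance

section
variable {M : Set ZFSet.{u}} {D op S : ZFSet.{u}}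

theorem subset_opClosure (hS : S ⊆ D) : S ⊆ opClosure M D op S :=
  fun _ hx => ZFSet.mem_sep.2 ⟨hS hx, fun _ _ h _ => h hx⟩

theorem opClosure_closed (hop : ZFSet.IsFunc (ZFSet.prod D D) D op) {s t : ZFSet.{u}}
    (hs : s ∈ opClosure M D op S) (ht : t ∈ opClosure M D op S) :
    app op (ZFSet.pair s t) ∈ opClosure M D op S := by
  obtain ⟨hs, hs'⟩ := ZFSet.mem_sep.1 hs
  obtain ⟨ht, ht'⟩ := ZFSet.mem_sep.1 ht
  exact ZFSet.mem_sep.2 ⟨app_mem hop (ZFSet.pair_mem_prod.2 ⟨hs, ht⟩), fun C hC hSC h =>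
    h s (hs' C hC hSC h) t (ht' C hC hSC h)⟩

theorem opClosure_subset {C : ZFSet.{u}} (hC : C ∈ M) (hSC : S ⊆ C)
    (h : ∀ s ∈ C, ∀ t ∈ C, app op (ZFSet.pair s t) ∈ C) : opClosure M D op S ⊆ C :=
  fun _ hz => (ZFSet.mem_sep.1 hz).2 C hC hSC h

variable [hM : Fact (IsTransitiveModelZFC M)]

theorem opClosure_mem_model (hD : D ∈ M) (hop : op ∈ M) (hS : S ∈ M) : opClosure M D op S ∈ M :=
  have : Param M D := ⟨hD⟩
  have : Param M op := ⟨hop⟩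
  have : Param M S := ⟨hS⟩
  mem_model_of_isTerm _

theorem opClosure_mono {S' : ZFSet.{u}} (hD : D ∈ M) (hop : op ∈ M) (hS' : S' ∈ M)
    (hopf : ZFSet.IsFunc (ZFSet.prod D D) D op) (h : S ⊆ opClosure M D op S') :
    opClosure M D op S ⊆ opClosure M D op S' :=
  opClosure_subset (opClosure_mem_model hD hop hS') h fun _ hs _ ht => opClosure_closed hopf hs ht

/-- Every element of the closure of `S` is in the closure of the range of a sequence in `S`. -/
theorem exists_seq_of_mem_opClosure (hD : D ∈ M) (hop : op ∈ M) (hS : S ∈ M) (hSD : S ⊆ D)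
    (hopf : ZFSet.IsFunc (ZFSet.prod D D) D op) {z : ZFSet.{u}} (hz : z ∈ opClosure M D op S) :
    ∃ g ∈ M, ZFSet.IsFunc ZFSet.omega S g ∧
      z ∈ opClosure M D op (img (fun n => app g n) ZFSet.omega) := by
  classical
  have : Param M D := ⟨hD⟩
  have : Param M op := ⟨hop⟩
  have : Param M S := ⟨hS⟩
  set Z := ZFSet.sep (fun z => ∃ g, g ∈ M ∧ (ZFSet.IsFunc ZFSet.omega S g ∧
      z ∈ opClosure M D op (img (fun n => app g n) ZFSet.omega))) D with hZ
  have hZM : Z ∈ M := mem_model_of_isTerm _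
  have hgD : ∀ g, ZFSet.IsFunc ZFSet.omega S g → img (fun n => app g n) ZFSet.omega ⊆ D := by
    rintro g hg x hx
    obtain ⟨n, hn, rfl⟩ := mem_img.1 hx
    exact hSD (app_mem hg hn)
  suffices h : opClosure M D op S ⊆ Z from (ZFSet.mem_sep.1 (h hz)).2
  refine opClosure_subset hZM (fun x hx => ?_) fun s hs t ht => ?_
  · have : Param M x := ⟨mem_of_mem_model hS hx⟩
    have hf : ZFSet.IsFunc ZFSet.omega S (lam ZFSet.omega fun _ => x) := isFunc_lam fun _ _ => hx
    refine ZFSet.mem_sep.2 ⟨hSD hx, _, mem_model_of_isTerm (lam ZFSet.omega fun _ => x), hf,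
      subset_opClosure (hgD _ hf) (mem_img.2 ⟨∅, ZFSet.omega_zero, app_lam ZFSet.omega_zero⟩)⟩
  · obtain ⟨hsD, g, hg, hgf, hsg⟩ := ZFSet.mem_sep.1 hs
    obtain ⟨htD, h, hh, hhf, hth⟩ := ZFSet.mem_sep.1 ht
    have : Param M g := ⟨hg⟩
    have : Param M h := ⟨hh⟩
    obtain ⟨k, hk, hkf, hkm⟩ := exists_merge (G := lam ZFSet.omega fun n => if n = ∅ then g else h)
      (B := S) (M := M) (mem_model_of_isTerm _) (fun n hn => by
        rw [app_lam hn]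
        split_ifs
        exacts [hgf, hhf])
    have : Param M k := ⟨hk⟩
    have hkM : img (fun n => app k n) ZFSet.omega ∈ M := mem_model_of_isTerm _
    refine ZFSet.mem_sep.2 ⟨app_mem hopf (ZFSet.pair_mem_prod.2 ⟨hsD, htD⟩), k, hk, hkf,
      opClosure_closed hopf (opClosure_mono hD hop hkM hopf ?_ hsg)
        (opClosure_mono hD hop hkM hopf ?_ hth)⟩
    · intro x hx
      obtain ⟨n, hn, rfl⟩ := mem_img.1 hx
      obtain ⟨m, hm, heq⟩ := hkm ∅ ZFSet.omega_zero n hn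
      rw [app_lam ZFSet.omega_zero, if_pos rfl] at heq
      exact subset_opClosure (hgD _ hkf) (mem_img.2 ⟨m, hm, heq⟩)
    · intro x hx
      obtain ⟨n, hn, rfl⟩ := mem_img.1 hx
      obtain ⟨m, hm, heq⟩ := hkm {∅} singleton_empty_mem_omega n hn
      rw [app_lam singleton_empty_mem_omega, if_neg singleton_empty_ne_empty] at heq
      exact subset_opClosure (hgD _ hkf) (mem_img.2 ⟨m, hm, heq⟩)

end

/-- If every sequence in `S` belongs to `W`, then so does every sequence in the closure of `S` under
a binary operation of `W`: such a sequence lies in the closure of a sequence in `S`, which is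
countable in `W`. -/
theorem SeqClosed.opClosure (hWV : W ⊆ V) (hω : SeqClosed V W ZFSet.omega) {D op S : ZFSet.{u}}
    (hD : D ∈ W) (hop : op ∈ W) (hopf : ZFSet.IsFunc (ZFSet.prod D D) D op) (hSV : S ∈ V)
    (hSD : S ⊆ D) (hS : SeqClosed V W S) : SeqClosed V W (opClosure V D op S) := by
  intro f hf hfun
  have : Param V f := ⟨hf⟩
  have : Param V D := ⟨hWV hD⟩
  have : Param V op := ⟨hWV hop⟩
  have : Param V S := ⟨hSV⟩
  obtain ⟨p, hp, hpm⟩ := exists_powerset_model (prod_mem_model (omega_mem_model (M := V)) hSV)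
  obtain ⟨G, hG, -, hGf⟩ := exists_choice_model omega_mem_model hp (fun n g =>
    ZFSet.IsFunc ZFSet.omega S g ∧
      app f n ∈ InnerModel.opClosure V D op (img (fun n => app g n) ZFSet.omega)) (by
    intro n hn
    obtain ⟨g, hg, hgf, h⟩ := exists_seq_of_mem_opClosure (hWV hD) (hWV hop) hSV hSD hopf
      (app_mem hfun hn)
    exact ⟨g, (hpm g).2 ⟨hg, hgf.1⟩, hgf, h⟩)
  obtain ⟨g, hg, hgf, hgG⟩ := exists_merge hG fun n hn => (hGf n hn).1
  have hgD := isFunc_mono hgf hSD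
  obtain ⟨C, hC, hCD, hgC, hCop, e, he, heC⟩ := exists_closed_image isOrdinal_omega omega_mem_model
    subset_rfl hD hop hopf (hS g hg hgf) hgD
  refine hω.of_surjection hWV omega_mem_model he heC f hf ⟨fun z hz => ?_, hfun.2⟩
  obtain ⟨n, hn, b, hb, rfl⟩ := ZFSet.mem_prod.1 (hfun.1 hz)
  refine ZFSet.pair_mem_prod.2 ⟨hn, ?_⟩
  rw [← app_eq hfun hz]
  refine opClosure_subset (hWV hC) (fun x hx => ?_) hCop (hGf n hn).2
  obtain ⟨m, hm, rfl⟩ := mem_img.1 hx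
  obtain ⟨k, hk, hkm⟩ := hgG n hn m hm
  rw [← hkm]
  exact hgC k hk

end InnerModel

namespace InnerModel

section countable
variable {M : Set ZFSet.{u}} [hM : Fact (IsTransitiveModelZFC M)]

/-! ### Countable sets and the continuum -/

theorem omega_mem_of_continuumLTIn {κ : ZFSet.{u}} (hκ : κ.IsOrdinal) (hc : ContinuumLTIn M κ) :
    ZFSet.omega ∈ κ := by
  obtain ⟨c, hcκ, -, p, hp, hpω, hpc⟩ := hc
  have hle : CardLEIn M ZFSet.omega p := by
    refine .of_term (fun n => {n}) omega_mem_model (fun n hn => (hpω _ ?_).2 ?_)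
      fun a _ b _ h => ZFSet.singleton_injective h
    · exact singleton_mem_model (mem_of_mem_model omega_mem_model hn)
    · intro x hx
      rwa [ZFSet.mem_singleton.1 hx]
  exact isOrdinal_omega.mem_of_subset_of_mem hκ (omega_subset_of_not_finite (hκ.mem hcκ)
    ((hle.trans hpc.cardLEIn).not_finite not_finite_omega)) hcκ

/-- The range of a sequence is finite or countably infinite. -/
theorem sameCardIn_omega_of_range {f : ZFSet.{u}} (hf : f ∈ M)
    (hinf : ¬ (img (fun n => app f n) ZFSet.omega : Set ZFSet.{u}).Finite) :
    SameCardIn M (img (fun n => app f n) ZFSet.omega) ZFSet.omega := by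
  have : Param M f := ⟨hf⟩
  -- the indices of first occurrences
  set I := ZFSet.sep (fun n => ∀ m, m ∈ n → app f m ≠ app f n) ZFSet.omega with hI
  have hIM : I ∈ M := mem_model_of_isTerm _
  have hIω : I ⊆ ZFSet.omega := ZFSet.sep_subset
  obtain ⟨θ, hθ, hθo, e, he, hefun, hesurj, hlt⟩ := exists_orderType hIM fun x hx =>
    isOrdinal_of_mem_omega (hIω hx)
  have : Param M e := ⟨he⟩
  have hfirst : ∀ n ∈ ZFSet.omega, ∃ a ∈ θ, app f (app e a) = app f n := by
    intro n hn
    obtain ⟨m, ⟨hm, hmn⟩, hmin⟩ := ZFSet.mem_wf.has_min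
      {m : ZFSet.{u} | m ∈ ZFSet.omega ∧ app f m = app f n} ⟨n, hn, rfl⟩
    obtain ⟨a, ha, hea⟩ := hesurj m (ZFSet.mem_sep.2 ⟨hm, fun k hk hkm =>
      hmin k ⟨omega_trans hm hk, hkm.trans hmn⟩ hk⟩)
    exact ⟨a, ha, by rw [hea, hmn]⟩
  have hθω : θ = ZFSet.omega := by
    refine subset_antisymm (fun a ha => ?_) (omega_subset_of_not_finite hθo fun hfin => hinf ?_)
    · exact (hθo.mem ha).mem_of_subset_of_mem isOrdinal_omega
        (subset_app_of_increasing hθo isOrdinal_omega (isFunc_mono hefun hIω) hlt a ha)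
        (hIω (app_mem hefun ha))
    · refine (hfin.image fun a => app f (app e a)).subset ?_
      intro x hx
      obtain ⟨n, hn, rfl⟩ := mem_img.1 hx
      exact hfirst n hn
  rw [hθω] at hfirst hefun hlt
  refine SameCardIn.symm (.of_term (fun n => app f (app e n)) omega_mem_model
    (fun n hn => mem_img.2 ⟨_, hIω (app_mem hefun hn), rfl⟩) (fun a ha b hb hab => ?_)
    fun c hc => ?_)
  · refine injective_of_increasing isOrdinal_omega hlt a ha b hb ?_
    have h1 := app_mem hefun ha
    have h2 := app_mem hefun hb
    rcases (isOrdinal_of_mem_omega (hIω h1)).mem_trichotomous (isOrdinal_of_mem_omega (hIω h2))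
      with h | h | h
    · exact absurd hab ((ZFSet.mem_sep.1 h2).2 _ h)
    · exact h
    · exact absurd hab.symm ((ZFSet.mem_sep.1 h1).2 _ h)
  · obtain ⟨n, hn, rfl⟩ := mem_img.1 hc
    exact hfirst n hn

/-- Over a regular cardinal above the continuum, the last clause in the definition of a covering
matrix follows from the others: the traces of the entries on a countable set `X` number at most
`2^ω`, so all of them occur before some fixed column. -/
theorem localized_of_coherent {μ K X : ZFSet.{u}} (hK : K ∈ M) (hμ : IsRegularIn M μ)
    (hc : ContinuumLTIn M μ)
    (hcoh : ∀ β ∈ μ, ∀ γ ∈ β, ∀ α ∈ ZFSet.omega, ∃ η ∈ ZFSet.omega,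
      app K (ZFSet.pair α γ) ⊆ app K (ZFSet.pair η β))
    (hX : CardLEIn M X ZFSet.omega) :
    ∃ γ ∈ μ, ∀ β ∈ μ, ∀ η ∈ ZFSet.omega, ∃ α ∈ ZFSet.omega,
      app K (ZFSet.pair η β) ∩ X ⊆ app K (ZFSet.pair α γ) := by
  obtain ⟨c, hcμ, -, p, hp, hpω, hpc⟩ := hc
  obtain ⟨j, hj, hjfun, hjinj⟩ := hX.exists_app
  obtain ⟨e, he, hefun, -, hesurj⟩ := hpc.symm.exists_app
  have hμo := hμ.1.2.1
  have : Param M K := ⟨hK⟩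
  have : Param M μ := ⟨hμ.1.1⟩
  have : Param M X := ⟨hX.mem_left⟩
  have : Param M j := ⟨hj⟩
  have : Param M e := ⟨he⟩
  have hcM : c ∈ M := mem_of_mem_model hμ.1.1 hcμ
  -- every trace that occurs, occurs first in a column chosen in dependence of its code
  obtain ⟨f, hf, hfun, hfmin⟩ := exists_choice_model hcM hμ.1.1 (fun ν β =>
      (∃ γ, γ ∈ μ ∧ ∃ n, n ∈ ZFSet.omega ∧
        img (fun x => app j x) (app K (ZFSet.pair n γ) ∩ X) = app e ν) →
      ∃ n, n ∈ ZFSet.omega ∧ img (fun x => app j x) (app K (ZFSet.pair n β) ∩ X) = app e ν) (by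
    intro ν _
    by_cases h : ∃ γ ∈ μ, ∃ n ∈ ZFSet.omega,
        img (fun x => app j x) (app K (ZFSet.pair n γ) ∩ X) = app e ν
    · obtain ⟨γ, hγ, h⟩ := h
      exact ⟨γ, hγ, fun _ => h⟩
    · exact ⟨∅, hμ.2.1 ZFSet.omega_zero, fun h' => absurd h' h⟩)
  obtain ⟨δ, hδ, hδf⟩ := hμ.2.2 c hcμ f hf hfun
  refine ⟨δ, hδ, fun β hβ η hη => ?_⟩
  have : Param M β := ⟨mem_of_mem_model hμ.1.1 hβ⟩
  have : Param M η := ⟨mem_of_mem_model omega_mem_model hη⟩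
  have hS : img (fun x => app j x) (app K (ZFSet.pair η β) ∩ X) ∈ p := by
    refine (hpω _ (mem_model_of_isTerm _)).2 fun y hy => ?_
    obtain ⟨x, hx, rfl⟩ := mem_img.1 hy
    exact app_mem hjfun (ZFSet.mem_inter.1 hx).2
  obtain ⟨ν, hν, hνS⟩ := hesurj _ hS
  obtain ⟨n, hn, hnS⟩ := hfmin ν hν ⟨β, hβ, η, hη, hνS.symm⟩
  obtain ⟨m, hm, hnm⟩ := hcoh δ hδ _ (hδf ν hν) n hn
  refine ⟨m, hm, fun x hx => hnm ?_⟩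
  have h1 : app j x ∈ img (fun x => app j x) (app K (ZFSet.pair n (app f ν)) ∩ X) := by
    rw [hnS, hνS]
    exact mem_img.2 ⟨x, hx, rfl⟩
  obtain ⟨y, hy, hyx⟩ := mem_img.1 h1
  obtain ⟨hy, hyX⟩ := ZFSet.mem_inter.1 hy
  rwa [← hjinj y hyX x (ZFSet.mem_inter.1 hx).2 hyx]

/-- An unbounded subset of a regular cardinal has full cardinality. -/
theorem sameCardIn_of_unbounded {μ Y : ZFSet.{u}} (hμ : IsRegularIn M μ) (hY : Y ∈ M)
    (hYμ : Y ⊆ μ) (hunb : ∀ α ∈ μ, ∃ β ∈ Y, α ⊆ β) : SameCardIn M Y μ := by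
  have hμo := hμ.1.2.1
  obtain ⟨θ, hθ, hθo, e, he, hefun, hesurj, hlt⟩ := exists_orderType hY fun x hx =>
    hμo.mem (hYμ hx)
  have hθμ : θ ⊆ μ := fun a ha => (hθo.mem ha).mem_of_subset_of_mem hμo
    (subset_app_of_increasing hθo hμo (isFunc_mono hefun hYμ) hlt a ha) (hYμ (app_mem hefun ha))
  have hθeq : θ = μ := by
    refine (hθo.eq_or_mem_of_subset hμo hθμ).resolve_right fun h => ?_
    obtain ⟨β, hβ, hβe⟩ := hμ.2.2 θ h e he (isFunc_mono hefun hYμ)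
    obtain ⟨y, hy, hβy⟩ := hunb β hβ
    obtain ⟨a, ha, rfl⟩ := hesurj y hy
    exact ZFSet.mem_irrefl _ (hβy (hβe a ha))
  subst hθeq
  exact (SameCardIn.of_app he hefun (injective_of_increasing hθo hlt) hesurj).symm

end countable

variable {V W : Set ZFSet.{u}} [hV : Fact (IsTransitiveModelZFC V)]
  [hW : Fact (IsTransitiveModelZFC W)]

/-! ### The first cardinal with a new countable subset -/

/-- A sequence in an infinite `α < κ` is coded, through a pairing function of `W`, by a countable
subset of `α`. -/
theorem seqClosed_of_mem (hWV : W ⊆ V) {κ α : ZFSet.{u}} (hκ : κ.IsOrdinal) (hκW : κ ∈ W)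
    (hω : ZFSet.omega ∈ κ)
    (hleast : ∀ α ∈ κ, ∀ X ∈ V, X ⊆ α → SameCardIn V X ZFSet.omega → X ∈ W) (hα : α ∈ κ) :
    SeqClosed V W α := by
  wlog hωα : ZFSet.omega ⊆ α generalizing α
  · have h := ((hκ.mem hα).subset_total isOrdinal_omega).resolve_right hωα
    exact (this hω subset_rfl).mono h
  intro f hf hfun
  have hαW := mem_of_mem_model hκW hα
  obtain ⟨p, hp, hpfun, hpinj⟩ := (cardLEIn_prod_self (hκ.mem hα) hαW hωα).exists_app
  have : Param V p := ⟨hWV hp⟩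
  have : Param W p := ⟨hp⟩
  have : Param V f := ⟨hf⟩
  have : Param W α := ⟨hαW⟩
  have hpair : ∀ n ∈ ZFSet.omega, ZFSet.pair n (app f n) ∈ ZFSet.prod α α := fun n hn =>
    ZFSet.pair_mem_prod.2 ⟨hωα hn, app_mem hfun hn⟩
  -- the sequence `f` is coded by the countable set of the values `p (n, f n)`
  have hX : img (fun n => app p (ZFSet.pair n (app f n))) ZFSet.omega ∈ W := by
    refine hleast α hα _ (mem_model_of_isTerm _) (fun x hx => ?_)
      (SameCardIn.of_term (fun n => app p (ZFSet.pair n (app f n))) omega_mem_model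
        (fun n hn => mem_img.2 ⟨n, hn, rfl⟩) (fun n hn m hm h => ?_) fun c hc => ?_).symm
    · obtain ⟨n, hn, rfl⟩ := mem_img.1 hx
      exact app_mem hpfun (hpair n hn)
    · exact (ZFSet.pair_inj.1 (hpinj _ (hpair n hn) _ (hpair m hm) h)).1
    · exact mem_img.1 hc
  have : Param W _ := ⟨hX⟩
  have hW : ZFSet.sep (fun z => app p z ∈ img (fun n => app p (ZFSet.pair n (app f n))) ZFSet.omega)
      (ZFSet.prod ZFSet.omega α) ∈ W := mem_model_of_isTerm _
  convert hW
  ext z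
  rw [ZFSet.mem_sep, mem_img]
  constructor
  · intro hz
    obtain ⟨n, hn, a, ha, rfl⟩ := ZFSet.mem_prod.1 (hfun.1 hz)
    exact ⟨hfun.1 hz, n, hn, by rw [app_eq hfun hz]⟩
  · rintro ⟨hz, n, hn, h⟩
    obtain ⟨m, hm, a, ha, rfl⟩ := ZFSet.mem_prod.1 hz
    rw [← hpinj _ (hpair n hn) _ (ZFSet.pair_mem_prod.2 ⟨hωα hm, ha⟩) h]
    exact pair_app_mem hfun hn

theorem not_seqClosed {κ : ZFSet.{u}}
    (hnew : ∃ X ∈ V, X ⊆ κ ∧ SameCardIn V X ZFSet.omega ∧ X ∉ W) : ¬ SeqClosed V W κ := by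
  obtain ⟨X, -, hXκ, hXω, hXW⟩ := hnew
  obtain ⟨f, hf, hfun, -, hsurj⟩ := hXω.symm.exists_app
  intro h
  have : Param W f := ⟨h f hf (isFunc_mono hfun hXκ)⟩
  have h1 : img (fun n => app f n) ZFSet.omega ∈ W := mem_model_of_isTerm _
  apply hXW
  convert h1
  ext x
  rw [mem_img]
  exact ⟨fun hx => hsurj x hx, fun ⟨n, hn, h⟩ => h ▸ app_mem hfun hn⟩

/-- An injection in `W` of `κ` into a smaller ordinal would make `κ` sequence-closed. -/
theorem isCardinalIn_of_new (hWV : W ⊆ V) {κ : ZFSet.{u}} (hκ : κ.IsOrdinal) (hκW : κ ∈ W)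
    (hnot : ¬ SeqClosed V W κ) (hmem : ∀ α ∈ κ, SeqClosed V W α) : IsCardinalIn W κ :=
  ⟨hκW, hκ, fun α hα h => hnot ((hmem α hα).of_cardLEIn hWV h)⟩

omit hW in
/-- A new countable subset yields a new cofinal sequence. -/
theorem exists_cofinal_seq {κ : ZFSet.{u}} (hκ : κ.IsOrdinal)
    (hnew : ∃ X ∈ V, X ⊆ κ ∧ SameCardIn V X ZFSet.omega ∧ X ∉ W)
    (hleast : ∀ α ∈ κ, ∀ X ∈ V, X ⊆ α → SameCardIn V X ZFSet.omega → X ∈ W) :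
    ∃ h ∈ V, ZFSet.IsFunc ZFSet.omega κ h ∧ ∀ α ∈ κ, ∃ n ∈ ZFSet.omega, α ⊆ app h n := by
  obtain ⟨X, hXV, hXκ, hXω, hXW⟩ := hnew
  obtain ⟨f, hf, hfun, -, hsurj⟩ := hXω.symm.exists_app
  refine ⟨f, hf, isFunc_mono hfun hXκ, ?_⟩
  by_contra! hcon
  obtain ⟨α, hα, h⟩ := hcon
  refine hXW (hleast α hα X hXV (fun x hx => ?_) hXω)
  obtain ⟨n, hn, rfl⟩ := hsurj x hx
  exact (ZFSet.IsOrdinal.not_subset_iff_mem (hκ.mem hα) (hκ.mem (hXκ hx))).1 (h n hn)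

end InnerModel

namespace InnerModel

/-! ### Closure under a function of finite sets -/

theorem mem_finSubsets {x s : ZFSet.{u}} :
    s ∈ finSubsets x ↔ s ⊆ x ∧ (s : Set ZFSet.{u}).Finite := by
  rw [finSubsets, ZFSet.mem_sep, ZFSet.mem_powerset]

theorem finite_induction {P : ZFSet.{u} → Prop} (h0 : P ∅)
    (hs : ∀ c s : ZFSet.{u}, (s : Set ZFSet.{u}).Finite → P s → P (insert c s)) {s : ZFSet.{u}}
    (hfin : (s : Set ZFSet.{u}).Finite) : P s := by
  suffices h : ∀ t : Set ZFSet.{u}, t.Finite → ∀ s : ZFSet.{u}, (s : Set ZFSet.{u}) = t → P s from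
    h _ hfin s rfl
  intro t ht
  induction t, ht using Set.Finite.induction_on with
  | empty =>
    intro s hs
    convert h0
    exact SetLike.coe_injective (by simpa using hs)
  | @insert c t hct ht ih =>
    intro s hst
    have h1 : ((s \ {c} : ZFSet.{u}) : Set ZFSet.{u}) = t := by
      rw [ZFSet.coe_sdiff, hst, ZFSet.coe_singleton]
      simpa using hct
    have h2 : s = insert c (s \ {c}) := by
      apply SetLike.coe_injective
      rw [ZFSet.coe_insert, h1, hst]
    rw [h2]
    exact hs c _ (h1 ▸ ht) (ih _ h1)

variable {V W : Set ZFSet.{u}} [hV : Fact (IsTransitiveModelZFC V)]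
  [hW : Fact (IsTransitiveModelZFC W)]

/-- If every sequence in `A` belongs to `W`, then so does every sequence in a suitable closure of
`A` under a function `ψ` of `W` on finite sets. The closure is computed in the algebra of finite
sets whose binary operation maps `(s, s)` to `{ψ s}` and other pairs to their union. -/
theorem exists_seqClosed_closure (hWV : W ⊆ V) (hω : SeqClosed V W ZFSet.omega)
    {ν ψ A : ZFSet.{u}} (hν : ν ∈ V) (hψ : ψ ∈ W)
    (hψf : ZFSet.IsFunc (finSubsets ν) ν ψ) (hA : A ∈ V) (hAν : A ⊆ ν)
    (hne : A.Nonempty) (hAseq : SeqClosed V W A) :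
    ∃ Y ∈ V, A ⊆ Y ∧ Y ⊆ ν ∧ (∀ s ∈ finSubsets Y, app ψ s ∈ Y) ∧ SeqClosed V W Y := by
  classical
  set D := finSubsets ν with hD
  have hDW : D ∈ W := mem_model_of_isFunc hψ hψf
  have : Param W D := ⟨hDW⟩
  have : Param W ψ := ⟨hψ⟩
  have : Param V ν := ⟨hν⟩
  have : Param V D := ⟨hWV hDW⟩
  have : Param V ψ := ⟨hWV hψ⟩
  have : Param V A := ⟨hA⟩
  set op := lam (ZFSet.prod D D)
    (fun z => if fst z = snd z then {app ψ (fst z)} else fst z ∪ snd z) with hop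
  have hopW : op ∈ W := mem_model_of_isTerm _
  have : Param V op := ⟨hWV hopW⟩
  have happ_self : ∀ s ∈ D, app op (ZFSet.pair s s) = {app ψ s} := by
    intro s hs
    rw [hop, app_lam (ZFSet.pair_mem_prod.2 ⟨hs, hs⟩), fst_pair, snd_pair, if_pos rfl]
  have happ_ne : ∀ s ∈ D, ∀ t ∈ D, s ≠ t → app op (ZFSet.pair s t) = s ∪ t := by
    intro s hs t ht hst
    rw [hop, app_lam (ZFSet.pair_mem_prod.2 ⟨hs, ht⟩), fst_pair, snd_pair, if_neg hst]
  have hsingle : ∀ a ∈ ν, {a} ∈ D := by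
    intro a ha
    refine mem_finSubsets.2 ⟨fun x hx => ?_, by simp⟩
    rwa [ZFSet.mem_singleton.1 hx]
  have hopf : ZFSet.IsFunc (ZFSet.prod D D) D op := by
    refine isFunc_lam fun z hz => ?_
    obtain ⟨s, hs, t, ht, rfl⟩ := ZFSet.mem_prod.1 hz
    rw [fst_pair, snd_pair]
    split_ifs with h
    · exact hsingle _ (app_mem hψf hs)
    · rw [hD, mem_finSubsets] at hs ht ⊢
      refine ⟨fun x hx => (ZFSet.mem_union.1 hx).elim (fun h => hs.1 h) fun h => ht.1 h, ?_⟩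
      rw [ZFSet.coe_union]
      exact hs.2.union ht.2
  have hempty : (∅ : ZFSet) ∈ D := mem_finSubsets.2 ⟨ZFSet.empty_subset _, by simp⟩
  have hψ0 := app_mem hψf hempty
  have hψ0W : app ψ ∅ ∈ W := mem_model_of_isTerm _
  set A' := insert (app ψ ∅) A with hA'
  have hA'V : A' ∈ V := mem_model_of_isTerm _
  have : Param V A' := ⟨hA'V⟩
  have hA'ν : A' ⊆ ν := by
    intro x hx
    rcases ZFSet.mem_insert_iff.1 hx with rfl | hx
    exacts [hψ0, hAν hx]
  have hA'seq : SeqClosed V W A' := hAseq.insert hω hne hA (hWV hψ0W) hψ0W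
  set S := img (fun a => {a}) A' with hS
  have hSV : S ∈ V := mem_model_of_isTerm _
  have : Param V S := ⟨hSV⟩
  have hSD : S ⊆ D := by
    intro x hx
    obtain ⟨a, ha, rfl⟩ := mem_img.1 hx
    exact hsingle a (hA'ν ha)
  have hSseq : SeqClosed V W S := by
    refine hA'seq.of_term (fun x => ZFSet.sUnion x) (fun a => {a}) ?_ ?_
    all_goals
      intro x hx
      obtain ⟨a, ha, rfl⟩ := mem_img.1 hx
      rw [ZFSet.sUnion_singleton]
    exact ha
  have hCseq := SeqClosed.opClosure hWV hω hDW hopW hopf hSV hSD hSseq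
  set C := opClosure V D op S with hC
  have hCV : C ∈ V := mem_model_of_isTerm _
  have : Param V C := ⟨hCV⟩
  have hCD : C ⊆ D := ZFSet.sep_subset
  have hSC : S ⊆ C := subset_opClosure hSD
  have hCop : ∀ s ∈ C, ∀ t ∈ C, app op (ZFSet.pair s t) ∈ C := fun s hs t ht =>
    opClosure_closed hopf hs ht
  have hfin : ∀ s : ZFSet.{u}, (s : Set ZFSet.{u}).Finite → (∀ x ∈ s, {x} ∈ C) →
      s = ∅ ∨ s ∈ C := by
    intro s hs
    refine finite_induction (P := fun s => (∀ x ∈ s, {x} ∈ C) → s = ∅ ∨ s ∈ C)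
      (fun _ => Or.inl rfl) (fun c s _ ih h => Or.inr ?_) hs
    have hc := h c (ZFSet.mem_insert _ _)
    rcases ih fun x hx => h x (ZFSet.mem_insert_of_mem _ hx) with rfl | hsC
    · convert hc using 1
      ext; simp
    · by_cases hcs : {c} = s
      · convert hsC using 1
        ext x
        rw [ZFSet.mem_insert_iff, or_iff_right_of_imp]
        rintro rfl
        exact hcs ▸ ZFSet.mem_singleton.2 rfl
      · have := hCop _ hc _ hsC
        rwa [happ_ne _ (hCD hc) _ (hCD hsC) hcs, ← ZFSet.insert_eq] at this
  refine ⟨ZFSet.sep (fun z => {z} ∈ C) ν, mem_model_of_isTerm _, fun a ha => ?_,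
    ZFSet.sep_subset, fun s hs => ?_, ?_⟩
  · exact ZFSet.mem_sep.2 ⟨hAν ha, hSC (mem_img.2 ⟨a, ZFSet.mem_insert_of_mem _ ha, rfl⟩)⟩
  · obtain ⟨hsY, hsfin⟩ := mem_finSubsets.1 hs
    have hsD : s ∈ D := mem_finSubsets.2 ⟨hsY.trans ZFSet.sep_subset, hsfin⟩
    refine ZFSet.mem_sep.2 ⟨app_mem hψf hsD, ?_⟩
    rcases hfin s hsfin fun x hx => (ZFSet.mem_sep.1 (hsY hx)).2 with rfl | hsC
    · exact hSC (mem_img.2 ⟨_, ZFSet.mem_insert _ _, rfl⟩)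
    · rw [← happ_self s hsD]
      exact hCop s hsC s hsC
  · refine hCseq.of_term (fun z => {z}) (fun s => ZFSet.sUnion s)
      (fun x hx => (ZFSet.mem_sep.1 hx).2) fun x _ => ZFSet.sUnion_singleton

/-! ### The covering matrix -/

/-- The covering matrix with entries `K(n, β) = β ∩ cl ({β} ∪ N n)`, where `N n` consists of the
ordinals that are at most `h i` for some `i ≤ n`, and `cl` is the closure under an operation of `W`
that computes each element of `γ` from `γ` and its index in an enumeration of `γ` by ordinals below
`κ`. Coherence holds since the index of `γ` in the enumeration of `β` belongs to some `N n`, so that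
`γ ∈ cl ({β} ∪ N n)`. -/
theorem exists_coveringMatrix (hWV : W ⊆ V) {κ μ h : ZFSet.{u}} (hω : ZFSet.omega ∈ κ)
    (hc : ContinuumLTIn V κ) (hκ : IsCardinalIn W κ) (hseq : ∀ α ∈ κ, SeqClosed V W α)
    (hh : h ∈ V) (hhf : ZFSet.IsFunc ZFSet.omega κ h)
    (hcof : ∀ α ∈ κ, ∃ n ∈ ZFSet.omega, α ⊆ app h n)
    (hμV : IsSuccCardIn V κ μ) (hμW : IsSuccCardIn W κ μ) :
    ∃ K, IsCoveringMatrixIn V ZFSet.omega μ K ∧ ∀ n ∈ ZFSet.omega, ∀ β ∈ μ,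
      SeqClosed V W (app K (ZFSet.pair n β)) := by
  classical
  have hκo := hκ.2.1
  have hκW := hκ.1
  have hμo := hμW.1.2.1
  have hωκ : ZFSet.omega ⊆ κ := hκo.subset_of_mem hω
  have hκμ : κ ⊆ μ := hμo.subset_of_mem hμW.2.1
  obtain ⟨Φ, hΦ, hΦinj⟩ := hμW.exists_injections
  have : Param W Φ := ⟨hΦ⟩
  have : Param W μ := ⟨hμW.1.1⟩
  have : Param V μ := ⟨hμV.1.1⟩
  have : Param V κ := ⟨hWV hκW⟩
  have : Param V h := ⟨hh⟩
  -- `op (γ, ζ)` is the element of `γ` with index `ζ`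
  set op := lam (ZFSet.prod μ μ) (fun z =>
    if ∃ ξ, ξ ∈ fst z ∧ app (app Φ (fst z)) ξ = snd z then
      ZFSet.sUnion (ZFSet.sep (fun ξ => app (app Φ (fst z)) ξ = snd z) (fst z)) else fst z) with hop
  have hopW : op ∈ W := mem_model_of_isTerm _
  have : Param V op := ⟨hWV hopW⟩
  have hsep : ∀ γ ∈ μ, ∀ ξ ∈ γ, ZFSet.sUnion (ZFSet.sep (fun ξ' => app (app Φ γ) ξ' =
      app (app Φ γ) ξ) γ) = ξ := fun γ hγ ξ hξ => sUnion_sep_app_eq (hΦinj γ hγ).2 hξ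
  have hopf : ZFSet.IsFunc (ZFSet.prod μ μ) μ op := by
    refine isFunc_lam fun z hz => ?_
    obtain ⟨γ, hγ, ζ, hζ, rfl⟩ := ZFSet.mem_prod.1 hz
    rw [fst_pair, snd_pair]
    split_ifs with h
    · obtain ⟨ξ, hξ, rfl⟩ := h
      rw [hsep γ hγ ξ hξ]
      exact hμo.mem_trans hξ hγ
    · exact hγ
  have hopapp : ∀ γ ∈ μ, ∀ ξ ∈ γ, app op (ZFSet.pair γ (app (app Φ γ) ξ)) = ξ := by
    intro γ hγ ξ hξ
    rw [hop, app_lam (ZFSet.pair_mem_prod.2 ⟨hγ, hκμ (app_mem (hΦinj γ hγ).1 hξ)⟩), fst_pair,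
      snd_pair, if_pos ⟨ξ, hξ, rfl⟩, hsep γ hγ ξ hξ]
  -- the increasing sequence of bounded subsets of `κ` that generate the entries
  let N : ZFSet.{u} → ZFSet.{u} := fun n =>
    ZFSet.sep (fun ξ => ∃ i, i ∈ insert n n ∧ (ξ ∈ app h i ∨ ξ = app h i)) κ
  have hNdef : ∀ n, N n = ZFSet.sep (fun ξ => ∃ i, i ∈ insert n n ∧
    (ξ ∈ app h i ∨ ξ = app h i)) κ := fun _ => rfl
  have hNκ : ∀ n, N n ⊆ κ := fun n => ZFSet.sep_subset
  have hNbdd : ∀ n ∈ ZFSet.omega, ∃ ν ∈ κ, N n ⊆ ν := by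
    intro n hn
    suffices hi : ∃ ν ∈ κ, ∀ i ∈ insert n n, app h i ⊆ ν by
      obtain ⟨ν, hν, hi⟩ := hi
      refine ⟨insert ν ν, hκ.succ_mem hωκ hν, fun ξ hξ => ?_⟩
      obtain ⟨hξ, i, hin, h⟩ := ZFSet.mem_sep.1 hξ
      rw [ZFSet.mem_insert_iff]
      rcases h with h | rfl
      · exact Or.inr (hi i hin h)
      · exact (hκo.mem hξ).eq_or_mem_of_subset (hκo.mem hν) (hi i hin)
    refine omega_induction (P := fun n => ∃ ν ∈ κ, ∀ i ∈ insert n n, app h i ⊆ ν) ?_ ?_ n hn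
    · refine ⟨app h ∅, app_mem hhf ZFSet.omega_zero, fun i hi => ?_⟩
      rcases ZFSet.mem_insert_iff.1 hi with rfl | hi
      · rfl
      · exact absurd hi (ZFSet.notMem_empty _)
    · rintro n hn ⟨ν, hν, hi⟩
      have h1 := app_mem hhf (ZFSet.omega_succ hn)
      refine ⟨ν ∪ app h (insert n n), ?_, fun i hi' => ?_⟩
      · rcases union_of_isOrdinal (hκo.mem hν) (hκo.mem h1) with h | h <;> rw [h] <;> assumption
      · intro x hx
        rw [ZFSet.mem_union]
        rcases ZFSet.mem_insert_iff.1 hi' with rfl | hi'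
        · exact Or.inr hx
        · exact Or.inl (hi i hi' hx)
  have hNmono : ∀ n ∈ ZFSet.omega, ∀ m ∈ ZFSet.omega, n ⊆ m → N n ⊆ N m := by
    intro n hn m hm hnm ξ hξ
    obtain ⟨hξ, i, hi, h⟩ := ZFSet.mem_sep.1 hξ
    refine ZFSet.mem_sep.2 ⟨hξ, ?_⟩
    rcases ZFSet.mem_insert_iff.1 hi with rfl | hi
    · exact ⟨i, ZFSet.mem_insert_iff.2 ((isOrdinal_of_mem_omega hn).eq_or_mem_of_subset
        (isOrdinal_of_mem_omega hm) hnm), h⟩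
    · exact ⟨i, ZFSet.mem_insert_of_mem _ (hnm hi), h⟩
  have hNcov : ∀ ζ ∈ κ, ∃ n ∈ ZFSet.omega, ζ ∈ N n := by
    intro ζ hζ
    obtain ⟨n, hn, h⟩ := hcof ζ hζ
    refine ⟨n, hn, ZFSet.mem_sep.2 ⟨hζ, n, ZFSet.mem_insert _ _, ?_⟩⟩
    exact ((hκo.mem hζ).eq_or_mem_of_subset (hκo.mem (app_mem hhf hn)) h).symm
  let E : ZFSet.{u} → ZFSet.{u} → ZFSet.{u} := fun n β => opClosure V μ op (insert β (N n))
  have hsub : ∀ n, ∀ β ∈ μ, insert β (N n) ⊆ μ := by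
    intro n β hβ x hx
    rcases ZFSet.mem_insert_iff.1 hx with rfl | hx
    exacts [hβ, hκμ (hNκ n hx)]
  have hmemV : ∀ n ∈ ZFSet.omega, ∀ β ∈ μ, insert β (N n) ∈ V := by
    intro n hn β hβ
    have : Param V β := ⟨mem_of_mem_model hμV.1.1 hβ⟩
    have : Param V n := ⟨mem_of_mem_model omega_mem_model hn⟩
    exact mem_model_of_isTerm _
  have hE : ∀ n, ∀ β ∈ μ, ∀ m ∈ ZFSet.omega, ∀ γ ∈ μ, N n ⊆ N m → β ∈ E m γ → E n β ⊆ E m γ := by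
    intro n β hβ m hm γ hγ hnm hβE
    refine opClosure_mono hμV.1.1 (hWV hopW) (hmemV m hm γ hγ) hopf fun x hx => ?_
    rcases ZFSet.mem_insert_iff.1 hx with rfl | hx
    · exact hβE
    · exact subset_opClosure (hsub m γ hγ) (ZFSet.mem_insert_of_mem _ (hnm hx))
  have hself : ∀ n, ∀ β ∈ μ, β ∈ E n β := fun n β hβ =>
    subset_opClosure (hsub n β hβ) (ZFSet.mem_insert _ _)
  set K := lam (ZFSet.prod ZFSet.omega μ)
    (fun z => snd z ∩ opClosure V μ op (insert (snd z) (N (fst z)))) with hK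
  have hKV : K ∈ V := mem_model_of_isTerm _
  have hKapp : ∀ n ∈ ZFSet.omega, ∀ β ∈ μ, app K (ZFSet.pair n β) = β ∩ E n β := by
    intro n hn β hβ
    rw [hK, app_lam (ZFSet.pair_mem_prod.2 ⟨hn, hβ⟩), fst_pair, snd_pair]
  have hμreg := hμV.isRegularIn hωκ
  have hcoh : ∀ β ∈ μ, ∀ γ ∈ β, ∀ α ∈ ZFSet.omega, ∃ η ∈ ZFSet.omega,
      app K (ZFSet.pair α γ) ⊆ app K (ZFSet.pair η β) := by
    intro β hβ γ hγ α hα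
    have hγμ := hμo.mem_trans hγ hβ
    obtain ⟨m, hm, hmN⟩ := hNcov _ (app_mem (hΦinj β hβ).1 hγ)
    obtain ⟨η, hη, hαη, hmη⟩ : ∃ η ∈ ZFSet.omega, α ⊆ η ∧ m ⊆ η := by
      rcases (isOrdinal_of_mem_omega hα).subset_total (isOrdinal_of_mem_omega hm) with h | h
      exacts [⟨m, hm, h, subset_rfl⟩, ⟨α, hα, subset_rfl, h⟩]
    have hγE : γ ∈ E η β := by
      rw [← hopapp β hβ γ hγ]
      exact opClosure_closed hopf (hself η β hβ) (subset_opClosure (hsub η β hβ)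
        (ZFSet.mem_insert_of_mem _ (hNmono m hm η hη hmη hmN)))
    refine ⟨η, hη, fun x hx => ?_⟩
    rw [hKapp α hα γ hγμ, ZFSet.mem_inter] at hx
    rw [hKapp η hη β hβ, ZFSet.mem_inter]
    exact ⟨(hμo.mem hβ).mem_trans hx.1 hγ,
      hE α γ hγμ η hη β hβ (hNmono α hα η hη hαη) hγE hx.2⟩
  refine ⟨K, ⟨hKV, isFunc_lam fun z hz => ?_, fun β hβ ξ hξ => ?_, fun n hn β hβ => ?_,
    fun β hβ η hη α hα => ?_, hcoh, fun X hX hXμ hXω => ?_⟩, fun n hn β hβ => ?_⟩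
  · obtain ⟨n, hn, β, hβ, rfl⟩ := ZFSet.mem_prod.1 hz
    rw [snd_pair, ZFSet.mem_powerset]
    exact fun x hx => hμo.mem_trans (ZFSet.mem_inter.1 hx).1 hβ
  · obtain ⟨n, hn, hζ⟩ := hNcov _ (app_mem (hΦinj β hβ).1 hξ)
    refine ⟨n, hn, ?_⟩
    rw [hKapp n hn β hβ, ZFSet.mem_inter]
    refine ⟨hξ, ?_⟩
    have := opClosure_closed (M := V) hopf (hself n β hβ)
      (subset_opClosure (hsub n β hβ) (ZFSet.mem_insert_of_mem _ hζ))
    rwa [hopapp β hβ ξ hξ] at this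
  · have hmem : app K (ZFSet.pair n β) ∈ V := app_mem_model hKV
      (pair_mem_model (mem_of_mem_model omega_mem_model hn) (mem_of_mem_model hμV.1.1 hβ))
    have hsubβ : app K (ZFSet.pair n β) ⊆ β := by
      rw [hKapp n hn β hβ]
      exact fun x hx => (ZFSet.mem_inter.1 hx).1
    exact ⟨.of_subset hmem (hsubβ.trans (hμo.subset_of_mem hβ)), fun hle =>
      hμV.1.2.2 β hβ (hle.trans (.of_subset hmem hsubβ))⟩
  · have hαω := omega_trans hη hα
    intro x hx
    rw [hKapp α hαω β hβ, ZFSet.mem_inter] at hx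
    rw [hKapp η hη β hβ, ZFSet.mem_inter]
    exact ⟨hx.1, hE α β hβ η hη β hβ (hNmono α hαω η hη
      ((isOrdinal_of_mem_omega hη).subset_of_mem hα)) (hself η β hβ) hx.2⟩
  · obtain ⟨c, hcκ, hc⟩ := hc
    exact localized_of_coherent hKV hμreg ⟨c, hκμ hcκ, hc⟩ hcoh hXω
  · rw [hKapp n hn β hβ]
    refine SeqClosed.mono ?_ (fun x hx => (ZFSet.mem_inter.1 hx).2 : β ∩ E n β ⊆ E n β)
    obtain ⟨ν, hν, hNν⟩ := hNbdd n hn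
    have hβV := mem_of_mem_model hμV.1.1 hβ
    have : Param V n := ⟨mem_of_mem_model omega_mem_model hn⟩
    have hhn := app_mem hhf hn
    exact SeqClosed.opClosure hWV (hseq _ hω) hμW.1.1 hopW hopf (hmemV n hn β hβ) (hsub n β hβ)
      (((hseq ν hν).mono hNν).insert (hseq _ hω) ⟨app h n, ZFSet.mem_sep.2
        ⟨hhn, n, ZFSet.mem_insert _ _, Or.inr rfl⟩⟩ (mem_model_of_isTerm _) hβV
        (mem_of_mem_model hμW.1.1 hβ))

end InnerModel

namespace InnerModel

/-! ### Jónsson functions on the successor cardinal -/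

theorem isFunc_of_app {x y z f : ZFSet.{u}} (hf : ZFSet.IsFunc x y f) (h : ∀ a ∈ x, app f a ∈ z) :
    ZFSet.IsFunc x z f := by
  refine ⟨fun p hp => ?_, hf.2⟩
  obtain ⟨a, ha, b, hb, rfl⟩ := ZFSet.mem_prod.1 (hf.1 hp)
  exact ZFSet.pair_mem_prod.2 ⟨ha, app_eq hf hp ▸ h a ha⟩

section
variable {V W : Set ZFSet.{u}} [hV : Fact (IsTransitiveModelZFC V)]

/-- The finite case of the covering property holds for every covering matrix. -/
theorem IsCoveringMatrixIn.exists_of_finite {μ K : ZFSet.{u}} (hμ : IsCardinalIn V μ)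
    (hω : ZFSet.omega ⊆ μ) (hK : IsCoveringMatrixIn V ZFSet.omega μ K) {s : ZFSet.{u}}
    (hs : s ⊆ μ) (hfin : (s : Set ZFSet.{u}).Finite) :
    ∃ n ∈ ZFSet.omega, ∃ β ∈ μ, s ⊆ app K (ZFSet.pair n β) := by
  have hμo := hμ.2.1
  refine finite_induction (P := fun s => s ⊆ μ → ∃ n ∈ ZFSet.omega, ∃ β ∈ μ,
    s ⊆ app K (ZFSet.pair n β)) (fun _ => ⟨∅, ZFSet.omega_zero, ∅, hω ZFSet.omega_zero,
      ZFSet.empty_subset _⟩) (fun c s _ ih hsμ => ?_) hfin hs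
  obtain ⟨n, hn, β, hβ, hsub⟩ := ih fun x hx => hsμ (ZFSet.mem_insert_of_mem _ hx)
  have hc := hsμ (ZFSet.mem_insert c s)
  obtain ⟨γ, hγ, hβγ, hcγ⟩ : ∃ γ ∈ μ, β ∈ γ ∧ c ∈ γ := by
    rcases (hμo.mem hc).subset_total (hμo.mem hβ) with h | h
    · exact ⟨insert β β, hμ.succ_mem hω hβ, ZFSet.mem_insert _ _, ZFSet.mem_insert_iff.2
        ((hμo.mem hc).eq_or_mem_of_subset (hμo.mem hβ) h)⟩
    · exact ⟨insert c c, hμ.succ_mem hω hc, ZFSet.mem_insert_iff.2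
        ((hμo.mem hβ).eq_or_mem_of_subset (hμo.mem hc) h), ZFSet.mem_insert _ _⟩
  obtain ⟨m, hm, hnm⟩ := hK.coherent γ hγ β hβγ n hn
  obtain ⟨k, hk, hck⟩ := hK.cover γ hγ c hcγ
  have hmono : ∀ i ∈ ZFSet.omega, ∀ j ∈ ZFSet.omega, i ⊆ j →
      app K (ZFSet.pair i γ) ⊆ app K (ZFSet.pair j γ) := by
    intro i hi j hj hij
    rcases (isOrdinal_of_mem_omega hi).eq_or_mem_of_subset (isOrdinal_of_mem_omega hj) hij
      with rfl | h
    exacts [subset_rfl, hK.mono γ hγ j hj i h]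
  have hcase : ∃ l ∈ ZFSet.omega, m ⊆ l ∧ k ⊆ l := by
    rcases (isOrdinal_of_mem_omega hm).subset_total (isOrdinal_of_mem_omega hk) with h | h
    exacts [⟨k, hk, h, subset_rfl⟩, ⟨m, hm, subset_rfl, h⟩]
  obtain ⟨l, hl, hml, hkl⟩ := hcase
  refine ⟨l, hl, γ, hγ, fun x hx => ?_⟩
  rcases ZFSet.mem_insert_iff.1 hx with rfl | hx
  · exact hmono k hk l hl hkl hck
  · exact hmono m hm l hl hml (hnm (hsub hx))

/-- If all sequences in the entries of a covering matrix belong to `W`, then the covering property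
provides an unbounded set all sequences in which belong to `W`. -/
theorem CoveringPropertyIn.exists_seqClosed {μ K : ZFSet.{u}}
    (hCP : CoveringPropertyIn V μ ZFSet.omega) (hμ : IsCardinalIn V μ) (hω : ZFSet.omega ⊆ μ)
    (hK : IsCoveringMatrixIn V ZFSet.omega μ K)
    (hseq : ∀ n ∈ ZFSet.omega, ∀ β ∈ μ, SeqClosed V W (app K (ZFSet.pair n β))) :
    ∃ A ∈ V, A ⊆ μ ∧ (∀ α ∈ μ, ∃ β ∈ A, α ⊆ β) ∧ SeqClosed V W A := by
  obtain ⟨A, hA, hAμ, hunb, hcov⟩ := hCP K hK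
  refine ⟨A, hA, hAμ, hunb, fun f hf hfun => ?_⟩
  have : Param V f := ⟨hf⟩
  set X := img (fun n => app f n) ZFSet.omega with hX
  have hXA : X ⊆ A := by
    intro x hx
    obtain ⟨n, hn, rfl⟩ := mem_img.1 hx
    exact app_mem hfun hn
  obtain ⟨n, hn, β, hβ, h⟩ : ∃ n ∈ ZFSet.omega, ∃ β ∈ μ, X ⊆ app K (ZFSet.pair n β) := by
    by_cases hfin : (X : Set ZFSet.{u}).Finite
    · exact hK.exists_of_finite hμ hω (hXA.trans hAμ) hfin
    · exact hcov X (mem_model_of_isTerm _) hXA (sameCardIn_omega_of_range hf hfin)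
  exact hseq n hn β hβ f hf (isFunc_of_app hfun fun m hm => h (mem_img.2 ⟨m, hm, rfl⟩))

end

variable {V W : Set ZFSet.{u}} [hV : Fact (IsTransitiveModelZFC V)]
  [hW : Fact (IsTransitiveModelZFC W)]

/-- An unbounded set of a successor cardinal all sequences in which belong to `W` has a closure
under a given function of `W` that omits an element of the cardinal. -/
theorem isJonssonIn_of_seqClosed (hWV : W ⊆ V) (hω : SeqClosed V W ZFSet.omega)
    {κ μ A : ZFSet.{u}} (hκμ : κ ⊆ μ) (hμ : IsRegularIn V μ) (hnot : ¬ SeqClosed V W κ)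
    (hA : A ∈ V) (hAμ : A ⊆ μ) (hunb : ∀ α ∈ μ, ∃ β ∈ A, α ⊆ β) (hAseq : SeqClosed V W A) :
    IsJonssonIn V W μ := by
  refine ⟨hμ.1, fun ψ hψ hψf => ?_⟩
  have hne : A.Nonempty := by
    obtain ⟨β, hβ, -⟩ := hunb ∅ (hμ.2.1 ZFSet.omega_zero)
    exact ⟨β, hβ⟩
  obtain ⟨Y, hY, hAY, hYμ, hYψ, hYseq⟩ :=
    exists_seqClosed_closure hWV hω hμ.1.1 hψ hψf hA hAμ hne hAseq
  refine ⟨Y, hY, hYμ, fun h => hnot ((h ▸ hYseq).mono hκμ),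
    sameCardIn_of_unbounded hμ hY hYμ fun α hα => ?_, hYψ⟩
  obtain ⟨β, hβ, h⟩ := hunb α hα
  exact ⟨β, hAY hβ, h⟩

end InnerModel

namespace InnerModel

/-! ### Comparing order types, and iteration in a model -/

/-- If a relation `r` well-orders a set containing the values of `j` in the order type `θ`, as
witnessed by `e`, and `j` embeds the ordinal `δ` into it, then `δ ≤ θ`. -/
theorem subset_of_orderEmbedding {δ θ j e : ZFSet.{u}} (hδ : δ.IsOrdinal) (hθ : θ.IsOrdinal)
    (r : ZFSet.{u} → ZFSet.{u} → Prop) (he : ∀ a ∈ θ, ∀ b ∈ θ, a ∈ b → r (app e a) (app e b))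
    (hj : ∀ a ∈ δ, ∃ b ∈ θ, app e b = app j a)
    (hjinj : ∀ a ∈ δ, ∀ b ∈ δ, app j a = app j b → a = b)
    (hjr : ∀ a ∈ δ, ∀ b ∈ δ, r (app j a) (app j b) → a ∈ b) : δ ⊆ θ := by
  choose! F hF hFe using hj
  have hfun : ZFSet.IsFunc δ θ (lam δ F) := isFunc_lam hF
  have hlt : ∀ a ∈ δ, ∀ b ∈ δ, a ∈ b → app (lam δ F) a ∈ app (lam δ F) b := by
    intro a ha b hb hab
    rw [app_lam ha, app_lam hb]
    rcases (hθ.mem (hF a ha)).mem_trichotomous (hθ.mem (hF b hb)) with h | h | h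
    · exact h
    · refine absurd hab ?_
      rw [hjinj a ha b hb (by rw [← hFe a ha, ← hFe b hb, h])]
      exact ZFSet.mem_irrefl _
    · have := he _ (hF b hb) _ (hF a ha) h
      rw [hFe a ha, hFe b hb] at this
      exact absurd (hjr b hb a ha this) (ZFSet.mem_asymm hab)
  intro a ha
  exact (hδ.mem ha).mem_of_subset_of_mem hθ (subset_app_of_increasing hδ hθ hfun hlt a ha)
    (app_mem hfun ha)

theorem mem_of_app_mem_app {δ e : ZFSet.{u}} (hδ : δ.IsOrdinal)
    (hlt : ∀ a ∈ δ, ∀ b ∈ δ, a ∈ b → app e a ∈ app e b) :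
    ∀ a ∈ δ, ∀ b ∈ δ, app e a ∈ app e b → a ∈ b := by
  intro a ha b hb h
  rcases (hδ.mem ha).mem_trichotomous (hδ.mem hb) with h' | h' | h'
  · exact h'
  · subst h'
    exact absurd h (ZFSet.mem_irrefl _)
  · exact absurd h (ZFSet.mem_asymm (hlt b hb a ha h'))

theorem insert_self_injective {m n : ZFSet.{u}} (h : insert m m = insert n n) : m = n := by
  have h1 : m ∈ insert n n := h ▸ ZFSet.mem_insert _ _
  have h2 : n ∈ insert m m := h ▸ ZFSet.mem_insert _ _
  rcases ZFSet.mem_insert_iff.1 h1 with h1 | h1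
  · exact h1
  rcases ZFSet.mem_insert_iff.1 h2 with h2 | h2
  · exact h2.symm
  · exact absurd h1 (ZFSet.mem_asymm h2)

/-- A model contains the sequence of iterates of each of its functions. -/
theorem exists_iterate_model {M : Set ZFSet.{u}} [hM : Fact (IsTransitiveModelZFC M)]
    {U c u₀ : ZFSet.{u}} (hU : U ∈ M) (hc : c ∈ M) (hcf : ZFSet.IsFunc U U c) (hu₀ : u₀ ∈ U) :
    ∃ s ∈ M, ZFSet.IsFunc ZFSet.omega U s ∧ app s ∅ = u₀ ∧
      ∀ n ∈ ZFSet.omega, app s (insert n n) = app c (app s n) := by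
  have : Param M U := ⟨hU⟩
  have : Param M c := ⟨hc⟩
  have : Param M u₀ := ⟨mem_of_mem_model hU hu₀⟩
  -- the least relation that is closed under the recursive clauses
  set R := ZFSet.sep (fun z => ∀ Q, Q ∈ M → (ZFSet.pair ∅ u₀ ∈ Q ∧ ∀ n, n ∈ ZFSet.omega →
    ∀ u, u ∈ U → ZFSet.pair n u ∈ Q → ZFSet.pair (insert n n) (app c u) ∈ Q) → z ∈ Q)
    (ZFSet.prod ZFSet.omega U) with hR
  have hRM : R ∈ M := mem_model_of_isTerm _
  have : Param M R := ⟨hRM⟩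
  have hRsub : R ⊆ ZFSet.prod ZFSet.omega U := ZFSet.sep_subset
  have hRmin : ∀ Q ∈ M, (ZFSet.pair ∅ u₀ ∈ Q ∧ ∀ n, n ∈ ZFSet.omega →
      ∀ u, u ∈ U → ZFSet.pair n u ∈ Q → ZFSet.pair (insert n n) (app c u) ∈ Q) → R ⊆ Q :=
    fun Q hQ h z hz => (ZFSet.mem_sep.1 hz).2 Q hQ h
  have hR0 : ZFSet.pair ∅ u₀ ∈ R := ZFSet.mem_sep.2
    ⟨ZFSet.pair_mem_prod.2 ⟨ZFSet.omega_zero, hu₀⟩, fun Q _ h => h.1⟩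
  have hRs : ∀ n ∈ ZFSet.omega, ∀ u ∈ U, ZFSet.pair n u ∈ R →
      ZFSet.pair (insert n n) (app c u) ∈ R := fun n hn u hu h => ZFSet.mem_sep.2
    ⟨ZFSet.pair_mem_prod.2 ⟨ZFSet.omega_succ hn, app_mem hcf hu⟩, fun Q hQ hQ' =>
      hQ'.2 n hn u hu (hRmin Q hQ hQ' h)⟩
  clear_value R
  have hinv : R ⊆ ZFSet.sep (fun z => z = ZFSet.pair ∅ u₀ ∨ ∃ n, n ∈ ZFSet.omega ∧
      ∃ u, u ∈ U ∧ (ZFSet.pair n u ∈ R ∧ z = ZFSet.pair (insert n n) (app c u))) R := by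
    refine hRmin _ (mem_model_of_isTerm _) ⟨ZFSet.mem_sep.2 ⟨hR0, Or.inl rfl⟩,
      fun n hn u hu h => ?_⟩
    have h := ZFSet.sep_subset h
    exact ZFSet.mem_sep.2 ⟨hRs n hn u hu h, Or.inr ⟨n, hn, u, hu, h, rfl⟩⟩
  have huniq : ∀ n ∈ ZFSet.omega, ∃ u, ZFSet.pair n u ∈ R ∧ ∀ w, ZFSet.pair n w ∈ R → w = u := by
    refine omega_induction ⟨u₀, hR0, fun w hw => ?_⟩ ?_
    · rcases (ZFSet.mem_sep.1 (hinv hw)).2 with h | ⟨n, -, u, -, -, h⟩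
      · exact (ZFSet.pair_inj.1 h).2
      · exact absurd ((ZFSet.pair_inj.1 h).1 ▸ ZFSet.mem_insert n n) (ZFSet.notMem_empty _)
    · rintro n hn ⟨u, hu, huniq⟩
      refine ⟨app c u, hRs n hn u (ZFSet.pair_mem_prod.1 (hRsub hu)).2 hu, fun w hw => ?_⟩
      rcases (ZFSet.mem_sep.1 (hinv hw)).2 with h | ⟨m, -, v, -, hmv, h⟩
      · exact absurd ((ZFSet.pair_inj.1 h).1 ▸ ZFSet.mem_insert n n) (ZFSet.notMem_empty _)
      · obtain ⟨h1, h2⟩ := ZFSet.pair_inj.1 h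
        obtain rfl := insert_self_injective h1
        rw [h2, huniq v hmv]
  have hfun : ZFSet.IsFunc ZFSet.omega U R := ⟨hRsub, fun n hn => by
    obtain ⟨u, hu, h⟩ := huniq n hn
    exact ⟨u, hu, h⟩⟩
  exact ⟨R, hRM, hfun, app_eq hfun hR0, fun n hn =>
    app_eq hfun (hRs n hn _ (app_mem hfun hn) (pair_app_mem hfun hn))⟩

variable {V W : Set ZFSet.{u}} [hV : Fact (IsTransitiveModelZFC V)]
  [hW : Fact (IsTransitiveModelZFC W)]

/-! ### Models with the same bounded subsets -/

/-- A cardinal of `W` remains a cardinal in `V` if its bounded subsets in `V` belong to `W`: an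
injection of `κ` into a smaller ordinal would code a bounded well-order of type `κ`. -/
theorem isCardinalIn_of_bounded (hWV : W ⊆ V) {κ : ZFSet.{u}} (hκ : IsCardinalIn W κ)
    (hω : ZFSet.omega ∈ κ) (hbdd : ∀ α ∈ κ, ∀ X ∈ V, X ⊆ α → X ∈ W) : IsCardinalIn V κ := by
  have hκo := hκ.2.1
  refine ⟨hWV hκ.1, hκo, fun α hα hle => ?_⟩
  wlog hωα : ZFSet.omega ⊆ α generalizing α
  · have h := ((hκo.mem hα).subset_total isOrdinal_omega).resolve_right hωα
    exact this _ hω (hle.trans (.of_subset (hWV (mem_of_mem_model hκ.1 hα)) h)) subset_rfl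
  obtain ⟨j, hj, hjfun, hjinj⟩ := hle.exists_app
  have hαW := mem_of_mem_model hκ.1 hα
  obtain ⟨p, hp, hpfun, hpinj⟩ := (cardLEIn_prod_self (hκo.mem hα) hαW hωα).exists_app
  have : Param V j := ⟨hj⟩
  have : Param V p := ⟨hWV hp⟩
  have : Param W p := ⟨hp⟩
  have : Param V κ := ⟨hWV hκ.1⟩
  have hjα : ∀ a ∈ κ, app j a ∈ α := fun a ha => app_mem hjfun ha
  have hT : img (fun a => app j a) κ ∈ W := by
    refine hbdd α hα _ (mem_model_of_isTerm _) fun y hy => ?_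
    obtain ⟨a, ha, rfl⟩ := mem_img.1 hy
    exact hjα a ha
  set T := img (fun a => app j a) κ with hTdef
  have : Param W T := ⟨hT⟩
  have hE : img (fun z => app p (ZFSet.pair (app j (fst z)) (app j (snd z))))
      (ZFSet.sep (fun z => fst z ∈ snd z) (ZFSet.prod κ κ)) ∈ W := by
    refine hbdd α hα _ (mem_model_of_isTerm _) fun y hy => ?_
    obtain ⟨z, hz, rfl⟩ := mem_img.1 hy
    obtain ⟨a, ha, b, hb, rfl⟩ := ZFSet.mem_prod.1 (ZFSet.mem_sep.1 hz).1
    rw [fst_pair, snd_pair]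
    exact app_mem hpfun (ZFSet.pair_mem_prod.2 ⟨hjα a ha, hjα b hb⟩)
  set E := img (fun z => app p (ZFSet.pair (app j (fst z)) (app j (snd z))))
      (ZFSet.sep (fun z => fst z ∈ snd z) (ZFSet.prod κ κ)) with hEdef
  have : Param W E := ⟨hE⟩
  set R := ZFSet.sep (fun z => app p z ∈ E) (ZFSet.prod T T) with hR
  have hRW : R ∈ W := mem_model_of_isTerm _
  have hjT : ∀ a ∈ κ, app j a ∈ T := fun a ha => mem_img.2 ⟨a, ha, rfl⟩
  have hmem : ∀ a ∈ κ, ∀ b ∈ κ, ZFSet.pair (app j a) (app j b) ∈ R ↔ a ∈ b := by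
    intro a ha b hb
    rw [hR, ZFSet.mem_sep, and_iff_right (ZFSet.pair_mem_prod.2 ⟨hjT a ha, hjT b hb⟩), hEdef,
      mem_img]
    constructor
    · rintro ⟨z, hz, h⟩
      obtain ⟨hz, hlt⟩ := ZFSet.mem_sep.1 hz
      obtain ⟨c, hc, d, hd, rfl⟩ := ZFSet.mem_prod.1 hz
      rw [fst_pair, snd_pair] at hlt h
      obtain ⟨h1, h2⟩ := ZFSet.pair_inj.1 (hpinj _ (ZFSet.pair_mem_prod.2 ⟨hjα a ha, hjα b hb⟩) _
        (ZFSet.pair_mem_prod.2 ⟨hjα c hc, hjα d hd⟩) h.symm)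
      rwa [hjinj a ha c hc h1, hjinj b hb d hd h2]
    · intro h
      refine ⟨ZFSet.pair a b, ZFSet.mem_sep.2 ⟨ZFSet.pair_mem_prod.2 ⟨ha, hb⟩, ?_⟩, ?_⟩
      all_goals rw [fst_pair, snd_pair]
      exact h
  have hTκ : ∀ t ∈ T, ∃ a ∈ κ, app j a = t := fun t ht => mem_img.1 ht
  obtain ⟨θ, hθ, hθo, e, he, hefun, hesurj, hlt⟩ := exists_orderType_of_rel hT hRW
    (fun U _ hUT ⟨t, ht⟩ => by
      obtain ⟨a, ⟨ha, haU⟩, hmin⟩ := ZFSet.mem_wf.has_min {a : ZFSet.{u} | a ∈ κ ∧ app j a ∈ U} (by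
        obtain ⟨a, ha, rfl⟩ := hTκ t (hUT ht)
        exact ⟨a, ha, ht⟩)
      refine ⟨_, haU, fun y hy h => ?_⟩
      obtain ⟨b, hb, rfl⟩ := hTκ y (hUT hy)
      exact hmin b ⟨hb, hy⟩ ((hmem b hb a ha).1 h))
    (fun x hx y hy z hz => by
      obtain ⟨a, ha, rfl⟩ := hTκ x hx
      obtain ⟨b, hb, rfl⟩ := hTκ y hy
      obtain ⟨c, hc, rfl⟩ := hTκ z hz
      rw [hmem a ha b hb, hmem b hb c hc, hmem a ha c hc]
      exact (hκo.mem hc).mem_trans)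
    (fun x hx y hy => by
      obtain ⟨a, ha, rfl⟩ := hTκ x hx
      obtain ⟨b, hb, rfl⟩ := hTκ y hy
      rw [hmem a ha b hb, hmem b hb a ha]
      rcases (hκo.mem ha).mem_trichotomous (hκo.mem hb) with h | rfl | h
      exacts [Or.inl h, Or.inr (Or.inl rfl), Or.inr (Or.inr h)])
  have hκθ : κ ⊆ θ := subset_of_orderEmbedding hκo hθo (fun x y => ZFSet.pair x y ∈ R) hlt
    (fun a ha => hesurj _ (hjT a ha)) hjinj fun a ha b hb => (hmem a ha b hb).1
  have hirr : ∀ t ∈ T, ZFSet.pair t t ∉ R := by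
    intro t ht h
    obtain ⟨a, ha, rfl⟩ := hTκ t ht
    exact ZFSet.mem_irrefl _ ((hmem a ha a ha).1 h)
  have heinj : ∀ a ∈ θ, ∀ b ∈ θ, app e a = app e b → a = b := by
    intro a ha b hb h
    rcases (hθo.mem ha).mem_trichotomous (hθo.mem hb) with h' | h' | h'
    · exact absurd (h ▸ hlt a ha b hb h') (hirr _ (app_mem hefun hb))
    · exact h'
    · exact absurd (h ▸ hlt b hb a ha h') (hirr _ (app_mem hefun hb))
  refine hκ.2.2 α hα ((CardLEIn.of_subset hκ.1 hκθ).trans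
    (.of_app he (isFunc_mono hefun fun t ht => ?_) heinj))
  obtain ⟨a, ha, rfl⟩ := hTκ t ht
  exact hjα a ha

/-- An unbounded subset of the successor of `κ` all sequences in which belong to `W` yields a subset
of `κ` of size `κ` with the same property: transport an initial segment by an injection of `W`. -/
theorem exists_seqClosed_subset (hWV : W ⊆ V) {κ μ A : ZFSet.{u}} (hω : ZFSet.omega ⊆ κ)
    (hμV : IsSuccCardIn V κ μ) (hμW : IsSuccCardIn W κ μ)
    (hA : A ∈ V) (hAμ : A ⊆ μ) (hunb : ∀ α ∈ μ, ∃ β ∈ A, α ⊆ β) (hAseq : SeqClosed V W A) :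
    ∃ B ∈ V, B ⊆ κ ∧ CardLEIn V κ B ∧ SeqClosed V W B := by
  have hμo := hμV.1.2.1
  have hκμ := hμV.2.1
  have hκo := hμo.mem hκμ
  have hκV := mem_of_mem_model hμV.1.1 hκμ
  have hAcard := sameCardIn_of_unbounded (hμV.isRegularIn hω) hA hAμ hunb
  obtain ⟨θ, hθ, hθo, e, he, hefun, hesurj, hlt⟩ := exists_orderType hA fun x hx =>
    hμo.mem (hAμ hx)
  have heinj := injective_of_increasing hθo hlt
  have hκθ : κ ∈ θ := by
    refine (ZFSet.IsOrdinal.not_subset_iff_mem hθo hκo).1 fun h => ?_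
    exact hμV.1.2.2 κ hκμ (hAcard.symm.cardLEIn.trans
      ((SameCardIn.of_app he hefun heinj hesurj).symm.cardLEIn.trans (.of_subset hθ h)))
  have hκθ' : κ ⊆ θ := hθo.subset_of_mem hκθ
  set β := app e κ with hβ
  have hβA : β ∈ A := app_mem hefun hκθ
  have hβμ : β ∈ μ := hAμ hβA
  have heβ : ∀ a ∈ κ, app e a ∈ β := fun a ha => hlt a (hκθ' ha) κ hκθ ha
  obtain ⟨Φ, hΦ, hΦinj⟩ := hμW.exists_injections
  obtain ⟨hifun, hiinj⟩ := hΦinj β hβμ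
  have : Param W β := ⟨mem_of_mem_model hμW.1.1 hβμ⟩
  have : Param V β := ⟨mem_of_mem_model hμV.1.1 hβμ⟩
  have : Param W Φ := ⟨hΦ⟩
  have : Param V Φ := ⟨hWV hΦ⟩
  have : Param V e := ⟨he⟩
  have : Param V κ := ⟨hκV⟩
  refine ⟨img (fun a => app (app Φ β) (app e a)) κ, mem_model_of_isTerm _, fun y hy => ?_,
    .of_term (fun a => app (app Φ β) (app e a)) hκV (fun a ha => mem_img.2 ⟨a, ha, rfl⟩)
      fun a ha b hb h => ?_, ?_⟩
  · obtain ⟨a, ha, rfl⟩ := mem_img.1 hy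
    exact app_mem hifun (heβ a ha)
  · exact heinj a (hκθ' ha) b (hκθ' hb) (hiinj _ (heβ a ha) _ (heβ b hb) h)
  · refine hAseq.of_term (fun x => ZFSet.sUnion (ZFSet.sep (fun ξ' => app (app Φ β) ξ' = x) β))
      (fun ξ => app (app Φ β) ξ) ?_ ?_
    all_goals
      intro y hy
      obtain ⟨a, ha, rfl⟩ := mem_img.1 hy
      rw [sUnion_sep_app_eq hiinj (heβ a ha)]
    exact app_mem hefun (hκθ' ha)

end InnerModel

namespace InnerModel

/-! ### A tree of approximations to a closed set -/

/-- A cofinal `ω`-sequence in an infinite cardinal exceeds every bound beyond any given index. -/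
theorem exists_index_above {M : Set ZFSet.{u}} [hM : Fact (IsTransitiveModelZFC M)]
    {κ x : ZFSet.{u}} (hκ : IsCardinalIn M κ) (hω : ZFSet.omega ⊆ κ)
    (hx : ZFSet.IsFunc ZFSet.omega κ x) (hcof : ∀ α ∈ κ, ∃ n ∈ ZFSet.omega, α ⊆ app x n) :
    ∀ m ∈ ZFSet.omega, ∀ α ∈ κ, ∃ n ∈ ZFSet.omega, m ⊆ n ∧ α ⊆ app x n := by
  have hκo := hκ.2.1
  refine omega_induction (fun α hα => ?_) fun m hm ih α hα => ?_
  · obtain ⟨n, hn, h⟩ := hcof α hα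
    exact ⟨n, hn, ZFSet.empty_subset _, h⟩
  · have hxm := app_mem hx hm
    obtain ⟨α', hα', hαα', hxα'⟩ : ∃ α' ∈ κ, α ⊆ α' ∧ app x m ∈ α' := by
      rcases (hκo.mem hα).subset_total (hκo.mem hxm) with h | h
      · exact ⟨_, hκ.succ_mem hω hxm, fun a ha => ZFSet.mem_insert_of_mem _ (h ha),
          ZFSet.mem_insert _ _⟩
      · exact ⟨_, hκ.succ_mem hω hα, fun a ha => ZFSet.mem_insert_of_mem _ ha,
          ZFSet.mem_insert_iff.2 ((hκo.mem hxm).eq_or_mem_of_subset (hκo.mem hα) h)⟩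
    obtain ⟨n, hn, hmn, h⟩ := ih α' hα'
    refine ⟨n, hn, ?_, hαα'.trans h⟩
    rcases (isOrdinal_of_mem_omega hm).eq_or_mem_of_subset (isOrdinal_of_mem_omega hn) hmn
      with rfl | hmn
    · exact absurd (h hxα') (ZFSet.mem_irrefl _)
    · exact succ_subset_of_mem (isOrdinal_of_mem_omega hn) hmn

/-- The data `t = (n, (α, y))` consists of a level `n`, a bound `α` and a set `y ⊆ α` that omits `δ`
and is closed under `ψ` below `α`. -/
def IsApprox (D ψ δ t : ZFSet.{u}) : Prop :=
  snd (snd t) ⊆ fst (snd t) ∧ δ ∉ snd (snd t) ∧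
    ∀ s, s ∈ D → s ⊆ snd (snd t) → app ψ s ∈ fst (snd t) → app ψ s ∈ snd (snd t)

/-- `t'` is a successor of `t` in the tree of approximations: it lies one level higher, its set
end-extends that of `t`, and if `n` is the level of `t`, then its bound is at least the `n`-th
value of `x`, and so is the order type of its set, as witnessed in `M`. -/
def IsApproxSucc (M : Set ZFSet.{u}) (x t' t : ZFSet.{u}) : Prop :=
  fst t' = insert (fst t) (fst t) ∧ fst (snd t) ⊆ fst (snd t') ∧
    snd (snd t') ∩ fst (snd t) = snd (snd t) ∧ app x (fst t) ⊆ fst (snd t') ∧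
      ∃ e, e ∈ M ∧ (ZFSet.IsFunc (app x (fst t)) (snd (snd t')) e ∧
        ∀ a, a ∈ app x (fst t) → ∀ b, b ∈ app x (fst t) → a ∈ b → app e a ∈ app e b)

variable {V W : Set ZFSet.{u}} [hV : Fact (IsTransitiveModelZFC V)]
  [hW : Fact (IsTransitiveModelZFC W)]

/-- The traces of a `ψ`-closed set `Z` of `V` on the ordinals below `κ` form a tree of
approximations without terminal nodes, so the tree of all approximations in `W` is not
well-founded, in the sense of `W` either. -/
theorem exists_pruned_tree {κ D ψ δ x Z e : ZFSet.{u}} (hWV : W ⊆ V) (hκW : κ ∈ W)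
    (hκ : κ.IsOrdinal) (hω : ZFSet.omega ⊆ κ)
    (hbdd : ∀ α ∈ κ, ∀ X ∈ V, X ⊆ α → X ∈ W) (hD : D ∈ W) (hψ : ψ ∈ W) (hδ : δ ∈ W) (hx : x ∈ W)
    (hxf : ZFSet.IsFunc ZFSet.omega κ x) (hZ : Z ∈ V) (hZκ : Z ⊆ κ) (hδZ : δ ∉ Z)
    (hZψ : ∀ s ∈ D, s ⊆ Z → app ψ s ∈ Z) (hef : ∀ a ∈ κ, app e a ∈ Z)
    (hlt : ∀ a ∈ κ, ∀ b ∈ κ, a ∈ b → app e a ∈ app e b) :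
    ∃ U ∈ W, U.Nonempty ∧ (∀ t ∈ U, IsApprox D ψ δ t ∧ fst t ∈ ZFSet.omega ∧ fst (snd t) ∈ κ) ∧
      ∀ t ∈ U, ∃ t' ∈ U, IsApproxSucc W x t' t := by
  have : Param W κ := ⟨hκW⟩
  have : Param W D := ⟨hD⟩
  have : Param W ψ := ⟨hψ⟩
  have : Param W δ := ⟨hδ⟩
  have : Param W x := ⟨hx⟩
  have : Param V Z := ⟨hZ⟩
  obtain ⟨P, hPW, hP⟩ := exists_powerset_model hκW
  have : Param W P := ⟨hPW⟩
  have hdef1 : IsDef W fun v => IsApprox D ψ δ (v 0).1 := by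
    unfold IsApprox
    infer_instance
  have hdef2 : IsDef W fun v => IsApproxSucc W x (v 0).1 (v 1).1 := by
    unfold IsApproxSucc
    infer_instance
  have hdef3 : IsDef W fun v => IsApproxSucc W x (fst (v 0).1) (snd (v 0).1) := hdef2.comp₂
  have hTW : ZFSet.sep (fun t => IsApprox D ψ δ t)
      (ZFSet.prod ZFSet.omega (ZFSet.prod κ P)) ∈ W := sep_mem_model (mem_model_of_isTerm _)
  set T := ZFSet.sep (fun t => IsApprox D ψ δ t)
    (ZFSet.prod ZFSet.omega (ZFSet.prod κ P)) with hT
  have hRW : ZFSet.sep (fun z => IsApproxSucc W x (fst z) (snd z)) (ZFSet.prod T T) ∈ W :=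
    sep_mem_model (prod_mem_model hTW hTW)
  set R := ZFSet.sep (fun z => IsApproxSucc W x (fst z) (snd z)) (ZFSet.prod T T) with hR
  have hmemR : ∀ t' t, ZFSet.pair t' t ∈ R ↔ t' ∈ T ∧ t ∈ T ∧ IsApproxSucc W x t' t := by
    intro t' t
    rw [hR, ZFSet.mem_sep, ZFSet.pair_mem_prod, fst_pair, snd_pair, and_assoc]
  by_cases hU : ∀ U ∈ W, U ⊆ T → U.Nonempty → ∃ x ∈ U, ∀ y ∈ U, ZFSet.pair y x ∉ R
  swap
  · push Not at hU
    obtain ⟨U, hUW, hUT, hne, hU⟩ := hU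
    refine ⟨U, hUW, hne, fun t ht => ?_, fun t ht => ?_⟩
    · obtain ⟨h1, h2⟩ := ZFSet.mem_sep.1 (hUT ht)
      obtain ⟨n, hn, w, hw, rfl⟩ := ZFSet.mem_prod.1 h1
      obtain ⟨α, hα, y, hy, rfl⟩ := ZFSet.mem_prod.1 hw
      exact ⟨h2, by rwa [fst_pair], by rwa [snd_pair, fst_pair]⟩
    · obtain ⟨t', ht', h⟩ := hU t ht
      exact ⟨t', ht', ((hmemR _ _).1 h).2.2⟩
  -- otherwise the tree has a rank function, which must decrease along the traces of `Z`
  exfalso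
  obtain ⟨g, -, hg⟩ := exists_collapse_model hTW hRW hU
  have hnode : ∀ n ∈ ZFSet.omega, ∀ α ∈ κ, ZFSet.pair n (ZFSet.pair α (Z ∩ α)) ∈ T := by
    intro n hn α hα
    have : Param V α := ⟨mem_of_mem_model (hWV hκW) hα⟩
    refine ZFSet.mem_sep.2 ⟨ZFSet.pair_mem_prod.2 ⟨hn, ZFSet.pair_mem_prod.2 ⟨hα, (hP _).2
      ⟨hbdd α hα _ (mem_model_of_isTerm _) fun z hz => (ZFSet.mem_inter.1 hz).2,
        fun z hz => hZκ (ZFSet.mem_inter.1 hz).1⟩⟩⟩, ?_⟩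
    rw [IsApprox, snd_pair, fst_pair, snd_pair]
    exact ⟨fun z hz => (ZFSet.mem_inter.1 hz).2, fun h => hδZ (ZFSet.mem_inter.1 h).1,
      fun s hs hsZ h => ZFSet.mem_inter.2
        ⟨hZψ s hs fun z hz => (ZFSet.mem_inter.1 (hsZ hz)).1, h⟩⟩
  have hstep : ∀ n ∈ ZFSet.omega, ∀ α ∈ κ, ∃ β ∈ κ,
      IsApproxSucc W x (ZFSet.pair (insert n n) (ZFSet.pair β (Z ∩ β)))
        (ZFSet.pair n (ZFSet.pair α (Z ∩ α))) := by
    intro n hn α hα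
    have hξ := app_mem hxf hn
    set ξ := app x n with hξdef
    have heξ := hZκ (hef ξ hξ)
    have hξκ := hκ.subset_of_mem hξ
    have hξe : ξ ⊆ app e ξ := by
      have hfun : ZFSet.IsFunc κ κ (lam κ fun a => app e a) := isFunc_lam fun a ha => hZκ (hef a ha)
      have := subset_app_of_increasing hκ hκ hfun (fun a ha b hb hab => by
        rw [app_lam ha, app_lam hb]
        exact hlt a ha b hb hab) ξ hξ
      rwa [app_lam hξ] at this
    obtain ⟨β, hβ, hαβ, heβ⟩ : ∃ β ∈ κ, α ⊆ β ∧ app e ξ ⊆ β := by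
      rcases (hκ.mem hα).subset_total (hκ.mem heξ) with h | h
      exacts [⟨_, heξ, h, subset_rfl⟩, ⟨_, hα, subset_rfl, h⟩]
    have : Param V β := ⟨mem_of_mem_model (hWV hκW) hβ⟩
    have hY : Z ∩ β ∈ W := hbdd β hβ _ (mem_model_of_isTerm _) fun z hz => (ZFSet.mem_inter.1 hz).2
    obtain ⟨θ, hθ, hθo, i, hi, hif, hisurj, hilt⟩ := exists_orderType hY fun z hz =>
      hκ.mem (hZκ (ZFSet.mem_inter.1 hz).1)
    have hltξ : ∀ a ∈ ξ, ∀ b ∈ ξ, a ∈ b → app e a ∈ app e b := fun a ha b hb =>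
      hlt a (hξκ ha) b (hξκ hb)
    have hξθ : ξ ⊆ θ := subset_of_orderEmbedding (hκ.mem hξ) hθo (· ∈ ·) hilt
      (fun a ha => hisurj _ (ZFSet.mem_inter.2 ⟨hef a (hξκ ha),
        heβ (hlt a (hξκ ha) ξ hξ ha)⟩))
      (injective_of_increasing (hκ.mem hξ) hltξ) (mem_of_app_mem_app (hκ.mem hξ) hltξ)
    have : Param W i := ⟨hi⟩
    have : Param W ξ := ⟨mem_of_mem_model hκW hξ⟩
    refine ⟨β, hβ, ?_⟩
    simp only [IsApproxSucc, fst_pair, snd_pair, true_and, ← hξdef]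
    refine ⟨hαβ, ?_, hξe.trans heβ, lam ξ (fun a => app i a), mem_model_of_isTerm _,
      isFunc_lam fun a ha => app_mem hif (hξθ ha), fun a ha b hb hab => ?_⟩
    · ext z
      simp only [ZFSet.mem_inter]
      exact ⟨fun h => ⟨h.1.1, h.2⟩, fun h => ⟨⟨h.1, hαβ h.2⟩, h.2⟩⟩
    · rw [app_lam ha, app_lam hb]
      exact hilt a (hξθ ha) b (hξθ hb) hab
  obtain ⟨r, ⟨n, α, hn, hα, rfl⟩, hmin⟩ := ZFSet.mem_wf.has_min {r | ∃ n α, n ∈ ZFSet.omega ∧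
    α ∈ κ ∧ app g (ZFSet.pair n (ZFSet.pair α (Z ∩ α))) = r}
    ⟨_, ∅, ∅, ZFSet.omega_zero, hω ZFSet.omega_zero, rfl⟩
  obtain ⟨β, hβ, h⟩ := hstep n hn α hα
  refine hmin _ ⟨_, β, ZFSet.omega_succ hn, hβ, rfl⟩ ?_
  rw [hg _ (hnode n hn α hα), mem_img]
  exact ⟨_, mem_preds.2 ⟨hnode _ (ZFSet.omega_succ hn) β hβ, (hmemR _ _).2
    ⟨hnode _ (ZFSet.omega_succ hn) β hβ, hnode n hn α hα, h⟩⟩, rfl⟩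

end InnerModel

namespace InnerModel

/-- A tree of approximations without terminal nodes has an infinite branch in the model, the union
of which is closed under `ψ` and of full size. -/
theorem exists_closed_of_pruned_tree {W : Set ZFSet.{u}} [hW : Fact (IsTransitiveModelZFC W)]
    {κ ψ δ x U : ZFSet.{u}} (hκ : IsCardinalIn W κ) (hω : ZFSet.omega ⊆ κ)
    (hψf : ZFSet.IsFunc (finSubsets κ) κ ψ) (hx : x ∈ W) (hxf : ZFSet.IsFunc ZFSet.omega κ x)
    (hcof : ∀ α ∈ κ, ∃ n ∈ ZFSet.omega, α ⊆ app x n) (hU : U ∈ W) (hne : U.Nonempty)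
    (happrox : ∀ t ∈ U, IsApprox (finSubsets κ) ψ δ t ∧ fst t ∈ ZFSet.omega ∧ fst (snd t) ∈ κ)
    (hsucc : ∀ t ∈ U, ∃ t' ∈ U, IsApproxSucc W x t' t) :
    ∃ Y ∈ W, Y ⊆ κ ∧ δ ∉ Y ∧ SameCardIn W Y κ ∧ ∀ s ∈ finSubsets Y, app ψ s ∈ Y := by
  have hκo := hκ.2.1
  have : Param W x := ⟨hx⟩
  have hdef : IsDef W fun v => IsApproxSucc W x (v 0).1 (v 1).1 := by
    unfold IsApproxSucc
    infer_instance
  have : IsDef W fun v => IsApproxSucc W x (v 1).1 (v 0).1 := hdef.comp₂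
  obtain ⟨c, hc, hcf, hcs⟩ := exists_choice_model hU hU (fun t t' => IsApproxSucc W x t' t) hsucc
  obtain ⟨u₀, hu₀⟩ := hne
  obtain ⟨s, hs, hsf, hs0, hss⟩ := exists_iterate_model hU hc hcf hu₀
  have : Param W s := ⟨hs⟩
  have hsU : ∀ n ∈ ZFSet.omega, app s n ∈ U := fun n hn => app_mem hsf hn
  have hstep : ∀ n ∈ ZFSet.omega, IsApproxSucc W x (app s (insert n n)) (app s n) := by
    intro n hn
    rw [hss n hn]
    exact hcs _ (hsU n hn)
  -- the levels of the branch are cofinal in `ω`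
  have hlev : ∀ k ∈ ZFSet.omega, fst u₀ ⊆ k → ∃ n ∈ ZFSet.omega, fst (app s n) = k := by
    refine omega_induction (fun h => ⟨∅, ZFSet.omega_zero, ?_⟩) fun k hk ih h => ?_
    · rw [hs0]
      exact subset_antisymm h (ZFSet.empty_subset _)
    · have h0 := isOrdinal_of_mem_omega (happrox u₀ hu₀).2.1
      rcases h0.eq_or_mem_of_subset (isOrdinal_of_mem_omega (ZFSet.omega_succ hk)) h with h | h
      · exact ⟨∅, ZFSet.omega_zero, by rw [hs0, h]⟩
      · obtain ⟨n, hn, hnk⟩ := ih (by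
          rcases ZFSet.mem_insert_iff.1 h with h | h
          exacts [h ▸ subset_rfl, (isOrdinal_of_mem_omega hk).subset_of_mem h])
        exact ⟨insert n n, ZFSet.omega_succ hn, by rw [(hstep n hn).1, hnk]⟩
  have hbig : ∀ α ∈ κ, ∃ n ∈ ZFSet.omega, α ⊆ app x (fst (app s n)) := by
    intro α hα
    obtain ⟨k, hk, h, hαk⟩ := exists_index_above hκ hω hxf hcof _ (happrox u₀ hu₀).2.1 α hα
    obtain ⟨n, hn, rfl⟩ := hlev k hk h
    exact ⟨n, hn, hαk⟩
  let bd : ZFSet.{u} → ZFSet.{u} := fun n => fst (snd (app s n))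
  let tr : ZFSet.{u} → ZFSet.{u} := fun n => snd (snd (app s n))
  have hbd : ∀ n ∈ ZFSet.omega, bd n ∈ κ := fun n hn => (happrox _ (hsU n hn)).2.2
  have htr : ∀ n ∈ ZFSet.omega, IsApprox (finSubsets κ) ψ δ (app s n) := fun n hn =>
    (happrox _ (hsU n hn)).1
  have hmono : ∀ m ∈ ZFSet.omega, ∀ n ∈ ZFSet.omega, n ⊆ m → bd n ⊆ bd m ∧ tr n ⊆ tr m := by
    refine omega_induction (fun n hn h => ?_) fun m hm ih n hn h => ?_
    · obtain rfl : n = ∅ := subset_antisymm h (ZFSet.empty_subset _)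
      exact ⟨subset_rfl, subset_rfl⟩
    · rcases (isOrdinal_of_mem_omega hn).eq_or_mem_of_subset
        (isOrdinal_of_mem_omega (ZFSet.omega_succ hm)) h with rfl | h
      · exact ⟨subset_rfl, subset_rfl⟩
      · obtain ⟨h1, h2⟩ := ih n hn (by
          rcases ZFSet.mem_insert_iff.1 h with h | h
          exacts [h ▸ subset_rfl, (isOrdinal_of_mem_omega hm).subset_of_mem h])
        obtain ⟨-, h3, h4, -⟩ := hstep m hm
        exact ⟨h1.trans h3, h2.trans fun z hz =>
          (ZFSet.mem_inter.1 (h4.symm.subset hz)).1⟩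
  have hmax : ∀ m ∈ ZFSet.omega, ∀ n ∈ ZFSet.omega, ∃ l ∈ ZFSet.omega, m ⊆ l ∧ n ⊆ l := by
    intro m hm n hn
    rcases (isOrdinal_of_mem_omega hm).subset_total (isOrdinal_of_mem_omega hn) with h | h
    exacts [⟨n, hn, h, subset_rfl⟩, ⟨m, hm, subset_rfl, h⟩]
  set Y := ZFSet.sUnion (img (fun n => snd (snd (app s n))) ZFSet.omega) with hY
  have hYW : Y ∈ W := mem_model_of_isTerm _
  have hmemY : ∀ z, z ∈ Y ↔ ∃ n ∈ ZFSet.omega, z ∈ tr n := by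
    intro z
    simp only [hY, ZFSet.mem_sUnion, mem_img]
    constructor
    · rintro ⟨_, ⟨n, hn, rfl⟩, hz⟩
      exact ⟨n, hn, hz⟩
    · rintro ⟨n, hn, hz⟩
      exact ⟨_, ⟨n, hn, rfl⟩, hz⟩
  have hYκ : Y ⊆ κ := by
    intro z hz
    obtain ⟨n, hn, hz⟩ := (hmemY z).1 hz
    exact hκo.mem_trans ((htr n hn).1 hz) (hbd n hn)
  refine ⟨Y, hYW, hYκ, fun hδ => ?_, ?_, fun a ha => ?_⟩
  · obtain ⟨n, hn, hz⟩ := (hmemY _).1 hδ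
    exact (htr n hn).2.1 hz
  · -- the order type of `Y` is at least every value of `x`, and thus equals `κ`
    obtain ⟨θ, hθ, hθo, e, he, hef, hesurj, hlt⟩ := exists_orderType hYW fun z hz =>
      hκo.mem (hYκ hz)
    have hθκ : θ ⊆ κ := fun a ha => (hθo.mem ha).mem_of_subset_of_mem hκo
      (subset_app_of_increasing hθo hκo (isFunc_mono hef hYκ) hlt a ha) (hYκ (app_mem hef ha))
    have hκθ : κ ⊆ θ := by
      intro a ha
      obtain ⟨n, hn, h⟩ := hbig _ (hκ.succ_mem hω ha)
      obtain ⟨-, -, -, -, j, -, hjf, hjlt⟩ := hstep n hn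
      have hξ := hκo.mem (app_mem hxf (happrox _ (hsU n hn)).2.1)
      exact subset_of_orderEmbedding hξ hθo (· ∈ ·) hlt (fun b hb => hesurj _ ((hmemY _).2
        ⟨_, ZFSet.omega_succ hn, app_mem hjf hb⟩)) (injective_of_increasing hξ hjlt)
        (mem_of_app_mem_app hξ hjlt) (h (ZFSet.mem_insert _ _))
    obtain rfl := subset_antisymm hθκ hκθ
    exact (SameCardIn.of_app he hef (injective_of_increasing hθo hlt) hesurj).symm
  · obtain ⟨haY, hafin⟩ := mem_finSubsets.1 ha
    have haκ : a ∈ finSubsets κ := mem_finSubsets.2 ⟨haY.trans hYκ, hafin⟩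
    obtain ⟨n, hn, han⟩ : ∃ n ∈ ZFSet.omega, a ⊆ tr n := by
      refine finite_induction (P := fun a => a ⊆ Y → ∃ n ∈ ZFSet.omega, a ⊆ tr n)
        (fun _ => ⟨∅, ZFSet.omega_zero, ZFSet.empty_subset _⟩) (fun z a _ ih h => ?_) hafin haY
      obtain ⟨n, hn, han⟩ := ih fun w hw => h (ZFSet.mem_insert_of_mem _ hw)
      obtain ⟨m, hm, hzm⟩ := (hmemY z).1 (h (ZFSet.mem_insert _ _))
      obtain ⟨l, hl, hnl, hml⟩ := hmax n hn m hm
      refine ⟨l, hl, fun w hw => ?_⟩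
      rcases ZFSet.mem_insert_iff.1 hw with rfl | hw
      exacts [(hmono l hl m hm hml).2 hzm, (hmono l hl n hn hnl).2 (han hw)]
    obtain ⟨m, hm, hψm⟩ := hbig _ (hκ.succ_mem hω (app_mem hψf haκ))
    have hm' := ZFSet.omega_succ hm
    obtain ⟨l, hl, hnl, hml⟩ := hmax n hn _ hm'
    exact (hmemY _).2 ⟨l, hl, (htr l hl).2.2 a haκ (han.trans (hmono l hl n hn hnl).2)
      ((hmono l hl _ hm' hml).1 ((hstep m hm).2.2.2.1 (hψm (ZFSet.mem_insert _ _))))⟩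

variable {V W : Set ZFSet.{u}} [hV : Fact (IsTransitiveModelZFC V)]
  [hW : Fact (IsTransitiveModelZFC W)]

/-- If `W` and `V` have the same bounded subsets of `κ`, then `κ` is Jónsson in `W` as soon as some
set of size `κ` in `V` has all its sequences in `W`. -/
theorem isJonssonIn_of_bounded (hWV : W ⊆ V) {κ B h : ZFSet.{u}} (hκ : IsCardinalIn W κ)
    (hω : ZFSet.omega ∈ κ) (hseqω : SeqClosed V W ZFSet.omega) (hnot : ¬ SeqClosed V W κ)
    (hbdd : ∀ α ∈ κ, ∀ X ∈ V, X ⊆ α → X ∈ W)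
    (hh : h ∈ V) (hhf : ZFSet.IsFunc ZFSet.omega κ h)
    (hcof : ∀ α ∈ κ, ∃ n ∈ ZFSet.omega, α ⊆ app h n)
    (hB : B ∈ V) (hBκ : B ⊆ κ) (hcard : CardLEIn V κ B) (hBseq : SeqClosed V W B) :
    IsJonssonIn W W κ := by
  refine ⟨hκ, fun ψ hψ hψf => ?_⟩
  have hκo := hκ.2.1
  have hωκ := hκo.subset_of_mem hω
  have hκV := isCardinalIn_of_bounded hWV hκ hω hbdd
  -- a cofinal sequence in `B` lies in `W`
  have hunb : ∀ α ∈ κ, ∃ b ∈ B, α ⊆ b := by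
    intro α hα
    by_contra! hcon
    exact hκV.2.2 α hα (hcard.trans (.of_subset hB fun b hb =>
      (ZFSet.IsOrdinal.not_subset_iff_mem (hκo.mem hα) (hκo.mem (hBκ hb))).1 (hcon b hb)))
  have : Param V h := ⟨hh⟩
  obtain ⟨x, hx, hxf, hxh⟩ := exists_choice_model omega_mem_model hB (fun n b => app h n ⊆ b)
    fun n hn => hunb _ (app_mem hhf hn)
  have hxcof : ∀ α ∈ κ, ∃ n ∈ ZFSet.omega, α ⊆ app x n := by
    intro α hα
    obtain ⟨n, hn, h⟩ := hcof α hα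
    exact ⟨n, hn, h.trans (hxh n hn)⟩
  have hne : B.Nonempty := by
    obtain ⟨b, hb, -⟩ := hunb _ hω
    exact ⟨b, hb⟩
  obtain ⟨Z, hZ, hBZ, hZκ, hZψ, hZseq⟩ :=
    exists_seqClosed_closure hWV hseqω hκV.1 hψ hψf hB hBκ hne hBseq
  obtain ⟨δ, hδ, hδZ⟩ : ∃ δ ∈ κ, δ ∉ Z := by
    by_contra! hcon
    exact hnot (hZseq.mono hcon)
  obtain ⟨θ, hθ, hθo, e, he, hef, hesurj, hlt⟩ := exists_orderType hZ fun z hz =>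
    hκo.mem (hZκ hz)
  have hκθ : κ ⊆ θ := by
    by_contra hcon
    exact hκV.2.2 θ ((ZFSet.IsOrdinal.not_subset_iff_mem hκo hθo).1 hcon) (hcard.trans
      ((CardLEIn.of_subset hB hBZ).trans (SameCardIn.of_app he hef
        (injective_of_increasing hθo hlt) hesurj).symm.cardLEIn))
  have hxW := hBseq x hx hxf
  have hxκ := isFunc_mono hxf hBκ
  obtain ⟨U, hU, hUne, hUapprox, hUsucc⟩ := exists_pruned_tree hWV hκ.1 hκo hωκ hbdd
    (mem_model_of_isFunc hψ hψf) hψ (mem_of_mem_model hκ.1 hδ) hxW hxκ hZ hZκ hδZ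
    (fun s hs hsZ => hZψ s (mem_finSubsets.2 ⟨hsZ, (mem_finSubsets.1 hs).2⟩))
    (fun a ha => app_mem hef (hκθ ha)) fun a ha b hb => hlt a (hκθ ha) b (hκθ hb)
  obtain ⟨Y, hY, hYκ, hδY, hYcard, hYψ⟩ :=
    exists_closed_of_pruned_tree hκ hωκ hψf hxW hxκ hxcof hU hUne hUapprox hUsucc
  exact ⟨Y, hY, hYκ, fun h => hδY (h ▸ hδ), hYcard, hYψ⟩

end InnerModel

open InnerModel
theorem mainTheorem12 (V W : Set ZFSet.{u})
    (hV : IsTransitiveModelZFC V) (hW : IsTransitiveModelZFC W) (hWV : W ⊆ V)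
    (hCP : CPIn V)
    (κ : ZFSet.{u}) (hκ : κ.IsOrdinal) (hc : ContinuumLTIn V κ)
    (hnew : ∃ X ∈ V, X ⊆ κ ∧ SameCardIn V X ZFSet.omega ∧ X ∉ W)
    (hleast : ∀ α ∈ κ, ∀ X ∈ V, X ⊆ α → SameCardIn V X ZFSet.omega → X ∈ W)
    (μ : ZFSet.{u}) (hμV : IsSuccCardIn V κ μ) (hμW : IsSuccCardIn W κ μ) :
    IsJonssonIn V W μ ∧
      ((∀ α ∈ κ, ∀ X ∈ V, X ⊆ α → X ∈ W) → IsJonssonIn W W κ) := by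
  have : Fact (IsTransitiveModelZFC V) := ⟨hV⟩
  have : Fact (IsTransitiveModelZFC W) := ⟨hW⟩
  have hκW : κ ∈ W := mem_of_mem_model hμW.1.1 hμW.2.1
  have hω := omega_mem_of_continuumLTIn hκ hc
  have hωκ := hκ.subset_of_mem hω
  have hκμ := hμV.1.2.1.subset_of_mem hμV.2.1
  have hseq : ∀ α ∈ κ, SeqClosed V W α := fun α hα =>
    seqClosed_of_mem hWV hκ hκW hω hleast hα
  have hnot := not_seqClosed hnew
  have hκcard := isCardinalIn_of_new hWV hκ hκW hnot hseq
  obtain ⟨h, hh, hhf, hcof⟩ := exists_cofinal_seq hκ hnew hleast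
  obtain ⟨K, hK, hKseq⟩ := exists_coveringMatrix hWV hω hc hκcard hseq hh hhf hcof hμV hμW
  have hμreg := hμV.isRegularIn hωκ
  have hcμ : ContinuumLTIn V μ := by
    obtain ⟨c, hcκ, hc⟩ := hc
    exact ⟨c, hκμ hcκ, hc⟩
  obtain ⟨A, hA, hAμ, hunb, hAseq⟩ :=
    (hCP μ hμV.1.1 hμreg hcμ).exists_seqClosed hμV.1 (hωκ.trans hκμ) hK hKseq
  refine ⟨isJonssonIn_of_seqClosed hWV (hseq _ hω) hκμ hμreg hnot hA hAμ hunb hAseq,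
    fun hbdd => ?_⟩
  obtain ⟨B, hB, hBκ, hcard, hBseq⟩ :=
    exists_seqClosed_subset hWV hωκ hμV hμW hA hAμ hunb hAseq
  exact isJonssonIn_of_bounded hWV hκcard hω (hseq _ hω) hnot hbdd hh hhf hcof hB hBκ hcard hBseq
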